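/- Let $u\in C^1(\mathbb{R})$ be real-valued and monotone (not necessarily strictly) with $u(x)\to 0$ as $x\to-\infty$ and $u(x)\to 2\pi$ as $x\to+\infty$ (so that its topological charge is $Q_{top}=1$), and suppose that $\sin(u/2)$ and $1-|\cos(u/2)|$ belong to $L^1(\mathbb{R})$. Consider the scattering problem $$\Phi_x=\tfrac14\left(z-\tfrac1z\right)\cos\left(\tfrac u2\right)\begin{pmatrix}-i&0\\0&i\end{pmatrix}\Phi+\tfrac14\left(z+\tfrac1z\right)\sin\left(\tfrac u2\right)\begin{pmatrix}0&i\\i&0\end{pmatrix}\Phi,\qquad \Phi:\mathbb{R}\to\mathbb{C}^2,\tag{1}$$ and call $z\in\mathbb{C}\setminus\{0\}$ an eigenvalue if (1) has a solution $\Phi\not\equiv0$ in $L^2(\mathbb{R};\mathbb{C}^2)$. For $\operatorname{Im}z>0$ put $E(x,z)=\exp\left(-\tfrac i4\left(z-\tfrac1z\right)\int_0^x\cos(u/2)\,dy\right)$, and let $\Psi^{\pm}(\cdot,z)$ be the Jost solutions, i.e. the solutions of (1) with $E(x,z)^{-1}\Psi^{\pm}(x,z)\to(1,0)^T$ as $x\to\pm\infty$;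 let $W(z)=\Psi^-_1\Psi^+_2-\Psi^-_2\Psi^+_1$ be their Wronskian, which does not depend on $x$. An eigenvalue $z$ with $\operatorname{Im}z>0$ is called simple if the space of $L^2$ solutions of (1) is one-dimensional and $z$ is a simple zero of $W$, i.e. $W(z)=0$ and $W'(z)\neq0$. Let $I=\int_{\mathbb{R}}\sin(u/2)\,dx$ and let $N$ be the largest integer with $I>2N\pi$. Then there are exactly $2N+1$ eigenvalues in the open upper half plane $\{\operatorname{Im}z>0\}$. All of them lie on the unit circle $|z|=1$ and are simple, and $z=i$ is always one of them. -/

import Mathlib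

open MeasureTheory Filter Topology

noncomputable section

namespace SineGordonScattering

/-- A monotone potential of topological charge one: a real `C¹` function increasing from `0` to
`2π`, with the standard integrability assumptions of the scattering problem. -/
structure IsMonotoneKink (u : ℝ → ℝ) : Prop where
  contDiff : ContDiff ℝ 1 u
  monotone : Monotone u
  tendsto_atBot : Tendsto u atBot (𝓝 0)
  tendsto_atTop : Tendsto u atTop (𝓝 (2 * Real.pi))
  integrable_sin : Integrable (fun x : ℝ => Real.sin (u x / 2))
  integrable_cos : Integrable (fun x : ℝ => 1 - |Real.cos (u x / 2)|)

def tau1 : Matrix (Fin 2) (Fin 2) ℂ := !![-Complex.I, 0; 0, Complex.I]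

def tau2 : Matrix (Fin 2) (Fin 2) ℂ := !![0, Complex.I; Complex.I, 0]

/-- The coefficient matrix of the scattering problem for stationary data (`u_t = 0`). -/
def coeff (u : ℝ → ℝ) (z : ℂ) (x : ℝ) : Matrix (Fin 2) (Fin 2) ℂ :=
  ((1 / 4 : ℂ) * (z - 1 / z) * (Real.cos (u x / 2) : ℂ)) • tau1
    + ((1 / 4 : ℂ) * (z + 1 / z) * (Real.sin (u x / 2) : ℂ)) • tau2

/-- `Φ` solves the scattering problem `Φ' = coeff u z Φ` on the whole line. -/
def IsSolution (u : ℝ → ℝ) (z : ℂ) (Φ : ℝ → Fin 2 → ℂ) : Prop :=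
  ∀ x : ℝ, HasDerivAt Φ ((coeff u z x).mulVec (Φ x)) x

/-- The space of square integrable solutions. (The norm used on `ℂ²` is irrelevant for
square integrability.) -/
def eigenspace (u : ℝ → ℝ) (z : ℂ) : Submodule ℂ (ℝ → Fin 2 → ℂ) where
  carrier := {Φ | IsSolution u z Φ ∧ MemLp Φ 2 volume}
  zero_mem' := by
    refine ⟨fun x => ?_, MemLp.zero⟩
    have h : (coeff u z x).mulVec ((0 : ℝ → Fin 2 → ℂ) x) = 0 := by
      simp
    rw [h]
    exact hasDerivAt_const x (0 : Fin 2 → ℂ)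
  add_mem' := by
    rintro Φ Ψ ⟨h1, h2⟩ ⟨h3, h4⟩
    refine ⟨fun x => ?_, h2.add h4⟩
    have h := (h1 x).add (h3 x)
    rw [← Matrix.mulVec_add] at h
    exact h
  smul_mem' := by
    rintro c Φ ⟨h1, h2⟩
    refine ⟨fun x => ?_, h2.const_smul c⟩
    have h := (h1 x).const_smul c
    rw [← Matrix.mulVec_smul] at h
    exact h

/-- `z ≠ 0` is an eigenvalue if there is a nontrivial square integrable solution. -/
def IsEigenvalue (u : ℝ → ℝ) (z : ℂ) : Prop :=
  z ≠ 0 ∧ eigenspace u z ≠ ⊥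

/-- The scalar factor of the Jost asymptotics: since `(1, 0)` is an eigenvector of `tau1` with
eigenvalue `-i`, one has
`exp (1/4 (z - 1/z) (∫₀ˣ cos (u/2)) tau1) (1, 0) = jostFactor u z x • (1, 0)`. -/
def jostFactor (u : ℝ → ℝ) (z : ℂ) (x : ℝ) : ℂ :=
  Complex.exp (-Complex.I * ((1 / 4 : ℂ) * (z - 1 / z)) *
    ((∫ y in (0 : ℝ)..x, Real.cos (u y / 2) : ℝ) : ℂ))

/-- `Ψ` is the Jost solution at `-∞`: `Ψ ∼ jostFactor u z x • (1, 0)` as `x → -∞`. -/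
def IsLeftJost (u : ℝ → ℝ) (z : ℂ) (Ψ : ℝ → Fin 2 → ℂ) : Prop :=
  IsSolution u z Ψ ∧
    Tendsto (fun x : ℝ => (jostFactor u z x)⁻¹ • Ψ x) atBot (𝓝 ![1, 0])

/-- `Φ` is the Jost solution at `+∞`: `Φ ∼ jostFactor u z x • (1, 0)` as `x → +∞`. -/
def IsRightJost (u : ℝ → ℝ) (z : ℂ) (Φ : ℝ → Fin 2 → ℂ) : Prop :=
  IsSolution u z Φ ∧
    Tendsto (fun x : ℝ => (jostFactor u z x)⁻¹ • Φ x) atTop (𝓝 ![1, 0])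

/-- `w` is the Wronskian (constant in `x`) of the two Jost solutions at `z`. -/
def IsJostWronskian (u : ℝ → ℝ) (z w : ℂ) : Prop :=
  ∃ Ψ Φ : ℝ → Fin 2 → ℂ, IsLeftJost u z Ψ ∧ IsRightJost u z Φ ∧
    ∀ x : ℝ, Ψ x 0 * Φ x 1 - Ψ x 1 * Φ x 0 = w

/-- An eigenvalue `z` in the upper half plane is simple if its eigenspace is one-dimensional and
it is a simple zero of the Wronskian `W` of the Jost solutions, as a function on the upper half
plane. (The Jost solutions are uniquely determined there, hence so is `W`.) -/
def IsSimple (u : ℝ → ℝ) (z : ℂ) : Prop :=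
  Module.finrank ℂ (eigenspace u z) = 1 ∧
    ∃ W : ℂ → ℂ, (∀ ζ : ℂ, 0 < ζ.im → IsJostWronskian u ζ (W ζ)) ∧
      W z = 0 ∧ deriv W z ≠ 0

end SineGordonScattering

end

noncomputable section
namespace SineGordonScattering

/-! Write a = (z - 1/z)/4, b = (z + 1/z)/4, c = cos(u/2), s = sin(u/2). Since c → 1 at -∞ and c → -1
at +∞, for Im z > 0 the solutions decaying at a given end form a line, spanned by the solution
normalized there, and z is an eigenvalue exactly when the two normalized solutions have vanishing
Wronskian. The reflection u(x) ↦ 2π - u(-x) exchanges the two ends, so only -∞ has to be studied.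

Everything rests on one inequality, `integral_cos_mul_interaction_nonneg`. If u(x₀) = π and Φ is
square integrable near -∞, then ∫ c Im(b̄ Φ̄₀Φ₁) ≥ 0 over (-∞, x₀]. Indeed (|Φ₁|²)' = -2 (Im a) c
|Φ₁|² + 2 s Im(b̄ Φ̄₀Φ₁). Multiply by cot(u/2), which is nonincreasing because u is monotone and
vanishes at x₀, and integrate by parts.

First consequence: integrating (Φ̄₀Φ₁)' over the line, with the inequality on both half lines,
forces every square integrable solution off the unit circle to vanish (`eq_zero_of_norm_ne_one`).

Second consequence: by Green's identity, the Wronskian at x₀ of the left solutions at z and ζ is (ζ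
- z) K(z, ζ) with K continuous at ζ = z. On the circle, where the first component is real and the
second imaginary, K(z, z) = -m/(2z) with m > 0 (`exists_greenKernel_eq`). The same sign at both ends
makes each zero of the Wronskian on the circle simple (`exists_normalizedWronskian_eq`).

It also gives the count. For z = exp(iθ), the sum of the two components is a nonvanishing complex
number whose continuous argument at x₀ strictly decreases in θ. Adding the contributions of both
ends yields a phase δ on (0, π), odd about π/2, with limit I/2 at 0, where I = ∫ s, such that
exp(iθ) is an eigenvalue iff δ(θ) ∈ πℤ (`exists_phase`). Thus δ maps (0, π) bijectively onto (-I/2,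
I/2), and the eigenvalues correspond to the integers k with |k|π < I/2, that is |k| ≤ N; k = 0 is θ
= π/2, i.e. z = i. -/

/-- The coefficient of the diagonal part of the scattering problem. -/
def diagCoeff (z : ℂ) : ℂ := (1 / 4 : ℂ) * (z - 1 / z)

/-- The coefficient of the off-diagonal part of the scattering problem. -/
def offCoeff (z : ℂ) : ℂ := (1 / 4 : ℂ) * (z + 1 / z)

/-! ### The system in components, uniqueness, Wronskians -/

lemma isSolution_iff {u : ℝ → ℝ} {z : ℂ} {Φ : ℝ → Fin 2 → ℂ} :
    IsSolution u z Φ ↔ ∀ x,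
      HasDerivAt (fun x => Φ x 0) (-Complex.I * diagCoeff z * (Real.cos (u x / 2) : ℂ) * Φ x 0
        + Complex.I * offCoeff z * (Real.sin (u x / 2) : ℂ) * Φ x 1) x ∧
      HasDerivAt (fun x => Φ x 1) (Complex.I * offCoeff z * (Real.sin (u x / 2) : ℂ) * Φ x 0
        + Complex.I * diagCoeff z * (Real.cos (u x / 2) : ℂ) * Φ x 1) x := by
  unfold IsSolution
  refine forall_congr' fun x => ?_
  rw [hasDerivAt_pi, Fin.forall_fin_two]
  have h0 : ((coeff u z x).mulVec (Φ x)) 0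
      = -Complex.I * diagCoeff z * (Real.cos (u x / 2) : ℂ) * Φ x 0
        + Complex.I * offCoeff z * (Real.sin (u x / 2) : ℂ) * Φ x 1 := by
    simp [coeff, tau1, tau2, Matrix.mulVec, dotProduct, Fin.sum_univ_two, diagCoeff, offCoeff]
    ring
  have h1 : ((coeff u z x).mulVec (Φ x)) 1
      = Complex.I * offCoeff z * (Real.sin (u x / 2) : ℂ) * Φ x 0
        + Complex.I * diagCoeff z * (Real.cos (u x / 2) : ℂ) * Φ x 1 := by
    simp [coeff, tau1, tau2, Matrix.mulVec, dotProduct, Fin.sum_univ_two, diagCoeff, offCoeff]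
    ring
  rw [h0, h1]

lemma IsSolution.continuous {u : ℝ → ℝ} {z : ℂ} {Φ : ℝ → Fin 2 → ℂ} (h : IsSolution u z Φ) :
    Continuous Φ :=
  continuous_iff_continuousAt.2 fun x => (h x).continuousAt

lemma IsSolution.smul {u : ℝ → ℝ} {z : ℂ} {Φ : ℝ → Fin 2 → ℂ} (h : IsSolution u z Φ) (k : ℂ) :
    IsSolution u z (fun x => k • Φ x) := fun x => by
  have := (h x).const_smul k
  rw [← Matrix.mulVec_smul] at this
  exact this

lemma IsSolution.sub {u : ℝ → ℝ} {z : ℂ} {Φ Ψ : ℝ → Fin 2 → ℂ} (h : IsSolution u z Φ)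
    (h' : IsSolution u z Ψ) : IsSolution u z (fun x => Φ x - Ψ x) := fun x => by
  have := (h x).sub (h' x)
  rw [← Matrix.mulVec_sub] at this
  exact this

/-- A solution of the scattering problem that vanishes at one point vanishes identically. -/
lemma IsSolution.eq_zero {u : ℝ → ℝ} {z : ℂ} {Φ : ℝ → Fin 2 → ℂ} (h : IsSolution u z Φ)
    {x₀ : ℝ} (h0 : Φ x₀ = 0) (x : ℝ) : Φ x = 0 := by
  -- As |cos| and |sin| are at most 1, the coefficient matrix is bounded in the sup norm by |a| +
  -- |b| for all x, which makes global uniqueness available.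
  set K : NNReal := ⟨‖diagCoeff z‖ + ‖offCoeff z‖, by positivity⟩
  have key : ∀ t, LipschitzWith K (fun v : Fin 2 → ℂ => (coeff u z t).mulVec v) := by
    intro t
    refine LipschitzWith.of_dist_le_mul fun v w => ?_
    rw [dist_eq_norm, dist_eq_norm, ← Matrix.mulVec_sub]
    generalize v - w = y
    have hc : ‖(Real.cos (u t / 2) : ℂ)‖ ≤ 1 := by
      rw [Complex.norm_real]; exact Real.abs_cos_le_one _
    have hs : ‖(Real.sin (u t / 2) : ℂ)‖ ≤ 1 := by
      rw [Complex.norm_real]; exact Real.abs_sin_le_one _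
    have hK : (K : ℝ) = ‖diagCoeff z‖ + ‖offCoeff z‖ := rfl
    have gen : ∀ (α β γ δ : ℂ), ‖γ‖ ≤ 1 → ‖δ‖ ≤ 1 → ‖α‖ = ‖diagCoeff z‖ → ‖β‖ = ‖offCoeff z‖ →
        ∀ i j, ‖α * γ * y i + β * δ * y j‖ ≤ K * ‖y‖ := by
      intro α β γ δ h1 h2 h3 h4 i j
      calc ‖α * γ * y i + β * δ * y j‖ ≤ ‖α‖ * ‖γ‖ * ‖y i‖ + ‖β‖ * ‖δ‖ * ‖y j‖ := by
            refine (norm_add_le _ _).trans ?_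
            simp only [norm_mul, le_refl]
        _ ≤ ‖α‖ * 1 * ‖y‖ + ‖β‖ * 1 * ‖y‖ := by
            gcongr
            · exact norm_le_pi_norm y i
            · exact norm_le_pi_norm y j
        _ = K * ‖y‖ := by rw [hK, h3, h4]; ring
    rw [pi_norm_le_iff_of_nonneg (by positivity), Fin.forall_fin_two]
    constructor
    · have := gen (-Complex.I * diagCoeff z) (Complex.I * offCoeff z) _ _ hc hs (by simp)
        (by simp) 0 1
      refine le_trans (le_of_eq (congrArg _ ?_)) this
      simp [coeff, tau1, tau2, Matrix.mulVec, dotProduct, Fin.sum_univ_two, diagCoeff, offCoeff]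
      ring
    · have := gen (Complex.I * diagCoeff z) (Complex.I * offCoeff z) _ _ hc hs (by simp)
        (by simp) 1 0
      refine le_trans (le_of_eq (congrArg _ ?_)) this
      simp [coeff, tau1, tau2, Matrix.mulVec, dotProduct, Fin.sum_univ_two, diagCoeff, offCoeff]
      ring
  have := ODE_solution_unique_univ (v := fun t v => (coeff u z t).mulVec v) (s := fun _ => Set.univ)
    (K := K) (f := Φ) (g := fun _ => 0) (t₀ := x₀)
    (fun t => (key t).lipschitzOnWith) (fun t => ⟨h t, trivial⟩)
    (fun t => ⟨by rw [Matrix.mulVec_zero]; exact hasDerivAt_const _ _, trivial⟩) h0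
  exact congrFun this x

/-- The Wronskian of two vector valued functions. -/
def wronskian (Φ Ψ : ℝ → Fin 2 → ℂ) (x : ℝ) : ℂ := Φ x 0 * Ψ x 1 - Φ x 1 * Ψ x 0

/-- Two spectral parameters are allowed because both cases are needed: equal ones give constancy,
distinct ones give Green's identity after integration. -/
lemma hasDerivAt_wronskian {u : ℝ → ℝ} {z ζ : ℂ} {Φ Ψ : ℝ → Fin 2 → ℂ}
    (h : IsSolution u z Φ) (h' : IsSolution u ζ Ψ) (x : ℝ) :
    HasDerivAt (wronskian Φ Ψ)
      (Complex.I * (diagCoeff ζ - diagCoeff z) * (Real.cos (u x / 2) : ℂ)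
          * (Φ x 0 * Ψ x 1 + Φ x 1 * Ψ x 0)
        + Complex.I * (offCoeff ζ - offCoeff z) * (Real.sin (u x / 2) : ℂ)
          * (Φ x 0 * Ψ x 0 - Φ x 1 * Ψ x 1)) x := by
  obtain ⟨h0, h1⟩ := isSolution_iff.1 h x
  obtain ⟨k0, k1⟩ := isSolution_iff.1 h' x
  refine ((h0.mul k1).sub (h1.mul k0)).congr_deriv ?_
  ring

lemma wronskian_const {u : ℝ → ℝ} {z : ℂ} {Φ Ψ : ℝ → Fin 2 → ℂ}
    (h : IsSolution u z Φ) (h' : IsSolution u z Ψ) (x y : ℝ) :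
    wronskian Φ Ψ x = wronskian Φ Ψ y := by
  refine is_const_of_deriv_eq_zero (fun t => (hasDerivAt_wronskian h h' t).differentiableAt)
    (fun t => ?_) x y
  rw [(hasDerivAt_wronskian h h' t).deriv]
  simp

/-- Two solutions with vanishing Wronskian are linearly dependent. -/
lemma exists_smul_of_wronskian_eq_zero {u : ℝ → ℝ} {z : ℂ} {Φ Ψ : ℝ → Fin 2 → ℂ}
    (h : IsSolution u z Φ) (h' : IsSolution u z Ψ) {x₀ : ℝ} (h0 : Ψ x₀ ≠ 0)
    (hw : wronskian Φ Ψ x₀ = 0) : ∃ k : ℂ, ∀ x, Φ x = k • Ψ x := by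
  have hk : ∃ k : ℂ, Φ x₀ = k • Ψ x₀ := by
    unfold wronskian at hw
    by_cases h1 : Ψ x₀ 0 = 0
    · have h2 : Ψ x₀ 1 ≠ 0 := by
        intro h2; apply h0; ext i; fin_cases i <;> simp [h1, h2]
      refine ⟨Φ x₀ 1 / Ψ x₀ 1, ?_⟩
      rw [h1] at hw
      have : Φ x₀ 0 = 0 := by
        have h3 : Φ x₀ 0 * Ψ x₀ 1 = 0 := by linear_combination hw
        exact (mul_eq_zero.1 h3).resolve_right h2
      ext i; fin_cases i <;> simp [h1, h2, this]
    · refine ⟨Φ x₀ 0 / Ψ x₀ 0, ?_⟩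
      ext i
      fin_cases i
      · simp [h1]
      · simp only [Fin.mk_one, Pi.smul_apply, smul_eq_mul]
        field_simp
        linear_combination -hw
  obtain ⟨k, hk⟩ := hk
  refine ⟨k, fun x => ?_⟩
  exact sub_eq_zero.1 ((h.sub (h'.smul k)).eq_zero (x₀ := x₀) (sub_eq_zero.2 hk) x)

lemma tendsto_wronskian_zero {l : Filter ℝ} {Φ Ψ : ℝ → Fin 2 → ℂ} (h : Tendsto Φ l (𝓝 0))
    (h' : Tendsto Ψ l (𝓝 0)) : Tendsto (wronskian Φ Ψ) l (𝓝 0) := by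
  rw [tendsto_pi_nhds] at h h'
  have := ((h 0).mul (h' 1)).sub ((h 1).mul (h' 0))
  simp only [Pi.zero_apply, mul_zero, sub_zero] at this
  exact this

/-- Two solutions that tend to zero at the same end are linearly dependent. -/
lemma exists_smul_of_tendsto_zero {u : ℝ → ℝ} {z : ℂ} {Φ Ψ : ℝ → Fin 2 → ℂ} {l : Filter ℝ}
    [l.NeBot] (h : IsSolution u z Φ) (h' : IsSolution u z Ψ) {x₀ : ℝ} (h0 : Ψ x₀ ≠ 0)
    (hl : Tendsto Φ l (𝓝 0)) (hl' : Tendsto Ψ l (𝓝 0)) : ∃ k : ℂ, ∀ x, Φ x = k • Ψ x := by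
  refine exists_smul_of_wronskian_eq_zero h h' h0 ?_
  have h1 := tendsto_wronskian_zero hl hl'
  have h2 : wronskian Φ Ψ = fun _ => wronskian Φ Ψ x₀ := funext fun x => wronskian_const h h' x x₀
  rw [h2] at h1
  exact tendsto_nhds_unique tendsto_const_nhds h1

/-! ### Real and imaginary parts of the coefficients -/

lemma diagCoeff_re (z : ℂ) : (diagCoeff z).re = z.re * (1 - (Complex.normSq z)⁻¹) / 4 := by
  simp [diagCoeff, Complex.inv_re]; ring

lemma diagCoeff_im (z : ℂ) : (diagCoeff z).im = z.im * (1 + (Complex.normSq z)⁻¹) / 4 := by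
  simp [diagCoeff, Complex.inv_im]; ring

lemma offCoeff_re (z : ℂ) : (offCoeff z).re = z.re * (1 + (Complex.normSq z)⁻¹) / 4 := by
  simp [offCoeff, Complex.inv_re]; ring

lemma offCoeff_im (z : ℂ) : (offCoeff z).im = z.im * (1 - (Complex.normSq z)⁻¹) / 4 := by
  simp [offCoeff, Complex.inv_im]; ring

lemma ne_zero_of_im_pos {z : ℂ} (hz : 0 < z.im) : z ≠ 0 := by
  rintro rfl; simp at hz

lemma diagCoeff_im_pos {z : ℂ} (hz : 0 < z.im) : 0 < (diagCoeff z).im := by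
  rw [diagCoeff_im]
  have : 0 ≤ (Complex.normSq z)⁻¹ := inv_nonneg.2 (Complex.normSq_nonneg z)
  positivity

/-! ### Reflection: exchanging the two ends of the line -/

/-- The reflected potential `x ↦ 2π - u (-x)`. -/
def reflect (u : ℝ → ℝ) (x : ℝ) : ℝ := 2 * Real.pi - u (-x)

/-- The reflection of a solution. -/
def reflectSol (Φ : ℝ → Fin 2 → ℂ) (x : ℝ) : Fin 2 → ℂ := ![Φ (-x) 0, -Φ (-x) 1]

lemma reflect_reflect (u : ℝ → ℝ) : reflect (reflect u) = u := by
  ext x; simp [reflect]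

lemma reflectSol_reflectSol (Φ : ℝ → Fin 2 → ℂ) : reflectSol (reflectSol Φ) = Φ := by
  ext x i; fin_cases i <;> simp [reflectSol]

lemma cos_reflect (u : ℝ → ℝ) (x : ℝ) :
    Real.cos (reflect u x / 2) = -Real.cos (u (-x) / 2) := by
  rw [reflect, show (2 * Real.pi - u (-x)) / 2 = Real.pi - u (-x) / 2 by ring, Real.cos_pi_sub]

lemma sin_reflect (u : ℝ → ℝ) (x : ℝ) :
    Real.sin (reflect u x / 2) = Real.sin (u (-x) / 2) := by
  rw [reflect, show (2 * Real.pi - u (-x)) / 2 = Real.pi - u (-x) / 2 by ring, Real.sin_pi_sub]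

lemma IsMonotoneKink.reflect {u : ℝ → ℝ} (hu : IsMonotoneKink u) :
    IsMonotoneKink (reflect u) where
  contDiff := contDiff_const.sub (hu.contDiff.comp contDiff_neg)
  monotone := fun x y hxy => by
    have := hu.monotone (neg_le_neg hxy)
    simp only [SineGordonScattering.reflect]; linarith
  tendsto_atBot := by
    have := (hu.tendsto_atTop.comp tendsto_neg_atBot_atTop).const_sub (2 * Real.pi)
    rw [sub_self] at this
    exact this
  tendsto_atTop := by
    have := (hu.tendsto_atBot.comp tendsto_neg_atTop_atBot).const_sub (2 * Real.pi)
    rw [sub_zero] at this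
    exact this
  integrable_sin := by
    simp only [sin_reflect]; exact hu.integrable_sin.comp_neg
  integrable_cos := by
    simp only [cos_reflect, abs_neg]; exact hu.integrable_cos.comp_neg

/-- Reversing x changes the sign of the whole system. The sign flip of cos(u/2) compensates this on
the diagonal, the sign of the second component off the diagonal. -/
lemma IsSolution.reflectSol {u : ℝ → ℝ} {z : ℂ} {Φ : ℝ → Fin 2 → ℂ} (h : IsSolution u z Φ) :
    IsSolution (reflect u) z (reflectSol Φ) := by
  rw [isSolution_iff] at h ⊢
  intro x
  obtain ⟨h0, h1⟩ := h (-x)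
  rw [cos_reflect, sin_reflect]
  have hn := hasDerivAt_neg x
  constructor
  · refine (h0.scomp x hn).congr_deriv ?_
    simp [SineGordonScattering.reflectSol]
  · refine (h1.scomp x hn).neg.congr_deriv ?_
    simp [SineGordonScattering.reflectSol]; ring

/-! ### Elementary properties of monotone kinks -/

section Kink
variable {u : ℝ → ℝ} (hu : IsMonotoneKink u)
include hu

lemma IsMonotoneKink.continuous : Continuous u := hu.contDiff.continuous

lemma IsMonotoneKink.nonneg (x : ℝ) : 0 ≤ u x := hu.monotone.le_of_tendsto hu.tendsto_atBot x

lemma IsMonotoneKink.le_two_pi (x : ℝ) : u x ≤ 2 * Real.pi :=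
  hu.monotone.ge_of_tendsto hu.tendsto_atTop x

lemma IsMonotoneKink.sin_nonneg (x : ℝ) : 0 ≤ Real.sin (u x / 2) :=
  Real.sin_nonneg_of_nonneg_of_le_pi (by linarith [hu.nonneg x]) (by linarith [hu.le_two_pi x])

lemma IsMonotoneKink.exists_eq_pi : ∃ x₀, u x₀ = Real.pi := by
  have h := mem_range_of_exists_le_of_exists_ge hu.continuous (c := Real.pi) ?_ ?_
  · exact h
  · exact ((hu.tendsto_atBot.eventually (eventually_le_nhds Real.pi_pos))).exists
  · exact ((hu.tendsto_atTop.eventually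
      (eventually_ge_nhds (by linarith [Real.pi_pos] : Real.pi < 2 * Real.pi)))).exists

lemma IsMonotoneKink.continuous_cos : Continuous fun x => Real.cos (u x / 2) := by
  have := hu.continuous; fun_prop

lemma IsMonotoneKink.continuous_sin : Continuous fun x => Real.sin (u x / 2) := by
  have := hu.continuous; fun_prop

lemma IsMonotoneKink.cos_nonneg {x₀ x : ℝ} (h0 : u x₀ = Real.pi) (hx : x ≤ x₀) :
    0 ≤ Real.cos (u x / 2) := by
  have := hu.monotone hx
  exact Real.cos_nonneg_of_neg_pi_div_two_le_of_le
    (by linarith [hu.nonneg x, Real.pi_pos]) (by linarith)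

/-- The hypothesis concerns 1 - |cos|, which agrees with 1 - cos to the left of a point where u = π.
Only left half lines are possible, since 1 - cos → 2 at +∞. -/
lemma IsMonotoneKink.integrableOn_one_sub_cos (x : ℝ) :
    IntegrableOn (fun x => 1 - Real.cos (u x / 2)) (Set.Iic x) := by
  obtain ⟨x₀, h0⟩ := hu.exists_eq_pi
  have h1 : IntegrableOn (fun x => 1 - Real.cos (u x / 2)) (Set.Iic x₀) := by
    refine (hu.integrable_cos.integrableOn (s := Set.Iic x₀)).congr_fun (fun y hy => ?_)
      measurableSet_Iic
    simp only [abs_of_nonneg (hu.cos_nonneg h0 hy)]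
  have h2 : IntegrableOn (fun x => 1 - Real.cos (u x / 2)) (Set.Icc x₀ x) :=
    (continuous_const.sub hu.continuous_cos).continuousOn.integrableOn_Icc
  refine (h1.union h2).mono_set fun y hy => ?_
  rcases le_total y x₀ with h | h
  · exact Or.inl h
  · exact Or.inr ⟨h, hy⟩

end Kink

/-! ### Primitives from -∞ and the exponential weight -/

section IicPrimitive
variable {E : Type*} [NormedAddCommGroup E] [NormedSpace ℝ E] [CompleteSpace E]

lemma hasDerivAt_integral_Iic {F : ℝ → E} (hF : Continuous F)
    (hi : ∀ x, IntegrableOn F (Set.Iic x)) (x : ℝ) :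
    HasDerivAt (fun x => ∫ y in Set.Iic x, F y) (F x) x := by
  have h1 : (fun x => ∫ y in Set.Iic x, F y)
      = fun x => (∫ y in Set.Iic 0, F y) + ∫ y in (0 : ℝ)..x, F y := by
    ext t
    rw [← intervalIntegral.integral_Iic_sub_Iic (hi 0) (hi t)]
    abel
  rw [h1]
  exact (intervalIntegral.integral_hasDerivAt_right (hF.intervalIntegrable _ _)
    hF.aestronglyMeasurable.stronglyMeasurableAtFilter hF.continuousAt).const_add _

end IicPrimitive

/-- The density of the weight controlling the Volterra equation for the left Jost solution. -/
def weightRate (u : ℝ → ℝ) (x : ℝ) : ℝ := Real.sin (u x / 2) + (1 - Real.cos (u x / 2))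

/-- The weight controlling the Volterra equation for the left Jost solution. -/
def weight (u : ℝ → ℝ) (L x : ℝ) : ℝ := L * ∫ y in Set.Iic x, weightRate u y

section Weight
variable {u : ℝ → ℝ} (hu : IsMonotoneKink u) {L : ℝ} (hL : 0 ≤ L)
include hu

lemma continuous_weightRate : Continuous (weightRate u) :=
  hu.continuous_sin.add (continuous_const.sub hu.continuous_cos)

lemma weightRate_nonneg (x : ℝ) : 0 ≤ weightRate u x :=
  add_nonneg (hu.sin_nonneg x) (sub_nonneg.2 (Real.cos_le_one _))

lemma integrableOn_weightRate (x : ℝ) : IntegrableOn (weightRate u) (Set.Iic x) :=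
  hu.integrable_sin.integrableOn.add (hu.integrableOn_one_sub_cos x)

lemma hasDerivAt_weight (x : ℝ) : HasDerivAt (weight u L) (L * weightRate u x) x :=
  (hasDerivAt_integral_Iic (continuous_weightRate hu) (integrableOn_weightRate hu) x).const_mul L

lemma continuous_weight : Continuous (weight u L) :=
  continuous_iff_continuousAt.2 fun x => (hasDerivAt_weight hu x).continuousAt

omit hu in
lemma tendsto_weight : Tendsto (weight u L) atBot (𝓝 0) := by
  have := (tendsto_integral_Iic_zero (f := weightRate u) (μ := volume) tendsto_id).const_mul L
  rw [mul_zero] at this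
  exact this

include hL

lemma weight_nonneg (x : ℝ) : 0 ≤ weight u L x :=
  mul_nonneg hL (setIntegral_nonneg measurableSet_Iic fun y _ => weightRate_nonneg hu y)

lemma weight_mono : Monotone (weight u L) :=
  monotone_of_hasDerivAt_nonneg (fun x => hasDerivAt_weight hu x)
    fun x => mul_nonneg hL (weightRate_nonneg hu x)

lemma integrableOn_weightRate_mul_exp (x : ℝ) :
    IntegrableOn (fun y => L * weightRate u y * Real.exp (2 * weight u L y)) (Set.Iic x) := by
  have hc : Continuous (fun y => Real.exp (2 * weight u L y)) :=
    Real.continuous_exp.comp (continuous_const.mul (continuous_weight hu))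
  refine Integrable.mono' (((integrableOn_weightRate hu x).const_mul L).mul_const
    (Real.exp (2 * weight u L x)))
    (((continuous_const.mul (continuous_weightRate hu)).mul hc).aestronglyMeasurable) ?_
  filter_upwards [ae_restrict_mem measurableSet_Iic] with y hy
  have h1 := mul_nonneg hL (weightRate_nonneg hu y)
  rw [Real.norm_of_nonneg (mul_nonneg h1 (Real.exp_pos _).le)]
  refine mul_le_mul_of_nonneg_left (Real.exp_le_exp.2 ?_) h1
  have := weight_mono hu hL (Set.mem_Iic.1 hy)
  linarith

/-- The integrand is half the derivative of exp(2w). This factor 1/2, whatever the size of L and of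
the potential, is what makes the Volterra operator a contraction in the norm weighted by exp(2w). -/
lemma integral_weightRate_mul_exp (x : ℝ) :
    ∫ y in Set.Iic x, L * weightRate u y * Real.exp (2 * weight u L y)
      = (Real.exp (2 * weight u L x) - 1) / 2 := by
  have h := integral_Iic_of_hasDerivAt_of_tendsto'
    (f := fun y => Real.exp (2 * weight u L y) / 2) (m := 1 / 2) (a := x)
    (f' := fun y => L * weightRate u y * Real.exp (2 * weight u L y)) ?_
    (integrableOn_weightRate_mul_exp hu hL x) ?_
  · rw [h]; ring
  · intro y _
    refine ((((hasDerivAt_weight hu (L := L) y).const_mul 2).exp).div_const 2).congr_deriv ?_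
    ring
  · have : Tendsto (fun y => Real.exp (2 * weight u L y) / 2) atBot
        (𝓝 (Real.exp (2 * 0) / 2)) :=
      ((Real.continuous_exp.tendsto _).comp ((tendsto_weight (u := u)).const_mul 2)).div_const 2
    simpa using this

variable {F : ℝ → ℂ} {M : ℝ}

lemma norm_integral_Iic_le {x : ℝ}
    (hb : ∀ y ≤ x, ‖F y‖ ≤ M * (L * weightRate u y * Real.exp (2 * weight u L y))) :
    ‖∫ y in Set.Iic x, F y‖ ≤ M * ((Real.exp (2 * weight u L x) - 1) / 2) := by
  rw [← integral_weightRate_mul_exp hu hL, ← integral_const_mul]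
  refine norm_integral_le_of_norm_le ((integrableOn_weightRate_mul_exp hu hL x).const_mul M) ?_
  filter_upwards [ae_restrict_mem measurableSet_Iic] with y hy using hb y hy

lemma integrableOn_of_norm_le (hF : Continuous F) {x : ℝ}
    (hb : ∀ y ≤ x, ‖F y‖ ≤ M * (L * weightRate u y * Real.exp (2 * weight u L y))) :
    IntegrableOn F (Set.Iic x) := by
  refine Integrable.mono' ((integrableOn_weightRate_mul_exp hu hL x).const_mul M)
    hF.aestronglyMeasurable ?_
  filter_upwards [ae_restrict_mem measurableSet_Iic] with y hy using hb y hy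

end Weight

/-! ### The Volterra equation for n = exp(iax) Φ and its estimates -/

/-- First component of the inhomogeneity of the Volterra equation. -/
def source₁ (u : ℝ → ℝ) (a b : ℂ) (n : ℝ → ℂ × ℂ) (y : ℝ) : ℂ :=
  Complex.I * a * ((1 - Real.cos (u y / 2) : ℝ) : ℂ) * (n y).1
    + Complex.I * b * (Real.sin (u y / 2) : ℂ) * (n y).2

/-- Second component of the inhomogeneity of the Volterra equation. -/
def source₂ (u : ℝ → ℝ) (a b : ℂ) (n : ℝ → ℂ × ℂ) (y : ℝ) : ℂ :=
  Complex.I * b * (Real.sin (u y / 2) : ℂ) * (n y).1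
    - Complex.I * a * ((1 - Real.cos (u y / 2) : ℝ) : ℂ) * (n y).2

/-- The Volterra operator whose fixed points are the renormalized left Jost solutions. -/
def volterra (u : ℝ → ℝ) (a b : ℂ) (n : ℝ → ℂ × ℂ) (x : ℝ) : ℂ × ℂ :=
  (1 + ∫ y in Set.Iic x, source₁ u a b n y,
    ∫ y in Set.Iic x, Complex.exp (2 * Complex.I * a * ((x - y : ℝ) : ℂ)) * source₂ u a b n y)

lemma norm_exp_le_one {a : ℂ} (ha : 0 ≤ a.im) {t : ℝ} (ht : 0 ≤ t) :
    ‖Complex.exp (2 * Complex.I * a * (t : ℂ))‖ ≤ 1 := by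
  rw [Complex.norm_exp, Real.exp_le_one_iff]
  have : (2 * Complex.I * a * (t : ℂ)).re = -(2 * a.im * t) := by simp
  rw [this]
  have := mul_nonneg ha ht
  linarith

/-- Lipschitz dependence of a decaying exponential on its rate, uniformly in time. -/
lemma norm_exp_sub_exp_le {κ : ℝ} (hκ : 0 < κ) {a a' : ℂ} (ha : κ ≤ a.im) (ha' : κ ≤ a'.im)
    {t : ℝ} (ht : 0 ≤ t) :
    ‖Complex.exp (2 * Complex.I * a * (t : ℂ)) - Complex.exp (2 * Complex.I * a' * (t : ℂ))‖
      ≤ ‖a - a'‖ / κ := by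
  have hconv : Convex ℝ {w : ℂ | κ ≤ w.im} := convex_halfSpace_im_ge κ
  have hd : ∀ w ∈ {w : ℂ | κ ≤ w.im}, HasDerivWithinAt
      (fun w => Complex.exp (2 * Complex.I * w * (t : ℂ)))
      (Complex.exp (2 * Complex.I * w * (t : ℂ)) * (2 * Complex.I * t)) {w : ℂ | κ ≤ w.im} w := by
    intro w _
    have h1 : HasDerivAt (fun w : ℂ => 2 * Complex.I * w * (t : ℂ)) (2 * Complex.I * t) w := by
      refine (((hasDerivAt_id w).const_mul (2 * Complex.I)).mul_const (t : ℂ)).congr_deriv ?_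
      simp
    exact h1.cexp.hasDerivWithinAt
  have hb : ∀ w ∈ {w : ℂ | κ ≤ w.im},
      ‖Complex.exp (2 * Complex.I * w * (t : ℂ)) * (2 * Complex.I * t)‖ ≤ 1 / κ := by
    intro w hw
    have hw' : κ ≤ w.im := hw
    have h1 : ‖(2 * Complex.I * t : ℂ)‖ = 2 * t := by
      simp [abs_of_nonneg ht]
    have h2 : ‖Complex.exp (2 * Complex.I * w * (t : ℂ))‖ ≤ Real.exp (-(2 * κ * t)) := by
      rw [Complex.norm_exp, Real.exp_le_exp]
      have : (2 * Complex.I * w * (t : ℂ)).re = -(2 * w.im * t) := by simp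
      rw [this]
      have := mul_le_mul_of_nonneg_right hw' ht
      linarith
    rw [norm_mul, h1]
    -- The factor t from differentiating in the rate is absorbed by the decay, via y ≤ exp y with y
    -- = 2κt. This is why Im a must stay away from 0.
    have h3 : 2 * κ * t * Real.exp (-(2 * κ * t)) ≤ 1 := by
      have := Real.add_one_le_exp (2 * κ * t)
      rw [Real.exp_neg, ← div_eq_mul_inv, div_le_one (Real.exp_pos _)]
      linarith
    rw [le_div_iff₀ hκ]
    calc _ ≤ Real.exp (-(2 * κ * t)) * (2 * t) * κ := by gcongr
      _ = 2 * κ * t * Real.exp (-(2 * κ * t)) := by ring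
      _ ≤ 1 := h3
  have := hconv.norm_image_sub_le_of_norm_hasDerivWithin_le hd hb ha' ha
  rw [div_eq_mul_one_div, mul_comm ‖a - a'‖]
  exact this

section Volterra
variable {u : ℝ → ℝ} (hu : IsMonotoneKink u) {L : ℝ} {a b : ℂ}
include hu

lemma continuous_source₁ {n : ℝ → ℂ × ℂ} (hn : Continuous n) :
    Continuous (source₁ u a b n) := by
  have := hu.continuous
  unfold source₁; fun_prop

lemma continuous_source₂ {n : ℝ → ℂ × ℂ} (hn : Continuous n) :
    Continuous (source₂ u a b n) := by
  have := hu.continuous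
  unfold source₂; fun_prop

lemma norm_source₁_le (ha : ‖a‖ ≤ L) (hb : ‖b‖ ≤ L) (n : ℝ → ℂ × ℂ) (y : ℝ) :
    ‖source₁ u a b n y‖ ≤ L * weightRate u y * ‖n y‖ := by
  have hc : (0 : ℝ) ≤ 1 - Real.cos (u y / 2) := sub_nonneg.2 (Real.cos_le_one _)
  have hs := hu.sin_nonneg y
  have hL : 0 ≤ L := (norm_nonneg a).trans ha
  calc ‖source₁ u a b n y‖ ≤ ‖a‖ * (1 - Real.cos (u y / 2)) * ‖(n y).1‖
        + ‖b‖ * Real.sin (u y / 2) * ‖(n y).2‖ := by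
        refine (norm_add_le _ _).trans (le_of_eq ?_)
        rw [norm_mul, norm_mul, norm_mul, norm_mul, norm_mul, norm_mul, Complex.norm_I,
          Complex.norm_real, Complex.norm_real, Real.norm_of_nonneg hc, Real.norm_of_nonneg hs]
        ring
    _ ≤ L * (1 - Real.cos (u y / 2)) * ‖n y‖ + L * Real.sin (u y / 2) * ‖n y‖ := by
        gcongr
        · exact norm_fst_le _
        · exact norm_snd_le _
    _ = L * weightRate u y * ‖n y‖ := by unfold weightRate; ring

lemma norm_source₂_le (ha : ‖a‖ ≤ L) (hb : ‖b‖ ≤ L) (n : ℝ → ℂ × ℂ) (y : ℝ) :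
    ‖source₂ u a b n y‖ ≤ L * weightRate u y * ‖n y‖ := by
  -- Swapping the components of n and replacing a by -a turns the second source into the first.
  have h := norm_source₁_le hu (a := -a) (b := b) (by rwa [norm_neg]) hb
    (fun y => ((n y).2, (n y).1)) y
  have h1 : source₂ u a b n y = source₁ u (-a) b (fun y => ((n y).2, (n y).1)) y := by
    simp only [source₁, source₂]; ring
  rw [h1]
  refine h.trans (le_of_eq ?_)
  rw [Prod.norm_def, Prod.norm_def, max_comm]

lemma norm_source_sub_le (a' b' : ℂ) (n : ℝ → ℂ × ℂ) (y : ℝ) :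
    ‖source₁ u a b n y - source₁ u a' b' n y‖
      ≤ (‖a - a'‖ + ‖b - b'‖) * weightRate u y * ‖n y‖ ∧
    ‖source₂ u a b n y - source₂ u a' b' n y‖
      ≤ (‖a - a'‖ + ‖b - b'‖) * weightRate u y * ‖n y‖ := by
  have e1 : source₁ u a b n y - source₁ u a' b' n y = source₁ u (a - a') (b - b') n y := by
    simp only [source₁]; ring
  have e2 : source₂ u a b n y - source₂ u a' b' n y = source₂ u (a - a') (b - b') n y := by
    simp only [source₂]; ring
  rw [e1, e2]
  exact ⟨norm_source₁_le hu (by linarith [norm_nonneg (b - b')])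
      (by linarith [norm_nonneg (a - a')]) n y,
    norm_source₂_le hu (by linarith [norm_nonneg (b - b')])
      (by linarith [norm_nonneg (a - a')]) n y⟩

variable {n n' : ℝ → ℂ × ℂ} {M M' : ℝ}
  (ha : ‖a‖ ≤ L) (hb : ‖b‖ ≤ L) (hn : Continuous n) (hn' : Continuous n')
  (hM : ∀ y, ‖n y‖ ≤ M * Real.exp (2 * weight u L y))
  (hM' : ∀ y, ‖n' y‖ ≤ M' * Real.exp (2 * weight u L y))
include ha hb

lemma norm_source₁_le_of_le {y : ℝ} (hM : ‖n y‖ ≤ M * Real.exp (2 * weight u L y)) :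
    ‖source₁ u a b n y‖ ≤ M * (L * weightRate u y * Real.exp (2 * weight u L y)) := by
  have hL : 0 ≤ L := (norm_nonneg a).trans ha
  refine (norm_source₁_le hu ha hb n y).trans ?_
  calc _ ≤ L * weightRate u y * (M * Real.exp (2 * weight u L y)) :=
        mul_le_mul_of_nonneg_left hM (mul_nonneg hL (weightRate_nonneg hu y))
    _ = _ := by ring

lemma norm_source₂_le_of_le {y : ℝ} (hM : ‖n y‖ ≤ M * Real.exp (2 * weight u L y)) :
    ‖source₂ u a b n y‖ ≤ M * (L * weightRate u y * Real.exp (2 * weight u L y)) := by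
  have hL : 0 ≤ L := (norm_nonneg a).trans ha
  refine (norm_source₂_le hu ha hb n y).trans ?_
  calc _ ≤ L * weightRate u y * (M * Real.exp (2 * weight u L y)) :=
        mul_le_mul_of_nonneg_left hM (mul_nonneg hL (weightRate_nonneg hu y))
    _ = _ := by ring

lemma norm_exp_mul_source₂_le (hai : 0 ≤ a.im) {x y : ℝ} (hy : y ≤ x)
    (hM : ‖n y‖ ≤ M * Real.exp (2 * weight u L y)) :
    ‖Complex.exp (2 * Complex.I * a * ((x - y : ℝ) : ℂ)) * source₂ u a b n y‖
      ≤ M * (L * weightRate u y * Real.exp (2 * weight u L y)) := by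
  rw [norm_mul]
  calc _ ≤ 1 * ‖source₂ u a b n y‖ := by
        gcongr
        exact norm_exp_le_one hai (sub_nonneg.2 hy)
    _ ≤ _ := by rw [one_mul]; exact norm_source₂_le_of_le hu ha hb hM

include hn hM

lemma integrableOn_source₁ (x : ℝ) : IntegrableOn (source₁ u a b n) (Set.Iic x) :=
  integrableOn_of_norm_le hu ((norm_nonneg a).trans ha) (continuous_source₁ hu hn)
    fun y _ => norm_source₁_le_of_le hu ha hb (hM y)

lemma integrableOn_exp_mul_source₂ (hai : 0 ≤ a.im) (x : ℝ) :
    IntegrableOn (fun y => Complex.exp (2 * Complex.I * a * ((x - y : ℝ) : ℂ))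
      * source₂ u a b n y) (Set.Iic x) := by
  refine integrableOn_of_norm_le hu ((norm_nonneg a).trans ha) ?_
    fun y hy => norm_exp_mul_source₂_le hu ha hb hai hy (hM y)
  have := continuous_source₂ hu (a := a) (b := b) hn
  fun_prop

lemma hasDerivAt_volterra_fst (x : ℝ) :
    HasDerivAt (fun x => (volterra u a b n x).1) (source₁ u a b n x) x :=
  (hasDerivAt_integral_Iic (continuous_source₁ hu hn)
    (integrableOn_source₁ hu ha hb hn hM) x).const_add 1

lemma hasDerivAt_volterra_snd (hai : 0 ≤ a.im) (x : ℝ) :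
    HasDerivAt (fun x => (volterra u a b n x).2)
      (2 * Complex.I * a * (volterra u a b n x).2 + source₂ u a b n x) x := by
  -- The kernel exp(2ia(x - y)) splits into a factor in x and a factor in y, so the integral becomes
  -- an exponential times a primitive.
  set G : ℝ → ℂ := fun y => Complex.exp (-(2 * Complex.I * a * (y : ℂ))) * source₂ u a b n y
  have hsplit : ∀ x y : ℝ, Complex.exp (2 * Complex.I * a * ((x - y : ℝ) : ℂ)) * source₂ u a b n y
      = Complex.exp (2 * Complex.I * a * (x : ℂ)) * G y := by
    intro x y
    simp only [G]
    rw [← mul_assoc, ← Complex.exp_add]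
    congr 2; push_cast; ring
  have hG : Continuous G := by
    have := continuous_source₂ hu (a := a) (b := b) hn
    fun_prop
  have hGi : ∀ x, IntegrableOn G (Set.Iic x) := by
    intro x
    have h := (integrableOn_exp_mul_source₂ hu ha hb hn hM hai x).const_mul
      (Complex.exp (-(2 * Complex.I * a * (x : ℂ))))
    refine h.congr (Eventually.of_forall fun y => ?_)
    simp only [hsplit]
    rw [← mul_assoc, ← Complex.exp_add]
    simp
  have h2 : ∀ x, (volterra u a b n x).2
      = Complex.exp (2 * Complex.I * a * (x : ℂ)) * ∫ y in Set.Iic x, G y := by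
    intro x
    simp only [volterra, hsplit]
    rw [integral_const_mul]
  have hexp : HasDerivAt (fun x : ℝ => Complex.exp (2 * Complex.I * a * (x : ℂ)))
      (Complex.exp (2 * Complex.I * a * (x : ℂ)) * (2 * Complex.I * a)) x := by
    have h3 : HasDerivAt (fun x : ℝ => 2 * Complex.I * a * (x : ℂ)) (2 * Complex.I * a) x := by
      simpa using (Complex.ofRealCLM.hasDerivAt (x := x)).const_mul (2 * Complex.I * a)
    exact h3.cexp
  rw [funext h2]
  refine (hexp.mul (hasDerivAt_integral_Iic hG hGi x)).congr_deriv ?_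
  have h4 : Complex.exp (2 * Complex.I * a * (x : ℂ)) * G x = source₂ u a b n x := by
    rw [← hsplit]; simp
  rw [h4, h2 x]
  ring

lemma continuous_volterra (hai : 0 ≤ a.im) : Continuous (volterra u a b n) := by
  have h1 : Continuous fun x => (volterra u a b n x).1 :=
    continuous_iff_continuousAt.2 fun x =>
      (hasDerivAt_volterra_fst hu ha hb hn hM x).continuousAt
  have h2 : Continuous fun x => (volterra u a b n x).2 :=
    continuous_iff_continuousAt.2 fun x =>
      (hasDerivAt_volterra_snd hu ha hb hn hM hai x).continuousAt
  exact h1.prodMk h2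

-- The bound serves twice: with M = 2 its right side tends to 0 at -∞, which gives the
-- normalization, and applied to a difference it gives the contraction.
omit hn in
lemma norm_volterra_sub_le (hai : 0 ≤ a.im) (x : ℝ) :
    ‖volterra u a b n x - (1, 0)‖ ≤ M * ((Real.exp (2 * weight u L x) - 1) / 2) := by
  have hL : 0 ≤ L := (norm_nonneg a).trans ha
  rw [Prod.norm_def, max_le_iff]
  simp only [volterra, Prod.mk_sub_mk, add_sub_cancel_left, sub_zero]
  exact ⟨norm_integral_Iic_le hu hL fun y _ => norm_source₁_le_of_le hu ha hb (hM y),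
    norm_integral_Iic_le hu hL fun y hy => norm_exp_mul_source₂_le hu ha hb hai hy (hM y)⟩

include hn' hM'

lemma norm_volterra_sub_volterra_le (hai : 0 ≤ a.im) {D : ℝ}
    (hD : ∀ y, ‖n y - n' y‖ ≤ D * Real.exp (2 * weight u L y)) (x : ℝ) :
    ‖volterra u a b n x - volterra u a b n' x‖
      ≤ D * ((Real.exp (2 * weight u L x) - 1) / 2) := by
  have h := norm_volterra_sub_le hu ha hb (n := fun y => n y - n' y) hD hai x
  refine le_trans (le_of_eq (congrArg _ ?_)) h
  have e1 : ∀ y, source₁ u a b (fun y => n y - n' y) y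
      = source₁ u a b n y - source₁ u a b n' y := by
    intro y; simp only [source₁, Prod.fst_sub, Prod.snd_sub]; ring
  have e2 : ∀ y, source₂ u a b (fun y => n y - n' y) y
      = source₂ u a b n y - source₂ u a b n' y := by
    intro y; simp only [source₂, Prod.fst_sub, Prod.snd_sub]; ring
  simp only [volterra, e1, e2, mul_sub]
  rw [integral_sub (integrableOn_source₁ hu ha hb hn hM x)
    (integrableOn_source₁ hu ha hb hn' hM' x),
    integral_sub (integrableOn_exp_mul_source₂ hu ha hb hn hM hai x)
    (integrableOn_exp_mul_source₂ hu ha hb hn' hM' hai x)]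
  simp

-- Two effects add up: varying the rate in the exponential costs 1/κ, varying the coefficients in
-- the sources costs 1/L.
omit hn' hM' in
lemma norm_volterra_sub_volterra_param_le (hL : 0 < L) {κ : ℝ} (hκ : 0 < κ) (hM0 : 0 ≤ M)
    {a' b' : ℂ} (ha' : ‖a'‖ ≤ L) (hb' : ‖b'‖ ≤ L) (hai : κ ≤ a.im) (hai' : κ ≤ a'.im) (x : ℝ) :
    ‖volterra u a b n x - volterra u a' b' n x‖
      ≤ M * ((‖a - a'‖ + ‖b - b'‖) * (1 / κ + 1 / L))
        * ((Real.exp (2 * weight u L x) - 1) / 2) := by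
  set D := ‖a - a'‖ + ‖b - b'‖ with hDdef
  have hD : 0 ≤ D := by positivity
  have haD : ‖a - a'‖ ≤ D := by rw [hDdef]; linarith [norm_nonneg (b - b')]
  have hsrc : ∀ y, D * weightRate u y * ‖n y‖
      ≤ M * (D * (1 / L)) * (L * weightRate u y * Real.exp (2 * weight u L y)) := by
    intro y
    calc D * weightRate u y * ‖n y‖
        ≤ D * weightRate u y * (M * Real.exp (2 * weight u L y)) :=
          mul_le_mul_of_nonneg_left (hM y) (mul_nonneg hD (weightRate_nonneg hu y))
      _ = _ := by field_simp
  rw [Prod.norm_def, max_le_iff]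
  simp only [volterra, Prod.mk_sub_mk, add_sub_add_left_eq_sub]
  rw [← integral_sub (integrableOn_source₁ hu ha hb hn hM x)
    (integrableOn_source₁ hu ha' hb' hn hM x),
    ← integral_sub (integrableOn_exp_mul_source₂ hu ha hb hn hM (hκ.le.trans hai) x)
    (integrableOn_exp_mul_source₂ hu ha' hb' hn hM (hκ.le.trans hai') x)]
  have hw : ∀ y, 0 ≤ L * weightRate u y * Real.exp (2 * weight u L y) := fun y =>
    mul_nonneg (mul_nonneg hL.le (weightRate_nonneg hu y)) (Real.exp_pos _).le
  refine ⟨norm_integral_Iic_le hu hL.le fun y _ => ?_,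
    norm_integral_Iic_le hu hL.le fun y hy => ?_⟩
  · refine ((norm_source_sub_le hu a' b' n y).1.trans (hsrc y)).trans ?_
    refine mul_le_mul_of_nonneg_right (mul_le_mul_of_nonneg_left
      (mul_le_mul_of_nonneg_left ?_ hD) hM0) (hw y)
    have : 0 < 1 / κ := by positivity
    linarith
  · have e : Complex.exp (2 * Complex.I * a * ((x - y : ℝ) : ℂ)) * source₂ u a b n y
        - Complex.exp (2 * Complex.I * a' * ((x - y : ℝ) : ℂ)) * source₂ u a' b' n y
        = (Complex.exp (2 * Complex.I * a * ((x - y : ℝ) : ℂ))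
            - Complex.exp (2 * Complex.I * a' * ((x - y : ℝ) : ℂ))) * source₂ u a b n y
          + Complex.exp (2 * Complex.I * a' * ((x - y : ℝ) : ℂ))
            * (source₂ u a b n y - source₂ u a' b' n y) := by ring
    rw [e]
    refine (norm_add_le _ _).trans ?_
    rw [norm_mul, norm_mul]
    calc _ ≤ D / κ * (M * (L * weightRate u y * Real.exp (2 * weight u L y)))
          + 1 * (M * (D * (1 / L)) * (L * weightRate u y * Real.exp (2 * weight u L y))) := by
          refine add_le_add (mul_le_mul ?_ (norm_source₂_le_of_le hu ha hb (hM y))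
            (norm_nonneg _) (by positivity)) (mul_le_mul ?_
            ((norm_source_sub_le hu a' b' n y).2.trans (hsrc y)) (norm_nonneg _) zero_le_one)
          · refine (norm_exp_sub_exp_le hκ hai hai' (sub_nonneg.2 hy)).trans ?_
            gcongr
          · exact norm_exp_le_one (hκ.le.trans hai') (sub_nonneg.2 hy)
      _ = _ := by ring

end Volterra

/-! ### Solving the Volterra equation, with continuous dependence on a and b -/

section FixedPoint
variable {u : ℝ → ℝ} (hu : IsMonotoneKink u) {L : ℝ}
include hu

open scoped BoundedContinuousFunction in
/-- The Volterra equation has a solution, and approximate solutions are close to it. -/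
lemma exists_volterra_fixedPoint {a b : ℂ} (ha : ‖a‖ ≤ L) (hb : ‖b‖ ≤ L) (hai : 0 ≤ a.im) :
    ∃ n : ℝ → ℂ × ℂ, Continuous n ∧ (∀ x, ‖n x‖ ≤ 2 * Real.exp (2 * weight u L x)) ∧
      (∀ x, volterra u a b n x = n x) ∧
      ∀ (n' : ℝ → ℂ × ℂ) (D : ℝ), Continuous n' →
        (∃ M, ∀ x, ‖n' x‖ ≤ M * Real.exp (2 * weight u L x)) →
        (∀ x, ‖n' x - volterra u a b n' x‖ ≤ D * Real.exp (2 * weight u L x)) →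
        ∀ x, ‖n' x - n x‖ ≤ 2 * D * Real.exp (2 * weight u L x) := by
  have hL : 0 ≤ L := (norm_nonneg a).trans ha
  set e : ℝ → ℝ := fun x => Real.exp (2 * weight u L x) with he
  have hepos : ∀ x, 0 < e x := fun x => Real.exp_pos _
  have hec : Continuous e := Real.continuous_exp.comp (continuous_const.mul (continuous_weight hu))
  have he1 : ∀ x, 1 ≤ e x := fun x => Real.one_le_exp (by linarith [weight_nonneg hu hL x])
  -- Functions bounded by a multiple of exp(2w) are exactly exp(2w) times bounded ones, so the
  -- contraction principle runs in the complete space of bounded continuous functions.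
  let up : (ℝ →ᵇ ℂ × ℂ) → ℝ → ℂ × ℂ := fun g x => e x • g x
  have hup : ∀ g, Continuous (up g) := fun g => hec.smul g.continuous
  have hupb : ∀ g y, ‖up g y‖ ≤ ‖g‖ * Real.exp (2 * weight u L y) := fun g y => by
    simp only [up]
    rw [norm_smul, Real.norm_of_nonneg (hepos y).le, mul_comm]
    exact mul_le_mul_of_nonneg_right (g.norm_coe_le_norm y) (hepos y).le
  have hVc : ∀ g, Continuous fun x => (e x)⁻¹ • volterra u a b (up g) x := fun g =>
    (hec.inv₀ fun x => (hepos x).ne').smul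
      (continuous_volterra hu ha hb (hup g) (hupb g) hai)
  have hVb : ∀ g x, ‖(e x)⁻¹ • volterra u a b (up g) x‖ ≤ 1 + ‖g‖ / 2 := fun g x => by
    have h1 := norm_volterra_sub_le hu ha hb (hupb g) hai x
    have h2 : ‖volterra u a b (up g) x‖ ≤ 1 + ‖g‖ * ((e x - 1) / 2) := by
      have h3 : ‖((1, 0) : ℂ × ℂ)‖ = 1 := by simp [Prod.norm_def]
      calc ‖volterra u a b (up g) x‖ = ‖(1, 0) + (volterra u a b (up g) x - (1, 0))‖ := by
            rw [add_sub_cancel]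
        _ ≤ _ := (norm_add_le _ _).trans (by rw [h3]; exact add_le_add_right h1 1)
    rw [norm_smul, norm_inv, Real.norm_of_nonneg (hepos x).le, inv_mul_le_iff₀ (hepos x)]
    refine h2.trans ?_
    nlinarith [norm_nonneg g, he1 x]
  let T : (ℝ →ᵇ ℂ × ℂ) → (ℝ →ᵇ ℂ × ℂ) := fun g =>
    BoundedContinuousFunction.ofNormedAddCommGroup _ (hVc g) (1 + ‖g‖ / 2) (hVb g)
  have hTapp : ∀ g x, T g x = (e x)⁻¹ • volterra u a b (up g) x := fun g x => rfl
  have hT : ContractingWith (1 / 2) T := by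
    refine ⟨by norm_num, LipschitzWith.of_dist_le_mul fun g g' => ?_⟩
    rw [dist_eq_norm, dist_eq_norm]
    refine (BoundedContinuousFunction.norm_le (by positivity)).2 fun x => ?_
    have h1 := norm_volterra_sub_volterra_le hu ha hb (hup g) (hup g') (hupb g) (hupb g') hai
      (D := ‖g - g'‖) (fun y => by
        have := hupb (g - g') y
        simp only [up, BoundedContinuousFunction.coe_sub, Pi.sub_apply, smul_sub] at this ⊢
        exact this) x
    rw [BoundedContinuousFunction.coe_sub, Pi.sub_apply, hTapp, hTapp, ← smul_sub, norm_smul,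
      norm_inv, Real.norm_of_nonneg (hepos x).le, inv_mul_le_iff₀ (hepos x)]
    refine h1.trans ?_
    have : ((1 / 2 : NNReal) : ℝ) = 1 / 2 := by norm_num
    rw [this]
    have := norm_nonneg (g - g')
    change ‖g - g'‖ * ((e x - 1) / 2) ≤ _
    nlinarith
  set g := ContractingWith.fixedPoint T hT with hg
  have hfix : T g = g := hT.fixedPoint_isFixedPt
  have hgn : ‖g‖ ≤ 2 := by
    have h1 : ‖T g‖ ≤ 1 + ‖g‖ / 2 :=
      (BoundedContinuousFunction.norm_le (by positivity)).2 (hVb g)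
    rw [hfix] at h1
    linarith
  refine ⟨up g, hup g, fun x => (hupb g x).trans (by gcongr), fun x => ?_, ?_⟩
  · have h1 : T g x = g x := by rw [hfix]
    rw [hTapp] at h1
    simp only [up]
    rw [← h1, smul_inv_smul₀ (hepos x).ne']
  · rintro n' D hn' ⟨M, hM⟩ hD x
    have hD0 : 0 ≤ D := by
      have := (norm_nonneg _).trans (hD x)
      exact nonneg_of_mul_nonneg_left this (hepos x)
    let g' : ℝ →ᵇ ℂ × ℂ := BoundedContinuousFunction.ofNormedAddCommGroup
      (fun x => (e x)⁻¹ • n' x) ((hec.inv₀ fun x => (hepos x).ne').smul hn') M (fun x => by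
        rw [norm_smul, norm_inv, Real.norm_of_nonneg (hepos x).le, inv_mul_le_iff₀ (hepos x),
          mul_comm]
        exact hM x)
    have hg'app : ∀ x, g' x = (e x)⁻¹ • n' x := fun x => rfl
    have hupg' : up g' = n' := by
      ext1 x; simp only [up, hg'app]; rw [smul_inv_smul₀ (hepos x).ne']
    -- The distance to the fixed point is at most the defect divided by 1 - 1/2, whence the factor 2
    -- in 2D.
    have h1 := hT.dist_fixedPoint_le g'
    have h2 : dist g' (T g') ≤ D := by
      rw [dist_eq_norm]
      refine (BoundedContinuousFunction.norm_le hD0).2 fun x => ?_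
      rw [BoundedContinuousFunction.coe_sub, Pi.sub_apply, hTapp, hupg', hg'app, ← smul_sub,
        norm_smul, norm_inv, Real.norm_of_nonneg (hepos x).le, inv_mul_le_iff₀ (hepos x), mul_comm]
      exact hD x
    have h3 : ‖g' - g‖ ≤ 2 * D := by
      rw [← dist_eq_norm]
      refine h1.trans ?_
      have : (1 - ((1 / 2 : NNReal) : ℝ)) = 1 / 2 := by norm_num
      rw [this]; linarith
    have h4 := hupb (g' - g) x
    have h5 : up (g' - g) x = n' x - up g x := by
      rw [← hupg']
      simp only [up, BoundedContinuousFunction.coe_sub, Pi.sub_apply, smul_sub]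
    rw [h5] at h4
    exact h4.trans (mul_le_mul_of_nonneg_right h3 (hepos x).le)

/-- A family of renormalized left Jost solutions depending continuously on the parameters. -/
lemma exists_volterra_family (hL : 0 < L) : ∃ n : ℂ → ℂ → ℝ → ℂ × ℂ,
    (∀ a b, 0 ≤ a.im → ‖a‖ ≤ L → ‖b‖ ≤ L → Continuous (n a b) ∧
      (∀ x, ‖n a b x‖ ≤ 2 * Real.exp (2 * weight u L x)) ∧
      (∀ x, volterra u a b (n a b) x = n a b x) ∧
      ∀ x, ‖n a b x - (1, 0)‖ ≤ Real.exp (2 * weight u L x) - 1) ∧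
    ∀ κ, 0 < κ → ∀ a b a' b' : ℂ, ‖a‖ ≤ L → ‖b‖ ≤ L → ‖a'‖ ≤ L → ‖b'‖ ≤ L →
      κ ≤ a.im → κ ≤ a'.im → ∀ x, ‖n a b x - n a' b' x‖
        ≤ 2 * ((‖a - a'‖ + ‖b - b'‖) * (1 / κ + 1 / L)) * Real.exp (2 * weight u L x) := by
  -- The constraints sit behind the existential so that `choose` yields a family defined for all
  -- parameters; the value 0 elsewhere is never used.
  have h : ∀ a b : ℂ, ∃ n : ℝ → ℂ × ℂ, 0 ≤ a.im → ‖a‖ ≤ L → ‖b‖ ≤ L → Continuous n ∧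
      (∀ x, ‖n x‖ ≤ 2 * Real.exp (2 * weight u L x)) ∧
      (∀ x, volterra u a b n x = n x) ∧
      ∀ (n' : ℝ → ℂ × ℂ) (D : ℝ), Continuous n' →
        (∃ M, ∀ x, ‖n' x‖ ≤ M * Real.exp (2 * weight u L x)) →
        (∀ x, ‖n' x - volterra u a b n' x‖ ≤ D * Real.exp (2 * weight u L x)) →
        ∀ x, ‖n' x - n x‖ ≤ 2 * D * Real.exp (2 * weight u L x) := by
    intro a b
    by_cases hc : 0 ≤ a.im ∧ ‖a‖ ≤ L ∧ ‖b‖ ≤ L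
    · obtain ⟨n, hn⟩ := exists_volterra_fixedPoint hu hc.2.1 hc.2.2 hc.1
      exact ⟨n, fun _ _ _ => hn⟩
    · exact ⟨0, fun h1 h2 h3 => (hc ⟨h1, h2, h3⟩).elim⟩
  choose n hn using h
  refine ⟨n, fun a b h1 h2 h3 => ?_, ?_⟩
  · obtain ⟨hc, hb, hf, -⟩ := hn a b h1 h2 h3
    refine ⟨hc, hb, hf, fun x => ?_⟩
    have := norm_volterra_sub_le hu h2 h3 hb h1 x
    rw [hf] at this
    linarith
  · intro κ hκ a b a' b' ha hb ha' hb' hai hai' x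
    obtain ⟨hc, hbd, hf, -⟩ := hn a b (hκ.le.trans hai) ha hb
    obtain ⟨-, -, -, hstab⟩ := hn a' b' (hκ.le.trans hai') ha' hb'
    set D := (‖a - a'‖ + ‖b - b'‖) * (1 / κ + 1 / L)
    have hD : 0 ≤ D := by positivity
    -- The solution for (a, b) is viewed as an approximate solution for (a', b').
    refine hstab (n a b) D hc ⟨2, hbd⟩ (fun y => ?_) x
    have h1 := norm_volterra_sub_volterra_param_le hu ha hb hc hbd hL hκ zero_le_two ha' hb'
      hai hai' y
    rw [hf] at h1
    refine h1.trans ?_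
    change 2 * D * _ ≤ _
    nlinarith [Real.exp_pos (2 * weight u L y)]

end FixedPoint

/-! ### The normalized solution at -∞ -/

/-- The left Jost solution built from the renormalized solution `n`. -/
def ofRenormalized (z : ℂ) (n : ℝ → ℂ × ℂ) (x : ℝ) : Fin 2 → ℂ :=
  Complex.exp (-(Complex.I * diagCoeff z * (x : ℂ))) • ![(n x).1, (n x).2]

lemma isSolution_ofRenormalized {u : ℝ → ℝ} (hu : IsMonotoneKink u) {L : ℝ} {z : ℂ}
    {n : ℝ → ℂ × ℂ} {M : ℝ} (ha : ‖diagCoeff z‖ ≤ L) (hb : ‖offCoeff z‖ ≤ L) (hn : Continuous n)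
    (hM : ∀ y, ‖n y‖ ≤ M * Real.exp (2 * weight u L y)) (hai : 0 ≤ (diagCoeff z).im)
    (hf : ∀ x, volterra u (diagCoeff z) (offCoeff z) n x = n x) :
    IsSolution u z (ofRenormalized z n) := by
  rw [isSolution_iff]
  intro x
  have h1 := hasDerivAt_volterra_fst hu ha hb hn hM x
  have h2 := hasDerivAt_volterra_snd hu ha hb hn hM hai x
  simp only [hf] at h1 h2
  have hexp : HasDerivAt (fun x : ℝ => Complex.exp (-(Complex.I * diagCoeff z * (x : ℂ))))
      (Complex.exp (-(Complex.I * diagCoeff z * (x : ℂ))) * (-(Complex.I * diagCoeff z))) x := by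
    have h3 : HasDerivAt (fun x : ℝ => -(Complex.I * diagCoeff z * (x : ℂ)))
        (-(Complex.I * diagCoeff z)) x := by
      have := ((Complex.ofRealCLM.hasDerivAt (x := x)).const_mul (Complex.I * diagCoeff z)).neg
      exact this.congr_deriv (by simp)
    exact h3.cexp
  constructor
  · refine (hexp.mul h1).congr_deriv ?_
    simp only [ofRenormalized, source₁, Pi.smul_apply, smul_eq_mul, Matrix.cons_val_zero,
      Matrix.cons_val_one]
    push_cast
    ring
  · refine (hexp.mul h2).congr_deriv ?_
    simp only [ofRenormalized, source₂, Pi.smul_apply, smul_eq_mul, Matrix.cons_val_zero,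
      Matrix.cons_val_one]
    push_cast
    ring

/-- `J` is the solution with `exp (i a x) J → (1, 0)` at `-∞`, where `a = diagCoeff z`. -/
def IsNormalizedLeft (u : ℝ → ℝ) (z : ℂ) (J : ℝ → Fin 2 → ℂ) : Prop :=
  IsSolution u z J ∧
    Tendsto (fun x : ℝ => Complex.exp (Complex.I * diagCoeff z * (x : ℂ)) • J x) atBot
      (𝓝 ![1, 0])

lemma norm_exp_neg_diagCoeff (z : ℂ) (x : ℝ) :
    ‖Complex.exp (-(Complex.I * diagCoeff z * (x : ℂ)))‖ = Real.exp ((diagCoeff z).im * x) := by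
  rw [Complex.norm_exp]; simp

lemma exp_neg_smul_exp_smul (w : ℂ) (v : Fin 2 → ℂ) :
    Complex.exp (-w) • (Complex.exp w • v) = v := by
  rw [smul_smul, ← Complex.exp_add]; simp

lemma IsNormalizedLeft.tendsto_zero {u : ℝ → ℝ} {z : ℂ} {J : ℝ → Fin 2 → ℂ}
    (h : IsNormalizedLeft u z J) (hz : 0 < z.im) : Tendsto J atBot (𝓝 0) := by
  have h1 : Tendsto (fun x : ℝ => Complex.exp (-(Complex.I * diagCoeff z * (x : ℂ)))) atBot
      (𝓝 0) := by
    rw [tendsto_zero_iff_norm_tendsto_zero]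
    simp only [norm_exp_neg_diagCoeff]
    exact Real.tendsto_exp_atBot.comp (tendsto_id.const_mul_atBot (diagCoeff_im_pos hz))
  have h2 := h1.smul h.2
  rw [zero_smul] at h2
  exact h2.congr fun x => exp_neg_smul_exp_smul _ _

lemma IsNormalizedLeft.ne_zero {u : ℝ → ℝ} {z : ℂ} {J : ℝ → Fin 2 → ℂ}
    (h : IsNormalizedLeft u z J) (x : ℝ) : J x ≠ 0 := by
  intro h0
  have h1 : ∀ y, J y = 0 := h.1.eq_zero h0
  have h2 := h.2
  simp only [h1, smul_zero] at h2
  have h3 := tendsto_nhds_unique h2 tendsto_const_nhds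
  have := congrFun h3 0
  simp at this

/-- For Im z > 0 both solutions decay at -∞, hence are proportional; the normalization fixes the
factor to 1. -/
lemma IsNormalizedLeft.unique {u : ℝ → ℝ} {z : ℂ} {J J' : ℝ → Fin 2 → ℂ}
    (h : IsNormalizedLeft u z J) (h' : IsNormalizedLeft u z J') (hz : 0 < z.im) : J = J' := by
  obtain ⟨k, hk⟩ := exists_smul_of_tendsto_zero h.1 h'.1 (h'.ne_zero 0) (h.tendsto_zero hz)
    (h'.tendsto_zero hz)
  have h1 := h'.2.const_smul k
  have h2 : (fun x : ℝ => k • Complex.exp (Complex.I * diagCoeff z * (x : ℂ)) • J' x)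
      = fun x : ℝ => Complex.exp (Complex.I * diagCoeff z * (x : ℂ)) • J x := by
    ext1 x; rw [hk, smul_comm]
  rw [h2] at h1
  have h3 := congrFun (tendsto_nhds_unique h1 h.2) 0
  simp only [Pi.smul_apply, Matrix.cons_val_zero, smul_eq_mul, mul_one] at h3
  ext1 x
  rw [hk, h3, one_smul]

lemma isNormalizedLeft_ofRenormalized {u : ℝ → ℝ} (hu : IsMonotoneKink u) {L : ℝ} {z : ℂ}
    {n : ℝ → ℂ × ℂ} {M : ℝ} (ha : ‖diagCoeff z‖ ≤ L) (hb : ‖offCoeff z‖ ≤ L) (hn : Continuous n)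
    (hM : ∀ y, ‖n y‖ ≤ M * Real.exp (2 * weight u L y)) (hai : 0 ≤ (diagCoeff z).im)
    (hf : ∀ x, volterra u (diagCoeff z) (offCoeff z) n x = n x)
    (hlim : ∀ x, ‖n x - (1, 0)‖ ≤ Real.exp (2 * weight u L x) - 1) :
    IsNormalizedLeft u z (ofRenormalized z n) := by
  refine ⟨isSolution_ofRenormalized hu ha hb hn hM hai hf, ?_⟩
  have h1 : Tendsto n atBot (𝓝 (1, 0)) := by
    rw [tendsto_iff_norm_sub_tendsto_zero]
    refine squeeze_zero (fun _ => norm_nonneg _) hlim ?_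
    have : Tendsto (fun x => Real.exp (2 * weight u L x) - 1) atBot (𝓝 (Real.exp (2 * 0) - 1)) :=
      ((Real.continuous_exp.tendsto _).comp ((tendsto_weight (u := u)).const_mul 2)).sub_const 1
    simpa using this
  have h2 : ∀ x : ℝ, Complex.exp (Complex.I * diagCoeff z * (x : ℂ)) • ofRenormalized z n x
      = ![(n x).1, (n x).2] := by
    intro x
    have := exp_neg_smul_exp_smul (-(Complex.I * diagCoeff z * (x : ℂ))) ![(n x).1, (n x).2]
    rwa [neg_neg] at this
  simp only [h2]
  rw [tendsto_pi_nhds, Fin.forall_fin_two]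
  exact ⟨(continuous_fst.tendsto _).comp h1, (continuous_snd.tendsto _).comp h1⟩

open Classical in
/-- The normalized solution at `-∞`. -/
def leftSol (u : ℝ → ℝ) (z : ℂ) : ℝ → Fin 2 → ℂ :=
  if h : ∃ J, IsNormalizedLeft u z J then h.choose else 0

section LeftSol
variable {u : ℝ → ℝ} (hu : IsMonotoneKink u)
include hu

lemma isNormalizedLeft_leftSol {z : ℂ} (hz : 0 < z.im) : IsNormalizedLeft u z (leftSol u z) := by
  have h : ∃ J, IsNormalizedLeft u z J := by
    set L := ‖diagCoeff z‖ + ‖offCoeff z‖ + 1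
    have hL : 0 < L := by positivity
    have ha : ‖diagCoeff z‖ ≤ L := by simp only [L]; linarith [norm_nonneg (offCoeff z)]
    have hb : ‖offCoeff z‖ ≤ L := by simp only [L]; linarith [norm_nonneg (diagCoeff z)]
    obtain ⟨n, hn, -⟩ := exists_volterra_family hu hL
    obtain ⟨h1, h2, h3, h4⟩ := hn _ _ (diagCoeff_im_pos hz).le ha hb
    exact ⟨_, isNormalizedLeft_ofRenormalized hu ha hb h1 h2 (diagCoeff_im_pos hz).le h3 h4⟩
  rw [leftSol, dif_pos h]
  exact h.choose_spec

/-- `leftSol` is chosen separately for each z, so its dependence on z is not visible. Uniqueness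
identifies it with one family of Volterra solutions for all z with coefficients bounded by L, which
carries the estimates in (a, b) over. -/
lemma leftSol_family {L : ℝ} (hL : 0 < L) : ∃ n : ℂ → ℂ → ℝ → ℂ × ℂ,
    (∀ z : ℂ, 0 < z.im → ‖diagCoeff z‖ ≤ L → ‖offCoeff z‖ ≤ L →
      leftSol u z = ofRenormalized z (n (diagCoeff z) (offCoeff z)) ∧
      ∀ x, ‖n (diagCoeff z) (offCoeff z) x - (1, 0)‖ ≤ Real.exp (2 * weight u L x) - 1) ∧
    ∀ κ, 0 < κ → ∀ a b a' b' : ℂ, ‖a‖ ≤ L → ‖b‖ ≤ L → ‖a'‖ ≤ L → ‖b'‖ ≤ L →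
      κ ≤ a.im → κ ≤ a'.im → ∀ x, ‖n a b x - n a' b' x‖
        ≤ 2 * ((‖a - a'‖ + ‖b - b'‖) * (1 / κ + 1 / L)) * Real.exp (2 * weight u L x) := by
  obtain ⟨n, hn, hn'⟩ := exists_volterra_family hu hL
  refine ⟨n, fun z hz ha hb => ?_, hn'⟩
  obtain ⟨h1, h2, h3, h4⟩ := hn _ _ (diagCoeff_im_pos hz).le ha hb
  exact ⟨(isNormalizedLeft_leftSol hu hz).unique
    (isNormalizedLeft_ofRenormalized hu ha hb h1 h2 (diagCoeff_im_pos hz).le h3 h4) hz, h4⟩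

lemma leftSol_sub_le {L : ℝ} (hL : 0 < L) {z : ℂ} (hz : 0 < z.im) (ha : ‖diagCoeff z‖ ≤ L)
    (hb : ‖offCoeff z‖ ≤ L) (x : ℝ) :
    ‖Complex.exp (Complex.I * diagCoeff z * (x : ℂ)) • leftSol u z x - ![1, 0]‖
      ≤ Real.exp (2 * weight u L x) - 1 := by
  obtain ⟨n, hn, -⟩ := leftSol_family hu hL
  obtain ⟨h1, h2⟩ := hn z hz ha hb
  have h3 := exp_neg_smul_exp_smul (-(Complex.I * diagCoeff z * (x : ℂ)))
    ![(n (diagCoeff z) (offCoeff z) x).1, (n (diagCoeff z) (offCoeff z) x).2]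
  rw [neg_neg] at h3
  rw [h1, ofRenormalized, h3]
  refine le_trans ?_ (h2 x)
  rw [pi_norm_le_iff_of_nonneg (norm_nonneg _), Fin.forall_fin_two]
  exact ⟨norm_fst_le (n (diagCoeff z) (offCoeff z) x - (1, 0)),
    norm_snd_le (n (diagCoeff z) (offCoeff z) x - (1, 0))⟩

lemma norm_leftSol_le {L : ℝ} (hL : 0 < L) {z : ℂ} (hz : 0 < z.im) (ha : ‖diagCoeff z‖ ≤ L)
    (hb : ‖offCoeff z‖ ≤ L) (x : ℝ) :
    ‖leftSol u z x‖ ≤ Real.exp ((diagCoeff z).im * x) * Real.exp (2 * weight u L x) := by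
  have h1 := leftSol_sub_le hu hL hz ha hb x
  set v := Complex.exp (Complex.I * diagCoeff z * (x : ℂ)) • leftSol u z x with hv
  have h2 : leftSol u z x = Complex.exp (-(Complex.I * diagCoeff z * (x : ℂ))) • v := by
    rw [hv, exp_neg_smul_exp_smul]
  have h3 : ‖v‖ ≤ Real.exp (2 * weight u L x) := by
    have h4 : ‖(![1, 0] : Fin 2 → ℂ)‖ ≤ 1 := by
      rw [pi_norm_le_iff_of_nonneg zero_le_one, Fin.forall_fin_two]; simp
    calc ‖v‖ = ‖(v - ![1, 0]) + ![1, 0]‖ := by rw [sub_add_cancel]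
      _ ≤ _ := norm_add_le _ _
      _ ≤ _ := by linarith
  rw [h2, norm_smul, norm_exp_neg_diagCoeff]
  exact mul_le_mul_of_nonneg_left h3 (Real.exp_pos _).le

omit hu in
lemma continuousAt_diagCoeff {z : ℂ} (hz : z ≠ 0) : ContinuousAt diagCoeff z := by
  unfold diagCoeff; fun_prop (disch := exact hz)

omit hu in
lemma continuousAt_offCoeff {z : ℂ} (hz : z ≠ 0) : ContinuousAt offCoeff z := by
  unfold offCoeff; fun_prop (disch := exact hz)

omit hu in
/-- Uniform bounds for the coefficients near a point of the upper half plane. -/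
lemma eventually_coeff_bounds {z₀ : ℂ} (hz : 0 < z₀.im) : ∃ L κ : ℝ, 0 < L ∧ 0 < κ ∧
    ∀ᶠ z in 𝓝 z₀, 0 < z.im ∧ ‖diagCoeff z‖ ≤ L ∧ ‖offCoeff z‖ ≤ L ∧ κ ≤ (diagCoeff z).im := by
  have h0 := ne_zero_of_im_pos hz
  have ha := continuousAt_diagCoeff h0
  have hb := continuousAt_offCoeff h0
  refine ⟨‖diagCoeff z₀‖ + ‖offCoeff z₀‖ + 1, (diagCoeff z₀).im / 2, by positivity,
    half_pos (diagCoeff_im_pos hz), ?_⟩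
  have e1 := Complex.continuous_im.continuousAt.eventually (lt_mem_nhds hz)
  have e2 := ha.norm.eventually (gt_mem_nhds (show ‖diagCoeff z₀‖ <
    ‖diagCoeff z₀‖ + ‖offCoeff z₀‖ + 1 by linarith [norm_nonneg (offCoeff z₀)]))
  have e3 := hb.norm.eventually (gt_mem_nhds (show ‖offCoeff z₀‖ <
    ‖diagCoeff z₀‖ + ‖offCoeff z₀‖ + 1 by linarith [norm_nonneg (diagCoeff z₀)]))
  have e4 := (Complex.continuous_im.continuousAt.comp ha).eventually (lt_mem_nhds
    (half_lt_self (diagCoeff_im_pos hz)))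
  filter_upwards [e1, e2, e3, e4] with z h1 h2 h3 h4 using ⟨h1, h2.le, h3.le, le_of_lt h4⟩

lemma continuousAt_leftSol {z₀ : ℂ} (hz : 0 < z₀.im) (x : ℝ) :
    ContinuousAt (fun z => leftSol u z x) z₀ := by
  obtain ⟨L, κ, hL, hκ, hev⟩ := eventually_coeff_bounds hz
  obtain ⟨n, hn, hlip⟩ := leftSol_family hu hL
  obtain ⟨hz0, ha0, hb0, hk0⟩ := hev.self_of_nhds
  have h0 := ne_zero_of_im_pos hz
  have ha := continuousAt_diagCoeff h0
  have hb := continuousAt_offCoeff h0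
  have h1 : Tendsto (fun z => n (diagCoeff z) (offCoeff z) x) (𝓝 z₀)
      (𝓝 (n (diagCoeff z₀) (offCoeff z₀) x)) := by
    rw [tendsto_iff_norm_sub_tendsto_zero]
    have hlim : Tendsto (fun z => 2 * ((‖diagCoeff z - diagCoeff z₀‖ + ‖offCoeff z - offCoeff z₀‖)
        * (1 / κ + 1 / L)) * Real.exp (2 * weight u L x)) (𝓝 z₀) (𝓝 0) := by
      have := (((((ha.sub_const (diagCoeff z₀)).norm.add (hb.sub_const (offCoeff z₀)).norm).mul_const
        (1 / κ + 1 / L)).const_mul 2).mul_const (Real.exp (2 * weight u L x)))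
      simpa using this
    refine squeeze_zero' (Eventually.of_forall fun _ => norm_nonneg _) ?_ hlim
    filter_upwards [hev] with z hz
    exact hlip κ hκ _ _ _ _ hz.2.1 hz.2.2.1 ha0 hb0 hz.2.2.2 hk0 x
  have h2 : Tendsto (fun z => ofRenormalized z (n (diagCoeff z) (offCoeff z)) x) (𝓝 z₀)
      (𝓝 (ofRenormalized z₀ (n (diagCoeff z₀) (offCoeff z₀)) x)) := by
    unfold ofRenormalized
    refine Tendsto.smul ?_ ?_
    · exact (Complex.continuous_exp.tendsto _).comp
        (((ha.const_mul Complex.I).mul_const (x : ℂ)).neg)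
    · rw [tendsto_pi_nhds, Fin.forall_fin_two]
      exact ⟨(continuous_fst.tendsto _).comp h1, (continuous_snd.tendsto _).comp h1⟩
  rw [ContinuousAt, (hn z₀ hz0 ha0 hb0).1]
  refine h2.congr' ?_
  filter_upwards [hev] with z hz
  rw [(hn z hz.1 hz.2.1 hz.2.2.1).1]

/-- Locally uniform exponential decay of the normalized solutions at `-∞`. -/
lemma eventually_norm_leftSol_le {z₀ : ℂ} (hz : 0 < z₀.im) (X : ℝ) : ∃ C κ : ℝ, 0 < κ ∧
    ∀ᶠ z in 𝓝 z₀, ∀ x ≤ X, ‖leftSol u z x‖ ≤ C * Real.exp (κ * x) := by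
  obtain ⟨L, κ, hL, hκ, hev⟩ := eventually_coeff_bounds hz
  refine ⟨Real.exp (L * |X|) * Real.exp (2 * weight u L X), κ, hκ, ?_⟩
  filter_upwards [hev] with z hz x hx
  refine (norm_leftSol_le hu hL hz.1 hz.2.1 hz.2.2.1 x).trans ?_
  -- Lowering the rate from Im a to the common κ only costs for positive x, hence at most exp(L|X|)
  -- on x ≤ X.
  have h1 : (diagCoeff z).im * x ≤ L * |X| + κ * x := by
    have h2 : (diagCoeff z).im ≤ L :=
      (le_abs_self _).trans ((Complex.abs_im_le_norm _).trans hz.2.1)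
    have h3 : ((diagCoeff z).im - κ) * x ≤ ((diagCoeff z).im - κ) * |X| :=
      mul_le_mul_of_nonneg_left (hx.trans (le_abs_self X)) (sub_nonneg.2 hz.2.2.2)
    have h4 : ((diagCoeff z).im - κ) * |X| ≤ L * |X| :=
      mul_le_mul_of_nonneg_right (by linarith) (abs_nonneg X)
    linarith
  calc _ ≤ Real.exp (L * |X| + κ * x) * Real.exp (2 * weight u L X) := by
        gcongr
        exact weight_mono hu hL.le hx
    _ = _ := by rw [Real.exp_add]; ring

lemma integrableOn_sq_norm_leftSol {z : ℂ} (hz : 0 < z.im) (X : ℝ) :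
    IntegrableOn (fun x => ‖leftSol u z x‖ ^ 2) (Set.Iic X) := by
  obtain ⟨C, κ, hκ, h⟩ := eventually_norm_leftSol_le hu hz X
  have h1 := h.self_of_nhds
  refine Integrable.mono' ((integrableOn_exp_mul_Iic (by positivity : 0 < 2 * κ) X).const_mul
    (C ^ 2)) ((isNormalizedLeft_leftSol hu hz).1.continuous.norm.pow 2).aestronglyMeasurable ?_
  filter_upwards [ae_restrict_mem measurableSet_Iic] with x hx
  rw [norm_pow, norm_norm]
  calc _ ≤ (C * Real.exp (κ * x)) ^ 2 := by
        gcongr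
        exact h1 x hx
    _ = _ := by rw [mul_pow, ← Real.exp_nat_mul]; push_cast; ring_nf

end LeftSol

/-! ### Positivity of the interaction integral -/

lemma norm_component_le {u : ℝ → ℝ} {a b : ℂ} (x : ℝ) (v : Fin 2 → ℂ) (i j : Fin 2) :
    ‖a * (Real.cos (u x / 2) : ℂ) * v i + b * (Real.sin (u x / 2) : ℂ) * v j‖
      ≤ (‖a‖ + ‖b‖) * ‖v‖ := by
  have hc : ‖(Real.cos (u x / 2) : ℂ)‖ ≤ 1 := by
    rw [Complex.norm_real]; exact Real.abs_cos_le_one _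
  have hs : ‖(Real.sin (u x / 2) : ℂ)‖ ≤ 1 := by
    rw [Complex.norm_real]; exact Real.abs_sin_le_one _
  calc _ ≤ ‖a‖ * ‖(Real.cos (u x / 2) : ℂ)‖ * ‖v i‖ + ‖b‖ * ‖(Real.sin (u x / 2) : ℂ)‖ * ‖v j‖ := by
        refine (norm_add_le _ _).trans ?_
        simp only [norm_mul, le_refl]
    _ ≤ ‖a‖ * 1 * ‖v‖ + ‖b‖ * 1 * ‖v‖ := by
        gcongr
        · exact norm_le_pi_norm v i
        · exact norm_le_pi_norm v j
    _ = _ := by ring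

lemma integrableOn_mul_of_sq {Φ : ℝ → Fin 2 → ℂ} {s : Set ℝ} (hs : MeasurableSet s)
    (hΦ : IntegrableOn (fun x => ‖Φ x‖ ^ 2) s) {g : ℝ → ℂ} (hg : Continuous g) {C : ℝ}
    (hb : ∀ x ∈ s, ‖g x‖ ≤ C * ‖Φ x‖ ^ 2) : IntegrableOn g s := by
  refine Integrable.mono' (hΦ.const_mul C) hg.aestronglyMeasurable ?_
  filter_upwards [ae_restrict_mem hs] with x hx using hb x hx

/-- The square of each component is integrable, and so is its derivative, because |Φ'| ≤ C|Φ|. Such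
a function tends to 0. -/
lemma IsSolution.tendsto_atBot_zero {u : ℝ → ℝ} (hu : Continuous u) {z : ℂ}
    {Φ : ℝ → Fin 2 → ℂ} (h : IsSolution u z Φ) {X : ℝ}
    (hi : IntegrableOn (fun x => ‖Φ x‖ ^ 2) (Set.Iic X)) : Tendsto Φ atBot (𝓝 0) := by
  have hc := h.continuous
  have h' := isSolution_iff.1 h
  have key : ∀ (i : Fin 2) (d : ℝ → ℂ), (∀ x, HasDerivAt (fun x => Φ x i) (d x) x) →
      Continuous d → (∃ C, ∀ x, ‖d x‖ ≤ C * ‖Φ x‖) → Tendsto (fun x => Φ x i) atBot (𝓝 0) := by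
    rintro i d hd hdc ⟨C, hC⟩
    have hci : Continuous fun x => Φ x i := (continuous_apply i).comp hc
    have h1 := tendsto_zero_of_hasDerivAt_of_integrableOn_Iic (a := X)
      (f := fun x => Φ x i ^ 2) (f' := fun x => 2 * Φ x i * d x)
      (fun x _ => by
        have := (hd x).pow 2
        refine this.congr_deriv ?_
        simp)
      (integrableOn_mul_of_sq (C := 2 * C) measurableSet_Iic hi (by fun_prop)
        fun x _ => by
          rw [norm_mul, norm_mul, Complex.norm_ofNat]
          calc 2 * ‖Φ x i‖ * ‖d x‖ ≤ 2 * ‖Φ x‖ * (C * ‖Φ x‖) := by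
                gcongr
                · exact norm_le_pi_norm _ i
                · exact hC x
            _ = _ := by ring)
      (integrableOn_mul_of_sq (C := 1) measurableSet_Iic hi (by fun_prop)
        fun x _ => by
          rw [norm_pow, one_mul]
          gcongr
          exact norm_le_pi_norm _ i)
    rw [tendsto_zero_iff_norm_tendsto_zero] at h1 ⊢
    have h2 := (Real.continuous_sqrt.tendsto _).comp h1
    rw [Real.sqrt_zero] at h2
    refine h2.congr fun x => ?_
    simp [Real.sqrt_sq]
  rw [tendsto_pi_nhds, Fin.forall_fin_two]
  have hc0 : Continuous fun x => Φ x 0 := (continuous_apply 0).comp hc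
  have hc1 : Continuous fun x => Φ x 1 := (continuous_apply 1).comp hc
  refine ⟨key 0 _ (fun x => (h' x).1) (by fun_prop) ⟨_, fun x => norm_component_le x (Φ x) 0 1⟩,
    key 1 _ (fun x => (h' x).2) (by fun_prop)
      ⟨_, fun x => (le_of_eq (by rw [add_comm])).trans (norm_component_le x (Φ x) 1 0)⟩⟩

/-- The interaction density of the two components of a solution. -/
def interaction (z : ℂ) (Φ : ℝ → Fin 2 → ℂ) (x : ℝ) : ℝ :=
  (starRingEnd ℂ (offCoeff z) * (starRingEnd ℂ (Φ x 0) * Φ x 1)).im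

lemma continuous_interaction {z : ℂ} {Φ : ℝ → Fin 2 → ℂ} (hc : Continuous Φ) :
    Continuous (interaction z Φ) := by
  have hc0 : Continuous fun x => Φ x 0 := (continuous_apply 0).comp hc
  have hc1 : Continuous fun x => Φ x 1 := (continuous_apply 1).comp hc
  have := Complex.continuous_conj.comp hc0
  exact Complex.continuous_im.comp (continuous_const.mul (this.mul hc1))

lemma abs_interaction_le (z : ℂ) (Φ : ℝ → Fin 2 → ℂ) (x : ℝ) :
    |interaction z Φ x| ≤ ‖offCoeff z‖ * ‖Φ x‖ ^ 2 := by
  refine (Complex.abs_im_le_norm _).trans ?_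
  rw [norm_mul, norm_mul, Complex.norm_conj, Complex.norm_conj, sq]
  gcongr <;> exact norm_le_pi_norm _ _

/-- This equation, tested against cot(u/2), converts the interaction weighted by sin into the
interaction weighted by cos. -/
lemma hasDerivAt_sq_norm_snd {u : ℝ → ℝ} {z : ℂ} {Φ : ℝ → Fin 2 → ℂ} (h : IsSolution u z Φ)
    (x : ℝ) : HasDerivAt (fun x => ‖Φ x 1‖ ^ 2)
      (-(2 * (diagCoeff z).im * Real.cos (u x / 2)) * ‖Φ x 1‖ ^ 2
        + 2 * Real.sin (u x / 2) * interaction z Φ x) x := by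
  have h1 := (isSolution_iff.1 h x).2.norm_sq
  refine h1.congr_deriv ?_
  rw [Complex.inner, interaction, Complex.sq_norm, Complex.normSq_apply]
  generalize Real.cos (u x / 2) = c
  generalize Real.sin (u x / 2) = s
  simp only [Complex.mul_re, Complex.mul_im, Complex.add_re, Complex.add_im, Complex.conj_re,
    Complex.conj_im, Complex.ofReal_re, Complex.ofReal_im, Complex.I_re, Complex.I_im]
  ring

section Kink
variable {u : ℝ → ℝ} (hu : IsMonotoneKink u) {x₀ : ℝ} (h0 : u x₀ = Real.pi) {z : ℂ}
  (hz : 0 < z.im) {Φ : ℝ → Fin 2 → ℂ} (h : IsSolution u z Φ)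
  (hi : IntegrableOn (fun x => ‖Φ x‖ ^ 2) (Set.Iic x₀))
include hu h0 hz h hi

/-- On a half line where the potential vanishes, the second component of a decaying solution
vanishes. -/
lemma snd_eq_zero_of_sin_eq_zero {x : ℝ} (hx : x ≤ x₀) (hs : Real.sin (u x / 2) = 0) :
    Φ x 1 = 0 := by
  have hpi := Real.pi_pos
  have hux : u x = 0 := by
    have h1 := hu.nonneg x
    have h2 := hu.monotone hx
    by_contra hne
    have : 0 < u x := lt_of_le_of_ne h1 (Ne.symm hne)
    have := Real.sin_pos_of_pos_of_lt_pi (x := u x / 2) (by linarith) (by linarith)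
    linarith
  have huy : ∀ y ≤ x, u y = 0 := fun y hy =>
    le_antisymm ((hu.monotone hy).trans hux.le) (hu.nonneg y)
  have hcont : Continuous fun x => ‖Φ x 1‖ ^ 2 :=
    ((continuous_apply 1).comp h.continuous).norm.pow 2
  -- With u = 0 on this half line the interaction term drops out and |Φ₁|² satisfies q' = -2 (Im a)
  -- q ≤ 0. A nonincreasing function with limit 0 at -∞ is ≤ 0.
  have hanti : AntitoneOn (fun x => ‖Φ x 1‖ ^ 2) (Set.Iic x) := by
    refine antitoneOn_of_deriv_nonpos (convex_Iic x) hcont.continuousOn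
      (fun y _ => (hasDerivAt_sq_norm_snd h y).differentiableAt.differentiableWithinAt)
      fun y hy => ?_
    rw [interior_Iic] at hy
    rw [(hasDerivAt_sq_norm_snd h y).deriv, huy y hy.le]
    have := diagCoeff_im_pos hz
    simp
    positivity
  have hlim : Tendsto (fun x => ‖Φ x 1‖ ^ 2) atBot (𝓝 0) := by
    have := (tendsto_pi_nhds.1 (h.tendsto_atBot_zero hu.continuous hi) 1).norm.pow 2
    simpa using this
  have hle : ‖Φ x 1‖ ^ 2 ≤ 0 := by
    refine ge_of_tendsto hlim ?_
    filter_upwards [Iic_mem_atBot x] with y hy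
    exact hanti hy (Set.self_mem_Iic) hy
  have : ‖Φ x 1‖ = 0 := by nlinarith [norm_nonneg (Φ x 1)]
  exact norm_eq_zero.1 this

omit h0 hz in
lemma integrableOn_cos_mul_interaction :
    IntegrableOn (fun x => Real.cos (u x / 2) * interaction z Φ x) (Set.Iic x₀) := by
  refine Integrable.mono' (hi.const_mul ‖offCoeff z‖)
    (hu.continuous_cos.mul (continuous_interaction h.continuous)).aestronglyMeasurable
    (Eventually.of_forall fun x => ?_)
  rw [norm_mul]
  have h1 : ‖Real.cos (u x / 2)‖ ≤ 1 := Real.abs_cos_le_one _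
  calc _ ≤ 1 * (‖offCoeff z‖ * ‖Φ x‖ ^ 2) :=
        mul_le_mul h1 (abs_interaction_le z Φ x) (abs_nonneg _) zero_le_one
    _ = _ := one_mul _

/-- Integration by parts against w = cos/(sin + ε), a regularized cot(u/2): w is nonincreasing
because u is monotone, and the damping term contributes -2 (Im a) w cos |Φ₁|² ≤ 0 left of x₀. Hence
(w|Φ₁|²)' is at most twice the integrand, with zero boundary values at both ends. The shift by ε
keeps w bounded where sin(u/2) vanishes or tends to 0. -/
lemma integral_regularized_interaction_nonneg {ε : ℝ} (hε : 0 < ε) :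
    0 ≤ ∫ x in Set.Iic x₀, Real.sin (u x / 2) / (Real.sin (u x / 2) + ε)
      * (Real.cos (u x / 2) * interaction z Φ x) := by
  have hsε : ∀ x, 0 < Real.sin (u x / 2) + ε := fun x => by linarith [hu.sin_nonneg x]
  set w : ℝ → ℝ := fun x => Real.cos (u x / 2) / (Real.sin (u x / 2) + ε) with hw
  set F : ℝ → ℝ := fun x => Real.sin (u x / 2) / (Real.sin (u x / 2) + ε)
      * (Real.cos (u x / 2) * interaction z Φ x) with hF
  have hud : ∀ x, HasDerivAt u (deriv u x) x := fun x =>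
    (hu.contDiff.differentiable (by norm_num) x).hasDerivAt
  have hud0 : ∀ x, 0 ≤ deriv u x := fun x => hu.monotone.deriv_nonneg
  have hwd : ∀ x, HasDerivAt w (-(deriv u x / 2) * (Real.sin (u x / 2) * (Real.sin (u x / 2) + ε)
      + Real.cos (u x / 2) ^ 2) / (Real.sin (u x / 2) + ε) ^ 2) x := fun x => by
    have h1 := ((hud x).div_const 2).cos
    have h2 := (((hud x).div_const 2).sin).add_const ε
    refine (h1.div h2 (hsε x).ne').congr_deriv ?_
    congr 1; ring
  set g : ℝ → ℝ := fun x => w x * ‖Φ x 1‖ ^ 2 with hg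
  have hgd := fun x => (hwd x).mul (hasDerivAt_sq_norm_snd h x)
  have hcontF : Continuous F :=
    (hu.continuous_sin.div (hu.continuous_sin.add continuous_const) fun x => (hsε x).ne').mul
      (hu.continuous_cos.mul (continuous_interaction h.continuous))
  have hFi : IntegrableOn F (Set.Iic x₀) := by
    refine Integrable.mono' (integrableOn_cos_mul_interaction hu h hi).norm
      hcontF.aestronglyMeasurable (Eventually.of_forall fun x => ?_)
    rw [hF, norm_mul]
    refine mul_le_of_le_one_left (norm_nonneg _) ?_
    rw [Real.norm_of_nonneg (div_nonneg (hu.sin_nonneg x) (hsε x).le), div_le_one (hsε x)]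
    linarith
  have hineq : ∀ t ≤ x₀, -g t ≤ ∫ x in t..x₀, 2 * F x := by
    intro t ht
    have h1 := intervalIntegral.sub_le_integral_of_hasDeriv_right_of_le ht
      (g := g) (φ := fun x => 2 * F x)
      (fun x _ => (hgd x).continuousAt.continuousWithinAt)
      (fun x _ => (hgd x).hasDerivWithinAt)
      (continuous_const.mul hcontF).continuousOn.integrableOn_Icc
      (fun x hx => by
        have hc := hu.cos_nonneg h0 hx.2.le
        have hs := hu.sin_nonneg x
        have ha := diagCoeff_im_pos hz
        have e1 : (deriv u x / 2) * (Real.sin (u x / 2) * (Real.sin (u x / 2) + ε)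
          + Real.cos (u x / 2) ^ 2) / (Real.sin (u x / 2) + ε) ^ 2 * ‖Φ x 1‖ ^ 2 ≥ 0 := by
          have := hud0 x
          have := hsε x
          positivity
        have e2 : w x * (2 * (diagCoeff z).im * Real.cos (u x / 2)) * ‖Φ x 1‖ ^ 2 ≥ 0 := by
          have : 0 ≤ w x := div_nonneg hc (hsε x).le
          positivity
        have e3 : w x * (2 * Real.sin (u x / 2) * interaction z Φ x) = 2 * F x := by
          simp only [hw, hF]; ring
        rw [← e3]
        have e4 : -(deriv u x / 2) * (Real.sin (u x / 2) * (Real.sin (u x / 2) + ε)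
          + Real.cos (u x / 2) ^ 2) / (Real.sin (u x / 2) + ε) ^ 2 * ‖Φ x 1‖ ^ 2
          = -((deriv u x / 2) * (Real.sin (u x / 2) * (Real.sin (u x / 2) + ε)
          + Real.cos (u x / 2) ^ 2) / (Real.sin (u x / 2) + ε) ^ 2 * ‖Φ x 1‖ ^ 2) := by ring
        rw [e4]
        nlinarith)
    -- The half line ends where u = π so that cos(u/2) = 0 and no boundary term remains.
    have h2 : g x₀ = 0 := by
      simp [hg, hw, h0]
    rw [h2, zero_sub] at h1
    exact h1
  have hq : Tendsto (fun x => ‖Φ x 1‖ ^ 2) atBot (𝓝 0) := by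
    have := (tendsto_pi_nhds.1 (h.tendsto_atBot_zero hu.continuous hi) 1).norm.pow 2
    simpa using this
  have hg0 : Tendsto g atBot (𝓝 0) := by
    refine squeeze_zero_norm (a := fun x => 1 / ε * ‖Φ x 1‖ ^ 2) (fun x => ?_)
      (by simpa using hq.const_mul (1 / ε))
    rw [hg, norm_mul, Real.norm_of_nonneg (sq_nonneg ‖Φ x 1‖)]
    refine mul_le_mul_of_nonneg_right ?_ (sq_nonneg _)
    rw [hw, norm_div, Real.norm_of_nonneg (hsε x).le]
    exact div_le_div₀ zero_le_one (Real.abs_cos_le_one _) hε (by linarith [hu.sin_nonneg x])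
  have hlim := intervalIntegral_tendsto_integral_Iic x₀ (hFi.const_mul 2) tendsto_id
  have h3 : -0 ≤ ∫ x in Set.Iic x₀, 2 * F x := by
    refine le_of_tendsto_of_tendsto hg0.neg hlim ?_
    filter_upwards [Iic_mem_atBot x₀] with t ht using hineq t ht
  rw [integral_const_mul] at h3
  linarith

/-- The key positivity property: it uses the monotonicity of the potential. -/
lemma integral_cos_mul_interaction_nonneg :
    0 ≤ ∫ x in Set.Iic x₀, Real.cos (u x / 2) * interaction z Φ x := by
  set G := fun x => Real.cos (u x / 2) * interaction z Φ x with hG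
  have hGi := integrableOn_cos_mul_interaction hu h hi
  have hcG : Continuous G := hu.continuous_cos.mul (continuous_interaction h.continuous)
  have hpos : ∀ n : ℕ, (0 : ℝ) < 1 / ((n : ℝ) + 1) := fun n => by positivity
  have hlim : Tendsto (fun n : ℕ => ∫ x in Set.Iic x₀, Real.sin (u x / 2)
      / (Real.sin (u x / 2) + 1 / ((n : ℝ) + 1)) * G x) atTop (𝓝 (∫ x in Set.Iic x₀, G x)) := by
    refine tendsto_integral_of_dominated_convergence (fun x => ‖G x‖) (fun n => ?_) hGi.norm
      (fun n => Eventually.of_forall fun x => ?_) ?_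
    · exact ((hu.continuous_sin.div (hu.continuous_sin.add continuous_const) fun x =>
        (add_pos_of_nonneg_of_pos (hu.sin_nonneg x) (hpos n)).ne').mul hcG).aestronglyMeasurable
    · rw [norm_mul]
      refine mul_le_of_le_one_left (norm_nonneg _) ?_
      have h1 := hu.sin_nonneg x
      have h2 := hpos n
      rw [Real.norm_of_nonneg (by positivity), div_le_one (by positivity)]
      linarith
    · filter_upwards [ae_restrict_mem measurableSet_Iic] with x hx
      -- Where sin vanishes the factor sin/(sin + ε) does not tend to 1, but there Φ₁ = 0 and the
      -- limit integrand vanishes too.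
      by_cases hs : Real.sin (u x / 2) = 0
      · have : G x = 0 := by
          simp only [hG, interaction, snd_eq_zero_of_sin_eq_zero hu h0 hz h hi hx hs]; simp
        simp [this]
      · have h1 := (tendsto_one_div_add_atTop_nhds_zero_nat (𝕜 := ℝ)).const_add
          (Real.sin (u x / 2))
        rw [add_zero] at h1
        have h2 := ((tendsto_const_nhds (x := Real.sin (u x / 2))).div h1 hs).mul_const (G x)
        rw [div_self hs, one_mul] at h2
        exact h2
  exact ge_of_tendsto' hlim fun n =>
    integral_regularized_interaction_nonneg hu h0 hz h hi (hpos n)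

end Kink

/-! ### No eigenvalues off the unit circle -/

lemma memLp_two_iff {Φ : ℝ → Fin 2 → ℂ} (hc : Continuous Φ) :
    MemLp Φ 2 volume ↔ Integrable (fun x => ‖Φ x‖ ^ 2) :=
  memLp_two_iff_integrable_sq_norm hc.aestronglyMeasurable

lemma norm_reflectSol (Φ : ℝ → Fin 2 → ℂ) (x : ℝ) : ‖reflectSol Φ x‖ = ‖Φ (-x)‖ := by
  have h : ∀ v : Fin 2 → ℂ, ‖![v 0, -v 1]‖ ≤ ‖v‖ := fun v => by
    rw [pi_norm_le_iff_of_nonneg (norm_nonneg _), Fin.forall_fin_two]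
    simp [norm_le_pi_norm]
  refine le_antisymm (h _) ?_
  have := h (reflectSol Φ x)
  refine le_trans (le_of_eq ?_) this
  congr 1
  ext i; fin_cases i <;> simp [reflectSol]

lemma integrable_sq_norm_reflectSol {Φ : ℝ → Fin 2 → ℂ} (h : Integrable (fun x => ‖Φ x‖ ^ 2)) :
    Integrable (fun x => ‖reflectSol Φ x‖ ^ 2) := by
  simp only [norm_reflectSol]
  exact h.comp_neg

lemma interaction_reflectSol (z : ℂ) (Φ : ℝ → Fin 2 → ℂ) (x : ℝ) :
    interaction z (reflectSol Φ) x = -interaction z Φ (-x) := by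
  simp [interaction, reflectSol]

lemma reflect_neg_eq_pi {u : ℝ → ℝ} {x₀ : ℝ} (h0 : u x₀ = Real.pi) :
    reflect u (-x₀) = Real.pi := by
  rw [reflect, neg_neg, h0]; ring

section Kink
variable {u : ℝ → ℝ} (hu : IsMonotoneKink u) {z : ℂ}
  (hz : 0 < z.im) {Φ : ℝ → Fin 2 → ℂ} (h : IsSolution u z Φ)
  (hi : Integrable (fun x => ‖Φ x‖ ^ 2))
include hu hz h hi

/-- Under reflection both the cosine and the interaction change sign, so their product is preserved
and the right half line follows from the left one. -/
lemma integral_univ_cos_mul_interaction_nonneg :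
    0 ≤ ∫ x, Real.cos (u x / 2) * interaction z Φ x := by
  obtain ⟨x₀, h0⟩ := hu.exists_eq_pi
  have hl := integral_cos_mul_interaction_nonneg hu h0 hz h hi.integrableOn
  have hi' := integrable_sq_norm_reflectSol hi
  have hr := integral_cos_mul_interaction_nonneg hu.reflect (reflect_neg_eq_pi h0) hz h.reflectSol
    hi'.integrableOn
  have hli := integrableOn_cos_mul_interaction (x₀ := x₀) hu h hi.integrableOn
  have e : ∀ x, Real.cos (reflect u x / 2) * interaction z (reflectSol Φ) x
      = (fun x => Real.cos (u x / 2) * interaction z Φ x) (-x) := fun x => by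
    simp only [cos_reflect, interaction_reflectSol]; ring
  simp only [e] at hr
  rw [integral_comp_neg_Iic (-x₀) (fun x => Real.cos (u x / 2) * interaction z Φ x), neg_neg] at hr
  have hri' : IntegrableOn (fun x => Real.cos (u x / 2) * interaction z Φ x) (Set.Ioi x₀) := by
    refine Integrable.integrableOn ?_
    refine Integrable.mono' (hi.const_mul ‖offCoeff z‖)
      (hu.continuous_cos.mul (continuous_interaction h.continuous)).aestronglyMeasurable
      (Eventually.of_forall fun x => ?_)
    rw [norm_mul]
    have h1 : ‖Real.cos (u x / 2)‖ ≤ 1 := Real.abs_cos_le_one _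
    calc _ ≤ 1 * (‖offCoeff z‖ * ‖Φ x‖ ^ 2) :=
          mul_le_mul h1 (abs_interaction_le z Φ x) (abs_nonneg _) zero_le_one
      _ = _ := one_mul _
  rw [← intervalIntegral.integral_Iic_add_Ioi hli hri']
  exact add_nonneg hl hr

/-- A square integrable solution vanishes off the unit circle. -/
lemma eq_zero_of_norm_ne_one (hz1 : ‖z‖ ≠ 1) (x : ℝ) : Φ x = 0 := by
  have hn1 : Complex.normSq z ≠ 1 := by
    rw [Complex.normSq_eq_norm_sq]
    intro h1
    exact hz1 ((pow_eq_one_iff_of_nonneg (norm_nonneg z) two_ne_zero).1 h1)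
  have hninv : 1 - (Complex.normSq z)⁻¹ ≠ 0 := by
    intro h1; apply hn1; rw [sub_eq_zero, eq_comm, inv_eq_one] at h1; exact h1
  set a := diagCoeff z with ha
  set b := offCoeff z with hb
  have hbi : b.im ≠ 0 := by
    rw [hb, offCoeff_im]
    exact div_ne_zero (mul_ne_zero hz.ne' hninv) (by norm_num)
  have hc0 : Continuous fun x => Φ x 0 := (continuous_apply 0).comp h.continuous
  have hc1 : Continuous fun x => Φ x 1 := (continuous_apply 1).comp h.continuous
  have hcc0 : Continuous fun x => starRingEnd ℂ (Φ x 0) := Complex.continuous_conj.comp hc0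
  have hcos := Complex.continuous_ofReal.comp hu.continuous_cos
  have hsin := Complex.continuous_ofReal.comp hu.continuous_sin
  have hcosb : ∀ x, ‖(Real.cos (u x / 2) : ℂ)‖ ≤ 1 := fun x => by
    rw [Complex.norm_real]; exact Real.abs_cos_le_one _
  have hsinb : ∀ x, ‖Real.sin (u x / 2)‖ ≤ 1 := fun x => Real.abs_sin_le_one _
  set g : ℝ → ℂ := fun x => starRingEnd ℂ (Φ x 0) * Φ x 1 with hg
  have hgc : Continuous g := hcc0.mul hc1
  have hgb : ∀ x, ‖g x‖ ≤ 1 * ‖Φ x‖ ^ 2 := fun x => by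
    rw [hg, norm_mul, Complex.norm_conj, sq, one_mul]
    gcongr <;> exact norm_le_pi_norm _ _
  have hgi : Integrable g := integrableOn_univ.1
    (integrableOn_mul_of_sq MeasurableSet.univ hi.integrableOn hgc fun x _ => hgb x)
  have hcgi : Integrable fun x => (Real.cos (u x / 2) : ℂ) * g x := integrableOn_univ.1
    (integrableOn_mul_of_sq MeasurableSet.univ hi.integrableOn (hcos.mul hgc) (C := 1) fun x _ => by
      rw [norm_mul]
      exact (mul_le_of_le_one_left (norm_nonneg _) (hcosb x)).trans (hgb x))
  have hsi : ∀ i, Integrable fun x => Real.sin (u x / 2) * ‖Φ x i‖ ^ 2 := fun i => by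
    refine Integrable.mono' hi (hu.continuous_sin.mul
      (((continuous_apply i).comp h.continuous).norm.pow 2)).aestronglyMeasurable
      (Eventually.of_forall fun x => ?_)
    rw [norm_mul, norm_pow, norm_norm]
    refine (mul_le_of_le_one_left (by positivity) (hsinb x)).trans ?_
    gcongr
    exact norm_le_pi_norm _ _
  -- Integrating this derivative over the line gives 2 (Re a) Z + b S₀ - b̄ S₁ = 0, where Z, S₀, S₁
  -- are the integrals defined below.
  have hgd : ∀ x, HasDerivAt g (Complex.I * (2 * a.re : ℝ) * ((Real.cos (u x / 2) : ℂ) * g x)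
      + (Complex.I * b * ((Real.sin (u x / 2) * ‖Φ x 0‖ ^ 2 : ℝ) : ℂ)
        - Complex.I * starRingEnd ℂ b * ((Real.sin (u x / 2) * ‖Φ x 1‖ ^ 2 : ℝ) : ℂ))) x := by
    intro x
    obtain ⟨h0, h1⟩ := isSolution_iff.1 h x
    refine (h0.star.mul h1).congr_deriv ?_
    simp only [Complex.star_def, hg, Complex.sq_norm, Complex.normSq_eq_conj_mul_self,
      Complex.ofReal_mul, map_add, map_mul, map_neg, Complex.conj_I, Complex.conj_ofReal]
    have e : ((2 : ℝ) : ℂ) * (a.re : ℂ) = a + starRingEnd ℂ a := by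
      rw [Complex.add_conj]; push_cast; ring
    rw [e]
    ring
  set Z := ∫ x, (Real.cos (u x / 2) : ℂ) * g x with hZ
  set S₀ := ∫ x, Real.sin (u x / 2) * ‖Φ x 0‖ ^ 2 with hS₀
  set S₁ := ∫ x, Real.sin (u x / 2) * ‖Φ x 1‖ ^ 2 with hS₁
  have hi0 : Integrable fun x =>
      Complex.I * b * ((Real.sin (u x / 2) * ‖Φ x 0‖ ^ 2 : ℝ) : ℂ) := (hsi 0).ofReal.const_mul _
  have hi1 : Integrable fun x =>
      Complex.I * starRingEnd ℂ b * ((Real.sin (u x / 2) * ‖Φ x 1‖ ^ 2 : ℝ) : ℂ) :=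
    (hsi 1).ofReal.const_mul _
  have hi2 : Integrable fun x =>
      Complex.I * (2 * a.re : ℝ) * ((Real.cos (u x / 2) : ℂ) * g x) := hcgi.const_mul _
  have hi3 : Integrable fun x => Complex.I * b * ((Real.sin (u x / 2) * ‖Φ x 0‖ ^ 2 : ℝ) : ℂ)
      - Complex.I * starRingEnd ℂ b * ((Real.sin (u x / 2) * ‖Φ x 1‖ ^ 2 : ℝ) : ℂ) := hi0.sub hi1
  have hrel := integral_eq_zero_of_hasDerivAt_of_integrable hgd (hi2.add hi3) hgi
  rw [integral_add hi2 hi3, integral_sub hi0 hi1, integral_const_mul, integral_const_mul,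
    integral_const_mul, integral_complex_ofReal, integral_complex_ofReal, ← hZ, ← hS₀, ← hS₁] at hrel
  have hbZ : 0 ≤ (starRingEnd ℂ b * Z).im := by
    have h1 := integral_univ_cos_mul_interaction_nonneg hu hz h hi
    have h2 : (starRingEnd ℂ b * Z).im = ∫ x, Real.cos (u x / 2) * interaction z Φ x := by
      rw [hZ, ← integral_const_mul]
      have := Complex.imCLM.integral_comp_comm (hcgi.const_mul (starRingEnd ℂ b))
      simp only [Complex.imCLM_apply] at this
      rw [← this]
      congr 1; ext x
      rw [interaction, mul_left_comm, Complex.im_ofReal_mul]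
    rw [h2]; exact h1
  have hS₀n : 0 ≤ S₀ := integral_nonneg fun x => mul_nonneg (hu.sin_nonneg x) (sq_nonneg _)
  have hS₁n : 0 ≤ S₁ := integral_nonneg fun x => mul_nonneg (hu.sin_nonneg x) (sq_nonneg _)
  have hrel' : ((2 * a.re : ℝ) : ℂ) * Z + b * S₀ - starRingEnd ℂ b * S₁ = 0 := by
    have : Complex.I * (((2 * a.re : ℝ) : ℂ) * Z + b * S₀ - starRingEnd ℂ b * S₁) = 0 := by
      linear_combination hrel
    exact (mul_eq_zero.1 this).resolve_left Complex.I_ne_zero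
  -- Equivalently, a² - b² = -1/4 is real.
  have hab : b.re * b.im = a.re * a.im := by
    rw [ha, hb, offCoeff_re, offCoeff_im, diagCoeff_re, diagCoeff_im]; ring
  have hai : 0 < a.im := diagCoeff_im_pos hz
  have hS₁0 : S₁ = 0 := by
    -- If Re a = 0, the imaginary part of the relation reads (Im b)(S₀ + S₁) = 0. Otherwise
    -- multiplying by b̄ and taking imaginary parts eliminates S₀ and leaves Im(b̄Z) + (Im a) S₁ =
    -- 0, a sum of nonnegative terms.
    by_cases har : a.re = 0
    · have hzr : z.re = 0 := by
        rw [ha, diagCoeff_re] at har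
        rcases mul_eq_zero.1 ((div_eq_zero_iff.1 har).resolve_right (by norm_num)) with h1 | h1
        · exact h1
        · exact (hninv h1).elim
      have him := congrArg Complex.im hrel'
      simp [har] at him
      have : b.im * (S₀ + S₁) = 0 := by linarith
      have := (mul_eq_zero.1 this).resolve_left hbi
      linarith
    · have h1 := congrArg Complex.im (congrArg (starRingEnd ℂ b * ·) hrel')
      have h2 : (starRingEnd ℂ b * (((2 * a.re : ℝ) : ℂ) * Z + b * S₀ - starRingEnd ℂ b * S₁)).im
          = 2 * (a.re * (starRingEnd ℂ b * Z).im) + 2 * (b.re * b.im) * S₁ := by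
        simp; ring
      simp only [mul_zero, Complex.zero_im] at h1
      rw [h2, hab] at h1
      have h3 : a.re * ((starRingEnd ℂ b * Z).im + a.im * S₁) = 0 := by linarith
      have h4 := (mul_eq_zero.1 h3).resolve_left har
      have h5 : 0 ≤ a.im * S₁ := by positivity
      have h6 : a.im * S₁ = 0 := by linarith
      exact (mul_eq_zero.1 h6).resolve_left hai.ne'
  have hq : ∀ x, Real.sin (u x / 2) * ‖Φ x 1‖ ^ 2 = 0 := by
    have h1 := (integral_eq_zero_iff_of_nonneg
      (fun x => mul_nonneg (hu.sin_nonneg x) (sq_nonneg ‖Φ x 1‖)) (hsi 1)).1 hS₁0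
    have h2 := (Continuous.ae_eq_iff_eq volume
      (hu.continuous_sin.mul (hc1.norm.pow 2)) continuous_zero).1 h1
    exact fun x => congrFun h2 x
  obtain ⟨x₀, h0⟩ := hu.exists_eq_pi
  have hs1 : Real.sin (u x₀ / 2) = 1 := by rw [h0, Real.sin_pi_div_two]
  -- Near a point where u = π the sine is positive, so Φ₁ vanishes identically there; its equation
  -- then forces Φ₀ = 0 as b ≠ 0.
  have hev : (fun x => Φ x 1) =ᶠ[𝓝 x₀] fun _ => 0 := by
    have h1 : ∀ᶠ x in 𝓝 x₀, 0 < Real.sin (u x / 2) :=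
      hu.continuous_sin.continuousAt.eventually (lt_mem_nhds (one_pos.trans_eq hs1.symm))
    filter_upwards [h1] with x hx
    have h2 := (mul_eq_zero.1 (hq x)).resolve_left hx.ne'
    exact norm_eq_zero.1 (pow_eq_zero_iff (two_ne_zero) |>.1 h2)
  have hq0 : Φ x₀ 1 = 0 := hev.self_of_nhds
  have hd := (isSolution_iff.1 h x₀).2
  have hd' : HasDerivAt (fun x => Φ x 1) 0 x₀ := (hasDerivAt_const x₀ (0 : ℂ)).congr_of_eventuallyEq hev
  have h3 := hd.unique hd'
  rw [hs1, hq0] at h3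
  have hb0 : offCoeff z ≠ 0 := by
    intro h4; apply hbi; rw [hb, h4]; rfl
  have hp0 : Φ x₀ 0 = 0 := by
    simpa [hb0] using h3
  refine h.eq_zero (x₀ := x₀) ?_ x
  ext i; fin_cases i <;> simp [hp0, hq0]

end Kink

/-! ### Eigenvalues as zeros of the Wronskian -/

/-- The normalized solution at `+∞`. -/
def rightSol (u : ℝ → ℝ) (z : ℂ) : ℝ → Fin 2 → ℂ := reflectSol (leftSol (reflect u) z)

/-- The Wronskian of the normalized solutions. -/
def normalizedWronskian (u : ℝ → ℝ) (z : ℂ) : ℂ := wronskian (leftSol u z) (rightSol u z) 0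

section Kink
variable {u : ℝ → ℝ} (hu : IsMonotoneKink u) {z : ℂ} (hz : 0 < z.im)
include hu hz

lemma isSolution_rightSol : IsSolution u z (rightSol u z) := by
  have := (isNormalizedLeft_leftSol hu.reflect hz).1.reflectSol
  rwa [reflect_reflect] at this

lemma rightSol_ne_zero (x : ℝ) : rightSol u z x ≠ 0 := by
  rw [← norm_ne_zero_iff, rightSol, norm_reflectSol, norm_ne_zero_iff]
  exact (isNormalizedLeft_leftSol hu.reflect hz).ne_zero _

lemma wronskian_leftSol_rightSol (x : ℝ) :
    wronskian (leftSol u z) (rightSol u z) x = normalizedWronskian u z :=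
  wronskian_const (isNormalizedLeft_leftSol hu hz).1 (isSolution_rightSol hu hz) x 0

lemma exists_eq_smul_leftSol {Φ : ℝ → Fin 2 → ℂ} (h : IsSolution u z Φ) {X : ℝ}
    (hi : IntegrableOn (fun x => ‖Φ x‖ ^ 2) (Set.Iic X)) :
    ∃ k : ℂ, ∀ x, Φ x = k • leftSol u z x :=
  exists_smul_of_tendsto_zero h (isNormalizedLeft_leftSol hu hz).1
    ((isNormalizedLeft_leftSol hu hz).ne_zero 0) (h.tendsto_atBot_zero hu.continuous hi)
    ((isNormalizedLeft_leftSol hu hz).tendsto_zero hz)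

lemma exists_eq_smul_rightSol {Φ : ℝ → Fin 2 → ℂ} (h : IsSolution u z Φ)
    (hi : Integrable (fun x => ‖Φ x‖ ^ 2)) :
    ∃ k : ℂ, ∀ x, Φ x = k • rightSol u z x := by
  obtain ⟨k, hk⟩ := exists_eq_smul_leftSol hu.reflect hz h.reflectSol (X := 0)
    (integrable_sq_norm_reflectSol hi).integrableOn
  refine ⟨k, fun x => ?_⟩
  have h1 := congrFun (reflectSol_reflectSol Φ) x
  rw [← h1]
  have h2 := hk (-x)
  ext i
  fin_cases i
  · have h3 := congrFun h2 0
    simp [reflectSol] at h3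
    simp [reflectSol, rightSol, ← h3]
  · have h3 := congrFun h2 1
    simp [reflectSol] at h3
    simp [reflectSol, rightSol, ← h3]

lemma exists_leftSol_eq_smul_rightSol (hw : normalizedWronskian u z = 0) :
    ∃ k : ℂ, k ≠ 0 ∧ ∀ x, leftSol u z x = k • rightSol u z x := by
  obtain ⟨k, hk⟩ := exists_smul_of_wronskian_eq_zero (isNormalizedLeft_leftSol hu hz).1
    (isSolution_rightSol hu hz) (rightSol_ne_zero hu hz 0) hw
  refine ⟨k, ?_, hk⟩
  rintro rfl
  exact (isNormalizedLeft_leftSol hu hz).ne_zero 0 (by simpa using hk 0)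

lemma integrable_sq_norm_leftSol (hw : normalizedWronskian u z = 0) :
    Integrable (fun x => ‖leftSol u z x‖ ^ 2) := by
  obtain ⟨k, -, hk⟩ := exists_leftSol_eq_smul_rightSol hu hz hw
  have h1 := integrableOn_sq_norm_leftSol hu hz 0
  have h2 := integrableOn_sq_norm_leftSol hu.reflect hz 0
  have h3 : IntegrableOn (fun x => ‖rightSol u z x‖ ^ 2) (Set.Ici 0) := by
    have h4 : IntegrableOn (fun x => ‖leftSol (reflect u) z x‖ ^ 2) (Set.Iic (-0)) := by
      simpa using h2
    simp only [rightSol, norm_reflectSol]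
    exact h4.comp_neg_Ici
  have h4 : IntegrableOn (fun x => ‖leftSol u z x‖ ^ 2) (Set.Ici 0) := by
    simp only [hk, norm_smul, mul_pow]
    exact h3.const_mul _
  have h5 := h1.union h4
  rwa [Set.Iic_union_Ici, integrableOn_univ] at h5

lemma leftSol_mem_eigenspace (hw : normalizedWronskian u z = 0) :
    leftSol u z ∈ eigenspace u z :=
  ⟨(isNormalizedLeft_leftSol hu hz).1,
    (memLp_two_iff (isNormalizedLeft_leftSol hu hz).1.continuous).2
      (integrable_sq_norm_leftSol hu hz hw)⟩

/-- A square integrable solution decays at both ends, hence is a multiple of both normalized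
solutions. Conversely, if these are proportional, they decay exponentially on both sides. -/
lemma isEigenvalue_iff : IsEigenvalue u z ↔ normalizedWronskian u z = 0 := by
  constructor
  · rintro ⟨-, hne⟩
    obtain ⟨Φ, hΦ, hΦ0⟩ := (Submodule.ne_bot_iff _).1 hne
    obtain ⟨hs, hL⟩ : IsSolution u z Φ ∧ MemLp Φ 2 volume := hΦ
    have hi := (memLp_two_iff hs.continuous).1 hL
    obtain ⟨k, hk⟩ := exists_eq_smul_leftSol hu hz hs (X := 0) hi.integrableOn
    obtain ⟨l, hl⟩ := exists_eq_smul_rightSol hu hz hs hi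
    have hk0 : k ≠ 0 := by
      rintro rfl; exact hΦ0 (funext fun x => by simpa using hk x)
    have hl0 : l ≠ 0 := by
      rintro rfl; exact hΦ0 (funext fun x => by simpa using hl x)
    have h1 : k * l * normalizedWronskian u z = wronskian Φ Φ 0 := by
      have e1 : wronskian Φ Φ 0 = wronskian (fun x => k • leftSol u z x)
          (fun x => l • rightSol u z x) 0 := by
        rw [← funext hk, ← funext hl]
      rw [e1]
      simp [wronskian, normalizedWronskian]; ring
    have h2 : wronskian Φ Φ 0 = 0 := by simp [wronskian]; ring
    rw [h2] at h1
    simpa [hk0, hl0] using h1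
  · intro hw
    refine ⟨ne_zero_of_im_pos hz, (Submodule.ne_bot_iff _).2
      ⟨_, leftSol_mem_eigenspace hu hz hw, fun h0 => ?_⟩⟩
    exact (isNormalizedLeft_leftSol hu hz).ne_zero 0 (congrFun h0 0)

lemma finrank_eigenspace (hw : normalizedWronskian u z = 0) :
    Module.finrank ℂ (eigenspace u z) = 1 := by
  refine finrank_eq_one_iff'.2 ⟨⟨_, leftSol_mem_eigenspace hu hz hw⟩, fun h0 => ?_, ?_⟩
  · have := congrArg Subtype.val h0
    exact (isNormalizedLeft_leftSol hu hz).ne_zero 0 (congrFun this 0)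
  · rintro ⟨Φ, hs, hL⟩
    have hi := (memLp_two_iff hs.continuous).1 hL
    obtain ⟨k, hk⟩ := exists_eq_smul_leftSol hu hz hs (X := 0) hi.integrableOn
    exact ⟨k, Subtype.ext (funext fun x => (hk x).symm)⟩

end Kink

/-! ### From normalized solutions to Jost solutions -/

/-- The constant relating the normalized solution and the Jost solution at `-∞`. -/
def jostConst (u : ℝ → ℝ) (z : ℂ) : ℂ :=
  Complex.exp (-(Complex.I * diagCoeff z * ((∫ x in Set.Iic 0, (1 - Real.cos (u x / 2)) : ℝ) : ℂ)))

/-- The Jost factor involves ∫ cos(u/2), the normalization only x. The discrepancy ∫ (1 - cos(u/2))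
converges at -∞, so only a constant factor separates the two. -/
lemma isLeftJost_smul {u : ℝ → ℝ} (hu : IsMonotoneKink u) {z : ℂ} {J : ℝ → Fin 2 → ℂ}
    (h : IsNormalizedLeft u z J) : IsLeftJost u z (fun x => jostConst u z • J x) := by
  refine ⟨h.1.smul _, ?_⟩
  have hint : ∀ x, (∫ y in (0 : ℝ)..x, Real.cos (u y / 2))
      = x - ∫ y in (0 : ℝ)..x, (1 - Real.cos (u y / 2)) := fun x => by
    rw [intervalIntegral.integral_sub (by simp) (hu.continuous_cos.intervalIntegrable _ _)]
    simp
  have hlim : Tendsto (fun x : ℝ => ∫ y in (0 : ℝ)..x, (1 - Real.cos (u y / 2))) atBot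
      (𝓝 (-∫ x in Set.Iic 0, (1 - Real.cos (u x / 2)))) := by
    have := (intervalIntegral_tendsto_integral_Iic 0 (hu.integrableOn_one_sub_cos 0)
      tendsto_id).neg
    refine this.congr fun x => ?_
    rw [← intervalIntegral.integral_symm]; rfl
  have h1 : ∀ x, (jostFactor u z x)⁻¹ • jostConst u z • J x
      = (jostConst u z * Complex.exp (-(Complex.I * diagCoeff z *
        ((∫ y in (0 : ℝ)..x, (1 - Real.cos (u y / 2)) : ℝ) : ℂ)))) •
        (Complex.exp (Complex.I * diagCoeff z * (x : ℂ)) • J x) := fun x => by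
    rw [smul_smul, smul_smul, jostFactor, ← Complex.exp_neg, hint]
    congr 1
    rw [mul_assoc (jostConst u z), ← Complex.exp_add, mul_comm]
    congr 2
    simp only [diagCoeff]
    push_cast
    ring
  have h2 : Tendsto (fun x : ℝ => jostConst u z * Complex.exp (-(Complex.I * diagCoeff z *
        ((∫ y in (0 : ℝ)..x, (1 - Real.cos (u y / 2)) : ℝ) : ℂ)))) atBot (𝓝 1) := by
    have h3 := (Complex.continuous_exp.tendsto _).comp
      (((Complex.continuous_ofReal.tendsto _).comp hlim).const_mul (Complex.I * diagCoeff z)).neg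
    have h4 := h3.const_mul (jostConst u z)
    have h5 : jostConst u z * Complex.exp (-(Complex.I * diagCoeff z *
        ((-∫ x in Set.Iic 0, (1 - Real.cos (u x / 2)) : ℝ) : ℂ))) = 1 := by
      rw [jostConst, ← Complex.exp_add, ← Complex.exp_zero]
      congr 1
      push_cast
      ring
    rw [h5] at h4
    exact h4
  have h3 := h2.smul h.2
  rw [one_smul] at h3
  exact h3.congr fun x => (h1 x).symm

lemma jostFactor_reflect (u : ℝ → ℝ) (z : ℂ) (x : ℝ) :
    jostFactor (reflect u) z (-x) = jostFactor u z x := by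
  have h : (∫ y in (0 : ℝ)..(-x), Real.cos (reflect u y / 2))
      = ∫ y in (0 : ℝ)..x, Real.cos (u y / 2) := by
    simp only [cos_reflect]
    rw [intervalIntegral.integral_neg,
      intervalIntegral.integral_comp_neg (fun y => Real.cos (u y / 2)), neg_neg, neg_zero,
      ← intervalIntegral.integral_symm]
  rw [jostFactor, h, jostFactor]

lemma IsLeftJost.reflectSol {u : ℝ → ℝ} {z : ℂ} {Ψ : ℝ → Fin 2 → ℂ}
    (h : IsLeftJost (reflect u) z Ψ) : IsRightJost u z (reflectSol Ψ) := by
  refine ⟨by simpa only [reflect_reflect] using h.1.reflectSol, ?_⟩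
  have h1 := h.2.comp tendsto_neg_atTop_atBot
  rw [tendsto_pi_nhds, Fin.forall_fin_two] at h1 ⊢
  constructor
  · refine h1.1.congr fun x => ?_
    simp [SineGordonScattering.reflectSol, jostFactor_reflect]
  · have h2 := h1.2.neg
    have e : -(![1, 0] : Fin 2 → ℂ) 1 = ![1, 0] 1 := by simp
    rw [e] at h2
    refine h2.congr fun x => ?_
    simp [SineGordonScattering.reflectSol, jostFactor_reflect]

/-- Both constants are exponentials, so the Jost and the normalized Wronskian have the same zeros.
-/
lemma isJostWronskian {u : ℝ → ℝ} (hu : IsMonotoneKink u) {z : ℂ} (hz : 0 < z.im) :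
    IsJostWronskian u z (jostConst u z * jostConst (reflect u) z * normalizedWronskian u z) := by
  refine ⟨_, _, isLeftJost_smul hu (isNormalizedLeft_leftSol hu hz),
    (isLeftJost_smul hu.reflect (isNormalizedLeft_leftSol hu.reflect hz)).reflectSol, fun x => ?_⟩
  rw [← wronskian_leftSol_rightSol hu hz x]
  simp [wronskian, reflectSol, rightSol]
  ring

/-! ### Green's identity and its kernel -/

/-- The integrand of the Green identity for the normalized solutions at `z` and `ζ`. -/
def greenIntegrand (u : ℝ → ℝ) (z ζ : ℂ) (x : ℝ) : ℂ :=
  Complex.I / 4 * ((1 + 1 / (z * ζ)) * (Real.cos (u x / 2) : ℂ)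
      * (leftSol u z x 0 * leftSol u ζ x 1 + leftSol u z x 1 * leftSol u ζ x 0)
    + (1 - 1 / (z * ζ)) * (Real.sin (u x / 2) : ℂ)
      * (leftSol u z x 0 * leftSol u ζ x 0 - leftSol u z x 1 * leftSol u ζ x 1))

/-- The divided difference of the Wronskian of normalized solutions at `z` and `ζ`. -/
def greenKernel (u : ℝ → ℝ) (x₀ : ℝ) (z ζ : ℂ) : ℂ :=
  ∫ x in Set.Iic x₀, greenIntegrand u z ζ x

lemma norm_greenIntegrand_le (u : ℝ → ℝ) (z ζ : ℂ) (x : ℝ) {B C D : ℝ}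
    (hB : ‖1 / (z * ζ)‖ ≤ B) (hC : ‖leftSol u z x‖ ≤ C) (hD : ‖leftSol u ζ x‖ ≤ D) :
    ‖greenIntegrand u z ζ x‖ ≤ (1 + B) * C * D := by
  have hc : ‖(Real.cos (u x / 2) : ℂ)‖ ≤ 1 := by
    rw [Complex.norm_real]; exact Real.abs_cos_le_one _
  have hs : ‖(Real.sin (u x / 2) : ℂ)‖ ≤ 1 := by
    rw [Complex.norm_real]; exact Real.abs_sin_le_one _
  have hC0 : 0 ≤ C := (norm_nonneg _).trans hC
  have hB0 : 0 ≤ B := (norm_nonneg _).trans hB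
  have hprod : ∀ i j, ‖leftSol u z x i * leftSol u ζ x j‖ ≤ C * D := fun i j => by
    rw [norm_mul]
    exact mul_le_mul ((norm_le_pi_norm _ i).trans hC) ((norm_le_pi_norm _ j).trans hD)
      (norm_nonneg _) hC0
  have h1 : ‖1 + 1 / (z * ζ)‖ ≤ 1 + B := (norm_add_le _ _).trans (by rw [norm_one]; linarith)
  have h2 : ‖1 - 1 / (z * ζ)‖ ≤ 1 + B := (norm_sub_le _ _).trans (by rw [norm_one]; linarith)
  have hI : ‖Complex.I / 4‖ = 1 / 4 := by simp
  rw [greenIntegrand, norm_mul, hI]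
  calc _ ≤ 1 / 4 * ((1 + B) * 1 * (C * D + C * D) + (1 + B) * 1 * (C * D + C * D)) := by
        gcongr
        refine (norm_add_le _ _).trans ?_
        rw [norm_mul, norm_mul, norm_mul, norm_mul]
        gcongr
        · exact (norm_add_le _ _).trans (add_le_add (hprod _ _) (hprod _ _))
        · exact (norm_sub_le _ _).trans (add_le_add (hprod _ _) (hprod _ _))
    _ = _ := by ring

section Kink
variable {u : ℝ → ℝ} (hu : IsMonotoneKink u) {z : ℂ} (hz : 0 < z.im)
include hu hz

lemma continuous_greenIntegrand {ζ : ℂ} (hζ : 0 < ζ.im) : Continuous (greenIntegrand u z ζ) := by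
  have h0 := (isNormalizedLeft_leftSol hu hz).1.continuous
  have h1 := (isNormalizedLeft_leftSol hu hζ).1.continuous
  have hc : Continuous u := hu.continuous
  have e : ∀ i, Continuous fun x => leftSol u z x i := fun i => (continuous_apply i).comp h0
  have e' : ∀ i, Continuous fun x => leftSol u ζ x i := fun i => (continuous_apply i).comp h1
  have := e 0; have := e 1; have := e' 0; have := e' 1
  unfold greenIntegrand
  fun_prop

lemma integrableOn_greenIntegrand {ζ : ℂ} (hζ : 0 < ζ.im) (x₀ : ℝ) :
    IntegrableOn (greenIntegrand u z ζ) (Set.Iic x₀) := by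
  refine Integrable.mono' (((integrableOn_sq_norm_leftSol hu hz x₀).add
    (integrableOn_sq_norm_leftSol hu hζ x₀)).const_mul (1 + ‖1 / (z * ζ)‖))
    (continuous_greenIntegrand hu hz hζ).aestronglyMeasurable (Eventually.of_forall fun x => ?_)
  refine (norm_greenIntegrand_le u z ζ x le_rfl le_rfl le_rfl).trans ?_
  rw [mul_assoc]
  refine mul_le_mul_of_nonneg_left ?_ (by positivity)
  simp only [Pi.add_apply]
  nlinarith [sq_nonneg (‖leftSol u z x‖ - ‖leftSol u ζ x‖), sq_nonneg ‖leftSol u z x‖,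
    sq_nonneg ‖leftSol u ζ x‖]

/-- The Green identity. -/
lemma wronskian_leftSol_leftSol {ζ : ℂ} (hζ : 0 < ζ.im) (x₀ : ℝ) :
    wronskian (leftSol u z) (leftSol u ζ) x₀ = (ζ - z) * greenKernel u x₀ z ζ := by
  have hz0 := ne_zero_of_im_pos hz
  have hζ0 := ne_zero_of_im_pos hζ
  have h1 := isNormalizedLeft_leftSol hu hz
  have h2 := isNormalizedLeft_leftSol hu hζ
  have ea : diagCoeff ζ - diagCoeff z = (ζ - z) * (1 / 4 * (1 + 1 / (z * ζ))) := by
    simp only [diagCoeff]; field_simp; ring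
  have eb : offCoeff ζ - offCoeff z = (ζ - z) * (1 / 4 * (1 - 1 / (z * ζ))) := by
    simp only [offCoeff]; field_simp; ring
  have h := integral_Iic_of_hasDerivAt_of_tendsto' (a := x₀)
    (f := wronskian (leftSol u z) (leftSol u ζ))
    (f' := fun x => (ζ - z) * greenIntegrand u z ζ x) (m := 0) (fun x _ => by
      refine (hasDerivAt_wronskian h1.1 h2.1 x).congr_deriv ?_
      rw [ea, eb, greenIntegrand]; ring)
    ((integrableOn_greenIntegrand hu hz hζ x₀).const_mul _)
    (tendsto_wronskian_zero (h1.tendsto_zero hz) (h2.tendsto_zero hζ))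
  rw [integral_const_mul, sub_zero] at h
  rw [← h, greenKernel]

/-- Continuity of the divided difference on the diagonal suffices to differentiate Wronskians in the
spectral parameter; analyticity is never needed. Domination comes from the exponential decay of
`leftSol`, uniform near z. -/
lemma continuousAt_greenKernel (x₀ : ℝ) : ContinuousAt (greenKernel u x₀ z) z := by
  obtain ⟨C, κ, hκ, hev⟩ := eventually_norm_leftSol_le hu hz x₀
  have hz0 := ne_zero_of_im_pos hz
  have hinv : ContinuousAt (fun ζ => 1 / (z * ζ)) z := by
    fun_prop (disch := exact mul_ne_zero hz0 hz0)
  have e1 : ∀ᶠ ζ in 𝓝 z, ‖1 / (z * ζ)‖ ≤ ‖1 / (z * z)‖ + 1 :=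
    (hinv.norm.eventually (gt_mem_nhds (lt_add_one _))).mono fun _ h => le_of_lt h
  have e2 : ∀ᶠ ζ in 𝓝 z, 0 < ζ.im :=
    Complex.continuous_im.continuousAt.eventually (lt_mem_nhds hz)
  unfold greenKernel
  refine continuousAt_of_dominated (bound := fun x => (1 + (‖1 / (z * z)‖ + 1)) *
    (C * Real.exp (κ * x)) * (C * Real.exp (κ * x))) ?_ ?_ ?_ ?_
  · filter_upwards [e2] with ζ hζ
    exact (continuous_greenIntegrand hu hz hζ).aestronglyMeasurable
  · filter_upwards [e1, hev] with ζ h1 h2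
    filter_upwards [ae_restrict_mem measurableSet_Iic] with x hx
    exact norm_greenIntegrand_le u z ζ x h1 (hev.self_of_nhds x hx) (h2 x hx)
  · refine ((integrableOn_exp_mul_Iic (by positivity : 0 < 2 * κ) x₀).const_mul
      ((1 + (‖1 / (z * z)‖ + 1)) * C * C)).congr (Eventually.of_forall fun x => ?_)
    have : Real.exp (2 * κ * x) = Real.exp (κ * x) * Real.exp (κ * x) := by
      rw [← Real.exp_add]; ring_nf
    simp only [this]
    ring
  · refine Eventually.of_forall fun x => ?_
    have h := continuousAt_leftSol hu hz x
    have h0 : ContinuousAt (fun ζ => leftSol u ζ x 0) z := (continuous_apply 0).continuousAt.comp h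
    have h1 : ContinuousAt (fun ζ => leftSol u ζ x 1) z := (continuous_apply 1).continuousAt.comp h
    unfold greenIntegrand
    exact continuousAt_const.mul ((((continuousAt_const.add hinv).mul continuousAt_const).mul
      ((continuousAt_const.mul h1).add (continuousAt_const.mul h0))).add
      (((continuousAt_const.sub hinv).mul continuousAt_const).mul
      ((continuousAt_const.mul h0).sub (continuousAt_const.mul h1))))

end Kink

/-! ### Conjugation symmetries -/

section Symmetry

/-- The sign ε = 1 corresponds to z ↦ -z̄, the sign ε = -1 to z ↦ 1/z̄. The latter fixes the unit
circle pointwise and yields the reality of the components there. -/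
lemma IsNormalizedLeft.conj {u : ℝ → ℝ} {z z' : ℂ} {J : ℝ → Fin 2 → ℂ}
    (h : IsNormalizedLeft u z J) {ε : ℂ} (hε : ε = 1 ∨ ε = -1)
    (ha : diagCoeff z' = -starRingEnd ℂ (diagCoeff z))
    (hb : offCoeff z' = -(ε * starRingEnd ℂ (offCoeff z))) :
    IsNormalizedLeft u z' (fun x => ![starRingEnd ℂ (J x 0), ε * starRingEnd ℂ (J x 1)]) := by
  have hε2 : ε * ε = 1 := by rcases hε with rfl | rfl <;> ring
  constructor
  · rw [isSolution_iff]
    intro x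
    obtain ⟨h0, h1⟩ := isSolution_iff.1 h.1 x
    rw [ha, hb]
    constructor
    · refine h0.star.congr_deriv ?_
      simp only [Complex.star_def, map_add, map_mul, map_neg, Complex.conj_I, Complex.conj_ofReal,
        Matrix.cons_val_zero, Matrix.cons_val_one]
      linear_combination (Complex.I * starRingEnd ℂ (offCoeff z) * (Real.sin (u x / 2) : ℂ)
        * starRingEnd ℂ (J x 1)) * hε2
    · refine (h1.star.const_mul ε).congr_deriv ?_
      simp only [Complex.star_def, map_add, map_mul, Complex.conj_I, Complex.conj_ofReal,
        Matrix.cons_val_zero, Matrix.cons_val_one]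
      ring
  · have h1 : ∀ x : ℝ, Complex.exp (Complex.I * diagCoeff z' * (x : ℂ))
        = starRingEnd ℂ (Complex.exp (Complex.I * diagCoeff z * (x : ℂ))) := fun x => by
      rw [← Complex.exp_conj, ha]
      simp
    have h2 := tendsto_pi_nhds.1 h.2
    rw [tendsto_pi_nhds, Fin.forall_fin_two]
    constructor
    · have h3 := (Complex.continuous_conj.tendsto _).comp (h2 0)
      simp only [Matrix.cons_val_zero, map_one] at h3 ⊢
      refine h3.congr fun x => ?_
      simp [h1]
    · have h3 := ((Complex.continuous_conj.tendsto _).comp (h2 1)).const_mul ε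
      simp only [Matrix.cons_val_one, Matrix.cons_val_zero, map_zero, mul_zero] at h3 ⊢
      refine h3.congr fun x => ?_
      simp [h1]; ring

variable {u : ℝ → ℝ} (hu : IsMonotoneKink u) {z : ℂ} (hz : 0 < z.im)
include hu hz

lemma leftSol_neg_conj (x : ℝ) : leftSol u (-starRingEnd ℂ z) x
    = ![starRingEnd ℂ (leftSol u z x 0), starRingEnd ℂ (leftSol u z x 1)] := by
  have hz' : 0 < (-starRingEnd ℂ z).im := by simpa using hz
  have h := (isNormalizedLeft_leftSol hu hz).conj (z' := -starRingEnd ℂ z) (Or.inl rfl)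
    (by simp [diagCoeff, Complex.conj_ofNat]; ring) (by simp [offCoeff, Complex.conj_ofNat]; ring)
  have := congrFun ((isNormalizedLeft_leftSol hu hz').unique h hz') x
  simpa using this

omit hu hz in
lemma inv_eq_conj_of_norm_eq_one (h1 : ‖z‖ = 1) : z⁻¹ = starRingEnd ℂ z := by
  rw [Complex.inv_def, Complex.normSq_eq_norm_sq, h1]; simp

omit hu hz in
lemma diagCoeff_of_norm_eq_one (h1 : ‖z‖ = 1) :
    diagCoeff z = Complex.I * ((z.im / 2 : ℝ) : ℂ) := by
  rw [diagCoeff, one_div, one_div, inv_eq_conj_of_norm_eq_one h1, Complex.sub_conj]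
  push_cast; ring

omit hu hz in
lemma offCoeff_of_norm_eq_one (h1 : ‖z‖ = 1) : offCoeff z = ((z.re / 2 : ℝ) : ℂ) := by
  rw [offCoeff, one_div, one_div, inv_eq_conj_of_norm_eq_one h1, Complex.add_conj]
  push_cast; ring

/-- On the unit circle the first component is real and the second one imaginary. -/
lemma leftSol_conj_of_norm_eq_one (h1 : ‖z‖ = 1) (x : ℝ) :
    starRingEnd ℂ (leftSol u z x 0) = leftSol u z x 0 ∧
    starRingEnd ℂ (leftSol u z x 1) = -leftSol u z x 1 := by
  have h := (isNormalizedLeft_leftSol hu hz).conj (z' := z) (Or.inr rfl)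
    (by rw [diagCoeff_of_norm_eq_one h1, map_mul, Complex.conj_I, Complex.conj_ofReal]; ring)
    (by rw [offCoeff_of_norm_eq_one h1, Complex.conj_ofReal]; ring)
  have h2 := congrFun ((isNormalizedLeft_leftSol hu hz).unique h hz) x
  have e0 := congrFun h2 0
  have e1 := congrFun h2 1
  simp only [Matrix.cons_val_zero, Matrix.cons_val_one] at e0 e1
  refine ⟨e0.symm, ?_⟩
  linear_combination e1

end Symmetry

/-! ### Sign of the Green kernel on the unit circle -/

section Circle
variable {u : ℝ → ℝ} (hu : IsMonotoneKink u) {z : ℂ} (hz : 0 < z.im) (h1 : ‖z‖ = 1)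
include hu hz h1

/-- With Φ₀ real and Φ₁ imaginary, Φ₀² - Φ₁² = |Φ₀|² + |Φ₁|², and the product Φ₀Φ₁ becomes the
interaction. The bilinear Green integrand thus turns into a real density with a nonnegative
integral. -/
lemma greenIntegrand_of_norm_eq_one (x : ℝ) : greenIntegrand u z z x
    = -(z⁻¹ / 2) * ((4 * (Real.cos (u x / 2) * interaction z (leftSol u z) x)
      + z.im * (Real.sin (u x / 2) * (‖leftSol u z x 0‖ ^ 2 + ‖leftSol u z x 1‖ ^ 2)) : ℝ) : ℂ) := by
  have hz0 := ne_zero_of_im_pos hz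
  obtain ⟨e0, e1⟩ := leftSol_conj_of_norm_eq_one hu hz h1 x
  have hre : ((z.re : ℝ) : ℂ) = (z + z⁻¹) / 2 := by
    rw [inv_eq_conj_of_norm_eq_one h1, Complex.add_conj]; push_cast; ring
  have him : ((z.im : ℝ) : ℂ) = -Complex.I * (z - z⁻¹) / 2 := by
    rw [inv_eq_conj_of_norm_eq_one h1, Complex.sub_conj]
    push_cast
    linear_combination (z.im : ℂ) * Complex.I_sq
  have hint : ((interaction z (leftSol u z) x : ℝ) : ℂ)
      = -Complex.I * ((z + z⁻¹) / 4 * (leftSol u z x 0 * leftSol u z x 1)) := by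
    rw [interaction, offCoeff_of_norm_eq_one h1, Complex.conj_ofReal, e0]
    set p := leftSol u z x 0
    set q := leftSol u z x 1
    have h2 : starRingEnd ℂ (((z.re / 2 : ℝ) : ℂ) * (p * q)) = -(((z.re / 2 : ℝ) : ℂ) * (p * q)) := by
      rw [map_mul, map_mul, Complex.conj_ofReal, e0, e1]; ring
    have h3 := Complex.sub_conj (((z.re / 2 : ℝ) : ℂ) * (p * q))
    rw [h2] at h3
    have h4 : (((z.re / 2 : ℝ) : ℂ)) = (z + z⁻¹) / 4 := by push_cast; rw [hre]; ring
    rw [h4] at h3 ⊢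
    push_cast at h3
    linear_combination (Complex.I / 2) * h3 + ((((z + z⁻¹) / 4 * (p * q)).im : ℂ)) * Complex.I_sq
  have hp : ((‖leftSol u z x 0‖ ^ 2 : ℝ) : ℂ) = leftSol u z x 0 ^ 2 := by
    rw [Complex.sq_norm, Complex.normSq_eq_conj_mul_self, e0]; ring
  have hq : ((‖leftSol u z x 1‖ ^ 2 : ℝ) : ℂ) = -leftSol u z x 1 ^ 2 := by
    rw [Complex.sq_norm, Complex.normSq_eq_conj_mul_self, e1]; ring
  rw [Complex.ofReal_add, Complex.ofReal_mul, Complex.ofReal_mul, hint, Complex.ofReal_mul,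
    Complex.ofReal_mul, Complex.ofReal_add, hp, hq, him, greenIntegrand]
  push_cast
  field_simp
  ring

/-- The sign of the diagonal of the Green kernel on the unit circle. -/
lemma exists_greenKernel_eq {x₀ : ℝ} (h0 : u x₀ = Real.pi) : ∃ m : ℝ, 0 < m ∧
    greenKernel u x₀ z z = -(z⁻¹ / 2) * (m : ℂ) := by
  have hn := isNormalizedLeft_leftSol hu hz
  have hi := integrableOn_sq_norm_leftSol hu hz x₀
  set P : ℝ → ℝ := fun x => Real.sin (u x / 2) * (‖leftSol u z x 0‖ ^ 2 + ‖leftSol u z x 1‖ ^ 2)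
    with hP
  have hPc : Continuous P := hu.continuous_sin.mul
    ((((continuous_apply 0).comp hn.1.continuous).norm.pow 2).add
      (((continuous_apply 1).comp hn.1.continuous).norm.pow 2))
  have hP0 : ∀ x, 0 ≤ P x := fun x => mul_nonneg (hu.sin_nonneg x) (by positivity)
  have hPi : IntegrableOn P (Set.Iic x₀) := by
    refine Integrable.mono' (hi.const_mul 2) hPc.aestronglyMeasurable
      (Eventually.of_forall fun x => ?_)
    rw [Real.norm_of_nonneg (hP0 x)]
    have e0 : ‖leftSol u z x 0‖ ^ 2 ≤ ‖leftSol u z x‖ ^ 2 := by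
      gcongr; exact norm_le_pi_norm _ _
    have e1 : ‖leftSol u z x 1‖ ^ 2 ≤ ‖leftSol u z x‖ ^ 2 := by
      gcongr; exact norm_le_pi_norm _ _
    calc P x ≤ 1 * (‖leftSol u z x‖ ^ 2 + ‖leftSol u z x‖ ^ 2) :=
          mul_le_mul (Real.sin_le_one _) (add_le_add e0 e1) (by positivity) zero_le_one
      _ = _ := by ring
  have hci := integrableOn_cos_mul_interaction (x₀ := x₀) hu hn.1 hi
  -- Strictness comes from x₀ itself: there the sine equals 1 and the solution does not vanish.
  have hpos : 0 < ∫ x in Set.Iic x₀, P x := by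
    have h2 : 0 < ∫ x in (x₀ - 1)..x₀, P x := by
      refine intervalIntegral.integral_pos (by linarith) hPc.continuousOn (fun x _ => hP0 x)
        ⟨x₀, Set.right_mem_Icc.2 (by linarith), ?_⟩
      simp only [hP, h0, Real.sin_pi_div_two, one_mul]
      by_contra hle
      apply hn.ne_zero x₀
      have e0 : ‖leftSol u z x₀ 0‖ ^ 2 = 0 := by nlinarith [sq_nonneg ‖leftSol u z x₀ 0‖, sq_nonneg ‖leftSol u z x₀ 1‖]
      have e1 : ‖leftSol u z x₀ 1‖ ^ 2 = 0 := by nlinarith [sq_nonneg ‖leftSol u z x₀ 0‖, sq_nonneg ‖leftSol u z x₀ 1‖]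
      ext i
      fin_cases i
      · simpa using e0
      · simpa using e1
    rw [intervalIntegral.integral_of_le (by linarith)] at h2
    exact h2.trans_le (setIntegral_mono_set hPi (Eventually.of_forall hP0)
      Set.Ioc_subset_Iic_self.eventuallyLE)
  refine ⟨4 * (∫ x in Set.Iic x₀, Real.cos (u x / 2) * interaction z (leftSol u z) x)
    + z.im * ∫ x in Set.Iic x₀, P x, ?_, ?_⟩
  · have := integral_cos_mul_interaction_nonneg hu h0 hz hn.1 hi
    have := mul_pos hz hpos
    linarith
  · rw [greenKernel]
    simp only [greenIntegrand_of_norm_eq_one hu hz h1]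
    rw [integral_const_mul, integral_complex_ofReal, integral_add (hci.const_mul 4)
      (hPi.const_mul z.im), integral_const_mul, integral_const_mul]

end Circle

/-! ### Simplicity of the zeros on the circle -/

lemma hasDerivAt_of_eventuallyEq_sub_mul {F h : ℂ → ℂ} {z : ℂ}
    (hF : ∀ᶠ ζ in 𝓝 z, F ζ = (ζ - z) * h ζ) (hh : ContinuousAt h z) : HasDerivAt F (h z) z := by
  rw [hasDerivAt_iff_tendsto_slope]
  have hz : F z = 0 := by simpa using hF.self_of_nhds
  refine (hh.tendsto.mono_left nhdsWithin_le_nhds).congr' ?_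
  filter_upwards [hF.filter_mono nhdsWithin_le_nhds, self_mem_nhdsWithin] with ζ h1 h2
  have h3 : ζ - z ≠ 0 := sub_ne_zero.2 h2
  rw [slope_def_field, hz, h1]
  field_simp
  ring

section Simple
variable {u : ℝ → ℝ} (hu : IsMonotoneKink u) {z : ℂ} (hz : 0 < z.im)
include hu hz

lemma wronskian_rightSol_rightSol {ζ : ℂ} (hζ : 0 < ζ.im) (x₀ : ℝ) :
    wronskian (rightSol u z) (rightSol u ζ) x₀
      = -((ζ - z) * greenKernel (reflect u) (-x₀) z ζ) := by
  rw [← wronskian_leftSol_leftSol hu.reflect hz hζ]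
  simp [wronskian, rightSol, reflectSol]; ring

lemma continuousAt_rightSol (x : ℝ) : ContinuousAt (fun ζ => rightSol u ζ x) z := by
  have h := continuousAt_pi.1 (continuousAt_leftSol hu.reflect hz (-x))
  rw [continuousAt_pi, Fin.forall_fin_two]
  exact ⟨h 0, (h 1).neg⟩

lemma leftSol_ne_zero_or (x : ℝ) : leftSol u z x 0 ≠ 0 ∨ leftSol u z x 1 ≠ 0 := by
  by_contra hcon
  push Not at hcon
  refine (isNormalizedLeft_leftSol hu hz).ne_zero x ?_
  ext i; fin_cases i
  · exact hcon.1
  · exact hcon.2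

/-- Near a zero on the unit circle, the Wronskian of the normalized solutions is the product of
`ζ - z` and a continuous nonvanishing function. -/
lemma exists_normalizedWronskian_eq (h1 : ‖z‖ = 1) (hw : normalizedWronskian u z = 0) :
    ∃ h : ℂ → ℂ, ContinuousAt h z ∧ h z ≠ 0 ∧
      ∀ ζ : ℂ, 0 < ζ.im → normalizedWronskian u ζ = (ζ - z) * h ζ := by
  obtain ⟨x₀, h0⟩ := hu.exists_eq_pi
  obtain ⟨k, hk0, hk⟩ := exists_leftSol_eq_smul_rightSol hu hz hw
  obtain ⟨m, hm, hKm⟩ := exists_greenKernel_eq hu hz h1 h0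
  obtain ⟨m', hm', hKm'⟩ := exists_greenKernel_eq hu.reflect hz h1 (reflect_neg_eq_pi h0)
  set e := leftSol u z x₀ with he
  have hek : e = k • rightSol u z x₀ := hk x₀
  -- The vector f completes e to a basis with det(e, f) = |e|². The factorization is then the
  -- identity det(e,f) det(L,R) = det(e,L) det(f,R) - det(e,R) det(f,L), in which det(e,L) and
  -- det(e,R) carry the factor ζ - z by Green's identity.
  set f : Fin 2 → ℂ := ![-starRingEnd ℂ (e 1), starRingEnd ℂ (e 0)] with hf
  set n : ℝ := Complex.normSq (e 0) + Complex.normSq (e 1) with hn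
  have hnpos : 0 < n := by
    rcases leftSol_ne_zero_or hu hz x₀ with h2 | h2
    · exact add_pos_of_pos_of_nonneg (Complex.normSq_pos.2 h2) (Complex.normSq_nonneg _)
    · exact add_pos_of_nonneg_of_pos (Complex.normSq_nonneg _) (Complex.normSq_pos.2 h2)
  have hnC : (n : ℂ) ≠ 0 := by exact_mod_cast hnpos.ne'
  have hnef : e 0 * f 1 - e 1 * f 0 = n := by
    simp only [hf, hn, Matrix.cons_val_zero, Matrix.cons_val_one, Complex.ofReal_add,
      ← Complex.mul_conj]
    ring
  -- Reality of k makes k² positive, so that the contributions m and k² m' of the two ends cannot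
  -- cancel.
  have hkre : starRingEnd ℂ k = k := by
    obtain ⟨a0, a1⟩ := leftSol_conj_of_norm_eq_one hu hz h1 x₀
    obtain ⟨b0, b1⟩ := leftSol_conj_of_norm_eq_one hu.reflect hz h1 (-x₀)
    have e0 : e 0 = k * leftSol (reflect u) z (-x₀) 0 := by rw [hek]; simp [rightSol, reflectSol]
    have e1 : e 1 = -(k * leftSol (reflect u) z (-x₀) 1) := by
      rw [hek]; simp [rightSol, reflectSol]
    rcases leftSol_ne_zero_or hu.reflect hz (-x₀) with h2 | h2
    · rw [← he, e0, map_mul, b0] at a0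
      exact mul_right_cancel₀ h2 a0
    · rw [← he, e1, map_neg, map_mul, b1] at a1
      refine mul_right_cancel₀ h2 ?_
      linear_combination a1
  set k' := k.re with hk'
  have hkk : k = (k' : ℂ) := (Complex.conj_eq_iff_re.1 hkre).symm
  have hk'0 : k' ≠ 0 := by
    intro h2; apply hk0; rw [hkk, h2]; simp
  let K := greenKernel u x₀ z
  let K' := greenKernel (reflect u) (-x₀) z
  refine ⟨fun ζ => (K ζ * (f 0 * rightSol u ζ x₀ 1 - f 1 * rightSol u ζ x₀ 0)
    + k * K' ζ * (f 0 * leftSol u ζ x₀ 1 - f 1 * leftSol u ζ x₀ 0)) / n, ?_, ?_, ?_⟩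
  · have c1 := continuousAt_greenKernel hu hz x₀
    have c2 := continuousAt_greenKernel hu.reflect hz (-x₀)
    have c3 := continuousAt_pi.1 (continuousAt_rightSol hu hz x₀)
    have c4 := continuousAt_pi.1 (continuousAt_leftSol hu hz x₀)
    exact ((c1.mul ((continuousAt_const.mul (c3 1)).sub (continuousAt_const.mul (c3 0)))).add
      ((continuousAt_const.mul c2).mul
        ((continuousAt_const.mul (c4 1)).sub (continuousAt_const.mul (c4 0))))).div_const _
  · have hR : ∀ i, rightSol u z x₀ i = k⁻¹ * e i := fun i => by
      rw [hek]; simp [hk0]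
    have hz0 := ne_zero_of_im_pos hz
    have hval : (K z * (f 0 * rightSol u z x₀ 1 - f 1 * rightSol u z x₀ 0)
        + k * K' z * (f 0 * leftSol u z x₀ 1 - f 1 * leftSol u z x₀ 0)) / n
        = z⁻¹ / (2 * k) * ((m + k' ^ 2 * m' : ℝ) : ℂ) := by
      rw [hR, hR, ← he]
      have e1 : f 0 * (k⁻¹ * e 1) - f 1 * (k⁻¹ * e 0) = -(k⁻¹ * n) := by rw [← hnef]; ring
      have e2 : f 0 * e 1 - f 1 * e 0 = -n := by rw [← hnef]; ring
      rw [e1, e2]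
      simp only [K, K', hKm, hKm']
      push_cast
      rw [← hkk]
      field_simp
    simp only [hval]
    refine mul_ne_zero (div_ne_zero (inv_ne_zero hz0) (mul_ne_zero two_ne_zero hk0)) ?_
    have : 0 < m + k' ^ 2 * m' := by positivity
    exact_mod_cast this.ne'
  · intro ζ hζ
    have w1 := wronskian_leftSol_leftSol hu hz hζ x₀
    have w2 := wronskian_rightSol_rightSol hu hz hζ x₀
    have w3 := wronskian_leftSol_rightSol hu hζ x₀
    simp only [wronskian] at w1 w2 w3
    have hk0' : e 0 = k * rightSol u z x₀ 0 := by rw [hek]; rfl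
    have hk1' : e 1 = k * rightSol u z x₀ 1 := by rw [hek]; rfl
    have w2' : e 0 * rightSol u ζ x₀ 1 - e 1 * rightSol u ζ x₀ 0 = -(k * ((ζ - z) * K' ζ)) := by
      rw [hk0', hk1']
      linear_combination k * w2
    rw [← he] at w1
    rw [← w3, mul_div_assoc', eq_div_iff hnC, ← hnef]
    linear_combination (f 0 * rightSol u ζ x₀ 1 - f 1 * rightSol u ζ x₀ 0) * w1
      - (f 0 * leftSol u ζ x₀ 1 - f 1 * leftSol u ζ x₀ 0) * w2'

omit hu in
lemma continuousAt_jostConst : ContinuousAt (jostConst u) z := by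
  have := continuousAt_diagCoeff (ne_zero_of_im_pos hz)
  unfold jostConst
  exact Complex.continuous_exp.continuousAt.comp
    ((continuousAt_const.mul this).mul continuousAt_const).neg

lemma isSimple_of_norm_eq_one (h1 : ‖z‖ = 1) (hw : normalizedWronskian u z = 0) :
    IsSimple u z := by
  obtain ⟨h, hc, hne, hh⟩ := exists_normalizedWronskian_eq hu hz h1 hw
  refine ⟨finrank_eigenspace hu hz hw,
    fun ζ => jostConst u ζ * jostConst (reflect u) ζ * normalizedWronskian u ζ,
    fun ζ hζ => isJostWronskian hu hζ, by simp [hw], ?_⟩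
  have hev : ∀ᶠ ζ in 𝓝 z, jostConst u ζ * jostConst (reflect u) ζ * normalizedWronskian u ζ
      = (ζ - z) * (jostConst u ζ * jostConst (reflect u) ζ * h ζ) := by
    filter_upwards [Complex.continuous_im.continuousAt.eventually (lt_mem_nhds hz)] with ζ hζ
    rw [hh ζ hζ]; ring
  rw [(hasDerivAt_of_eventuallyEq_sub_mul hev
    (((continuousAt_jostConst hz).mul (continuousAt_jostConst hz)).mul hc)).deriv]
  exact mul_ne_zero (mul_ne_zero (Complex.exp_ne_zero _) (Complex.exp_ne_zero _)) hne

end Simple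

/-! ### The argument of the solution along the circle -/

lemma eq_mul_exp_integral {F ρ : ℝ → ℂ} (hF : ∀ x, HasDerivAt F (ρ x * F x) x)
    (hρ : Continuous ρ) (T X : ℝ) : F X = F T * Complex.exp (∫ x in T..X, ρ x) := by
  have hd : ∀ x, HasDerivAt (fun x => F x * Complex.exp (-∫ y in T..x, ρ y)) 0 x := fun x => by
    have h1 := (intervalIntegral.integral_hasDerivAt_right (hρ.intervalIntegrable T x)
      hρ.aestronglyMeasurable.stronglyMeasurableAtFilter hρ.continuousAt).neg.cexp
    refine ((hF x).mul h1).congr_deriv ?_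
    ring
  have h2 := is_const_of_deriv_eq_zero (fun x => (hd x).differentiableAt)
    (fun x => (hd x).deriv) X T
  simp only [intervalIntegral.integral_same, neg_zero, Complex.exp_zero, mul_one] at h2
  rw [← h2, mul_assoc, ← Complex.exp_add]
  simp

/-- A continuous function that decreases strictly through each point is strictly antitone. -/
lemma strictAntiOn_of_eventually_lt {f : ℝ → ℝ} {l r : ℝ} (hf : ContinuousOn f (Set.Ioo l r))
    (h : ∀ x ∈ Set.Ioo l r, ∀ᶠ y in 𝓝[<] x, f x < f y) : StrictAntiOn f (Set.Ioo l r) := by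
  intro a ha b hb hab
  have hsub : Set.Icc a b ⊆ Set.Ioo l r := fun x hx => ⟨ha.1.trans_le hx.1, hx.2.trans_lt hb.2⟩
  have key : ∀ m ∈ Set.Ioc a b, ∃ y ∈ Set.Icc a b, f m < f y := fun m hm => by
    have h1 := h m (hsub ⟨hm.1.le, hm.2⟩)
    have h2 : ∀ᶠ y in 𝓝[<] m, y ∈ Set.Ioo a m := Ioo_mem_nhdsLT hm.1
    obtain ⟨y, hy, hy'⟩ := (h1.and h2).exists
    exact ⟨y, ⟨hy'.1.le, (hy'.2.trans_le hm.2).le⟩, hy⟩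
  -- The maximum over [a, b] cannot be attained right of a, since larger values occur just to the
  -- left; hence it sits at a, and the value at b is strictly smaller.
  obtain ⟨m, hm, hmax⟩ := isCompact_Icc.exists_isMaxOn (Set.nonempty_Icc.2 hab.le) (hf.mono hsub)
  have hma : m = a := by
    by_contra hne
    obtain ⟨y, hy, hlt⟩ := key m ⟨lt_of_le_of_ne hm.1 (Ne.symm hne), hm.2⟩
    exact absurd (hmax hy) (not_le.2 hlt)
  obtain ⟨y, hy, hlt⟩ := key b ⟨hab, le_rfl⟩
  have := hmax hy
  rw [hma] at this
  exact hlt.trans_le this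

/-- The point of the unit circle with argument `θ`. -/
def circlePoint (θ : ℝ) : ℂ := Complex.exp (θ * Complex.I)

lemma circlePoint_re (θ : ℝ) : (circlePoint θ).re = Real.cos θ := Complex.exp_ofReal_mul_I_re θ

lemma circlePoint_im (θ : ℝ) : (circlePoint θ).im = Real.sin θ := Complex.exp_ofReal_mul_I_im θ

lemma norm_circlePoint (θ : ℝ) : ‖circlePoint θ‖ = 1 := Complex.norm_exp_ofReal_mul_I θ

lemma circlePoint_im_pos {θ : ℝ} (hθ : θ ∈ Set.Ioo 0 Real.pi) : 0 < (circlePoint θ).im := by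
  rw [circlePoint_im]; exact Real.sin_pos_of_mem_Ioo hθ

lemma hasDerivAt_circlePoint (θ : ℝ) :
    HasDerivAt circlePoint (circlePoint θ * Complex.I) θ := by
  have h1 : HasDerivAt (fun θ : ℝ => (θ : ℂ) * Complex.I) Complex.I θ := by
    simpa using (Complex.ofRealCLM.hasDerivAt (x := θ)).mul_const Complex.I
  exact h1.cexp

lemma circlePoint_pi_sub (θ : ℝ) :
    circlePoint (Real.pi - θ) = -starRingEnd ℂ (circlePoint θ) := by
  apply Complex.ext
  · rw [Complex.neg_re, Complex.conj_re, circlePoint_re, circlePoint_re, Real.cos_pi_sub]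
  · rw [Complex.neg_im, Complex.conj_im, circlePoint_im, circlePoint_im, Real.sin_pi_sub, neg_neg]

/-- The normalized solution on the unit circle as a single complex number: its first component is
real and its second one imaginary. -/
def phasor (u : ℝ → ℝ) (θ x : ℝ) : ℂ :=
  leftSol u (circlePoint θ) x 0 + leftSol u (circlePoint θ) x 1

/-- The logarithmic derivative of the phasor. -/
def phasorRate (u : ℝ → ℝ) (θ x : ℝ) : ℂ :=
  ((Real.sin θ / 2 * Real.cos (u x / 2) : ℝ) : ℂ) * (starRingEnd ℂ (phasor u θ x) / phasor u θ x)
    + ((Real.cos θ / 2 * Real.sin (u x / 2) : ℝ) : ℂ) * Complex.I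

section Kink
variable {u : ℝ → ℝ} (hu : IsMonotoneKink u) {θ : ℝ} (hθ : θ ∈ Set.Ioo 0 Real.pi)
include hu hθ

lemma conj_phasor (x : ℝ) : starRingEnd ℂ (phasor u θ x)
    = leftSol u (circlePoint θ) x 0 - leftSol u (circlePoint θ) x 1 := by
  obtain ⟨h0, h1⟩ := leftSol_conj_of_norm_eq_one hu (circlePoint_im_pos hθ) (norm_circlePoint θ) x
  rw [phasor, map_add, h0, h1, sub_eq_add_neg]

lemma phasor_ne_zero (x : ℝ) : phasor u θ x ≠ 0 := by
  intro h
  have h1 := conj_phasor hu hθ x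
  rw [h, map_zero] at h1
  rw [phasor] at h
  have h2 : leftSol u (circlePoint θ) x 0 = 0 := by linear_combination h / 2 - h1 / 2
  have h3 : leftSol u (circlePoint θ) x 1 = 0 := by linear_combination h / 2 + h1 / 2
  rcases leftSol_ne_zero_or hu (circlePoint_im_pos hθ) x with h4 | h4
  · exact h4 h2
  · exact h4 h3

lemma hasDerivAt_phasor (x : ℝ) :
    HasDerivAt (phasor u θ) (phasorRate u θ x * phasor u θ x) x := by
  have hn := isNormalizedLeft_leftSol hu (circlePoint_im_pos hθ)
  obtain ⟨h0, h1⟩ := isSolution_iff.1 hn.1 x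
  refine (h0.add h1).congr_deriv ?_
  have hne := phasor_ne_zero hu hθ x
  have hmul : phasorRate u θ x * phasor u θ x
      = ((Real.sin θ / 2 * Real.cos (u x / 2) : ℝ) : ℂ) * starRingEnd ℂ (phasor u θ x)
        + ((Real.cos θ / 2 * Real.sin (u x / 2) : ℝ) : ℂ) * Complex.I * phasor u θ x := by
    rw [phasorRate, add_mul, mul_assoc _ (_ / _), div_mul_cancel₀ _ hne]
  rw [hmul, conj_phasor hu hθ, phasor,
    diagCoeff_of_norm_eq_one (norm_circlePoint θ), offCoeff_of_norm_eq_one (norm_circlePoint θ),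
    circlePoint_im, circlePoint_re]
  push_cast
  linear_combination (-(Complex.sin θ / 2 * Complex.cos (u x / 2)
    * (leftSol u (circlePoint θ) x 0 - leftSol u (circlePoint θ) x 1))) * Complex.I_sq

lemma continuous_phasor : Continuous (phasor u θ) :=
  continuous_iff_continuousAt.2 fun x => (hasDerivAt_phasor hu hθ x).continuousAt

lemma continuous_phasorRate : Continuous (phasorRate u θ) := by
  have h1 := continuous_phasor hu hθ
  have h2 := Complex.continuous_conj.comp h1
  exact ((Complex.continuous_ofReal.comp (continuous_const.mul hu.continuous_cos)).mul
    (h2.div h1 (phasor_ne_zero hu hθ))).add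
    ((Complex.continuous_ofReal.comp (continuous_const.mul hu.continuous_sin)).mul continuous_const)

omit hu hθ in
lemma norm_phasor_ratio_le (x : ℝ) : ‖starRingEnd ℂ (phasor u θ x) / phasor u θ x‖ ≤ 1 := by
  rw [norm_div, Complex.norm_conj]; exact div_self_le_one _

-- As θ → 0 the rotation speed tends uniformly to sin(u/2)/2, which produces the limit of the angle.
omit hu hθ in
lemma abs_im_phasorRate_sub_le (x : ℝ) :
    |(phasorRate u θ x).im - Real.cos θ / 2 * Real.sin (u x / 2)| ≤ |Real.sin θ| / 2 := by
  have h1 : (phasorRate u θ x).im - Real.cos θ / 2 * Real.sin (u x / 2)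
      = Real.sin θ / 2 * Real.cos (u x / 2)
        * (starRingEnd ℂ (phasor u θ x) / phasor u θ x).im := by
    rw [phasorRate, Complex.add_im, Complex.im_ofReal_mul, Complex.im_ofReal_mul, Complex.I_im]
    ring
  rw [h1, abs_mul, abs_mul, abs_div, abs_two]
  calc _ ≤ |Real.sin θ| / 2 * 1 * 1 := by
        gcongr
        · exact Real.abs_cos_le_one _
        · exact (Complex.abs_im_le_norm _).trans (norm_phasor_ratio_le x)
    _ = _ := by ring

omit hu hθ in
lemma abs_im_phasorRate_le (x : ℝ) : |(phasorRate u θ x).im| ≤ 1 := by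
  have h1 := abs_im_phasorRate_sub_le (u := u) (θ := θ) x
  have h2 : |Real.cos θ / 2 * Real.sin (u x / 2)| ≤ 1 / 2 := by
    rw [abs_mul, abs_div, abs_two]
    calc _ ≤ 1 / 2 * 1 := mul_le_mul (by linarith [Real.abs_cos_le_one θ])
          (Real.abs_sin_le_one _) (abs_nonneg _) (by norm_num)
      _ = 1 / 2 := mul_one _
  have h3 := Real.abs_sin_le_one θ
  have h4 := abs_add_le ((phasorRate u θ x).im - Real.cos θ / 2 * Real.sin (u x / 2))
    (Real.cos θ / 2 * Real.sin (u x / 2))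
  rw [sub_add_cancel] at h4
  linarith

lemma phasor_pi_sub (x : ℝ) :
    phasor u (Real.pi - θ) x = starRingEnd ℂ (phasor u θ x) := by
  rw [phasor, circlePoint_pi_sub, leftSol_neg_conj hu (circlePoint_im_pos hθ), phasor, map_add]
  simp

lemma phasorRate_pi_sub (x : ℝ) :
    phasorRate u (Real.pi - θ) x = starRingEnd ℂ (phasorRate u θ x) := by
  simp only [phasorRate, phasor_pi_sub hu hθ, Real.sin_pi_sub, Real.cos_pi_sub, map_add, map_mul,
    map_div₀, Complex.conj_ofReal, Complex.conj_I, Complex.conj_conj]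
  push_cast
  ring

lemma continuousAt_phasor (x : ℝ) : ContinuousAt (fun θ => phasor u θ x) θ := by
  have h := continuousAt_pi.1 ((continuousAt_leftSol hu (circlePoint_im_pos hθ) x).comp
    (hasDerivAt_circlePoint θ).continuousAt)
  exact (h 0).add (h 1)

lemma continuousAt_phasorRate (x : ℝ) : ContinuousAt (fun θ => phasorRate u θ x) θ := by
  have h1 := continuousAt_phasor hu hθ x
  have h2 : ContinuousAt (fun θ => starRingEnd ℂ (phasor u θ x)) θ :=
    Complex.continuous_conj.continuousAt.comp h1
  have h3 : ContinuousAt (fun θ => ((Real.sin θ / 2 * Real.cos (u x / 2) : ℝ) : ℂ)) θ := by fun_prop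
  have h4 : ContinuousAt (fun θ => ((Real.cos θ / 2 * Real.sin (u x / 2) : ℝ) : ℂ)) θ := by fun_prop
  exact (h3.mul (h2.div h1 (phasor_ne_zero hu hθ x))).add (h4.mul continuousAt_const)

omit hθ in
/-- Near `-∞` the phasor is, up to a positive factor, close to `1`, uniformly in `θ`. -/
lemma exists_phasor_near_one {ε : ℝ} (hε : 0 < ε) : ∃ T : ℝ, ∀ x ≤ T, ∀ θ ∈ Set.Ioo 0 Real.pi,
    ∃ r : ℝ, 0 < r ∧ ‖(r : ℂ) * phasor u θ x - 1‖ < ε := by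
  have hlim : Tendsto (fun x => 2 * (Real.exp (2 * weight u 1 x) - 1)) atBot
      (𝓝 (2 * (Real.exp (2 * 0) - 1))) :=
    (((Real.continuous_exp.tendsto _).comp ((tendsto_weight (u := u)).const_mul 2)).sub_const
      1).const_mul 2
  simp only [mul_zero, Real.exp_zero, sub_self] at hlim
  obtain ⟨T, hT⟩ := (eventually_atBot.1 (hlim.eventually (gt_mem_nhds hε)))
  -- On the circle ia = -sin θ/2, so the normalizing factor exp(iax) is itself a positive real.
  refine ⟨T, fun x hx θ hθ => ⟨Real.exp (-(Real.sin θ / 2) * x), Real.exp_pos _, ?_⟩⟩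
  have him := circlePoint_im_pos hθ
  -- Both coefficients are bounded on the whole circle, so L = 1 serves every θ, even as Im a → 0.
  have ha : ‖diagCoeff (circlePoint θ)‖ ≤ 1 := by
    rw [diagCoeff_of_norm_eq_one (norm_circlePoint θ), norm_mul, Complex.norm_I, Complex.norm_real,
      circlePoint_im, one_mul, Real.norm_eq_abs, abs_div, abs_two]
    linarith [Real.abs_sin_le_one θ]
  have hb : ‖offCoeff (circlePoint θ)‖ ≤ 1 := by
    rw [offCoeff_of_norm_eq_one (norm_circlePoint θ), Complex.norm_real,
      circlePoint_re, Real.norm_eq_abs, abs_div, abs_two]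
    linarith [Real.abs_cos_le_one θ]
  have h1 := leftSol_sub_le hu one_pos him ha hb x
  have h2 : Complex.exp (Complex.I * diagCoeff (circlePoint θ) * (x : ℂ))
      = ((Real.exp (-(Real.sin θ / 2) * x) : ℝ) : ℂ) := by
    rw [diagCoeff_of_norm_eq_one (norm_circlePoint θ), circlePoint_im, ← mul_assoc,
      Complex.I_mul_I]
    push_cast; ring_nf
  rw [h2] at h1
  set r := Real.exp (-(Real.sin θ / 2) * x)
  set v := (r : ℂ) • leftSol u (circlePoint θ) x - ![1, 0] with hv
  have h3 : (r : ℂ) * phasor u θ x - 1 = v 0 + v 1 := by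
    have e0 : v 0 = r * leftSol u (circlePoint θ) x 0 - 1 := rfl
    have e1 : v 1 = r * leftSol u (circlePoint θ) x 1 - 0 := rfl
    rw [e0, e1, phasor]; ring
  rw [h3]
  calc ‖v 0 + v 1‖ ≤ ‖v‖ + ‖v‖ :=
        (norm_add_le _ _).trans (add_le_add (norm_le_pi_norm v 0) (norm_le_pi_norm v 1))
    _ ≤ 2 * (Real.exp (2 * weight u 1 x) - 1) := by linarith
    _ < ε := hT x hx

omit hθ in
lemma exists_abs_arg_phasor_lt {ε : ℝ} (hε : 0 < ε) : ∃ T : ℝ, ∀ x ≤ T,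
    ∀ θ ∈ Set.Ioo 0 Real.pi, 0 < (phasor u θ x).re ∧ |Complex.arg (phasor u θ x)| < ε := by
  have hc : ContinuousAt Complex.arg 1 := Complex.continuousAt_arg (by simp)
  have h1 : ∀ᶠ w in 𝓝 (1 : ℂ), |Complex.arg w| < ε := by
    have h2 := hc.abs
    rw [ContinuousAt, Complex.arg_one, abs_zero] at h2
    exact h2.eventually (gt_mem_nhds hε)
  have h2 : ∀ᶠ w in 𝓝 (1 : ℂ), 0 < w.re :=
    Complex.continuous_re.continuousAt.eventually (lt_mem_nhds (by simp))
  obtain ⟨δ, hδ, hball⟩ := Metric.eventually_nhds_iff.1 (h1.and h2)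
  obtain ⟨T, hT⟩ := exists_phasor_near_one hu hδ
  refine ⟨T, fun x hx θ hθ => ?_⟩
  obtain ⟨r, hr, hlt⟩ := hT x hx θ hθ
  obtain ⟨h3, h4⟩ := hball (y := (r : ℂ) * phasor u θ x) (by rwa [dist_eq_norm])
  rw [Complex.arg_real_mul _ hr] at h3
  rw [Complex.re_ofReal_mul] at h4
  exact ⟨pos_of_mul_pos_right h4 hr.le, h3⟩

end Kink

/-- A continuous determination of the argument of the phasor at `X`. -/
def angle (u : ℝ → ℝ) (T X θ : ℝ) : ℝ :=
  Complex.arg (phasor u θ T) + ∫ x in T..X, (phasorRate u θ x).im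

section Angle
variable {u : ℝ → ℝ} (hu : IsMonotoneKink u) {θ : ℝ} (hθ : θ ∈ Set.Ioo 0 Real.pi)
include hu hθ

lemma continuous_im_phasorRate : Continuous fun x => (phasorRate u θ x).im :=
  Complex.continuous_im.comp (continuous_phasorRate hu hθ)

lemma im_integral_phasorRate (T X : ℝ) :
    (∫ x in T..X, phasorRate u θ x).im = ∫ x in T..X, (phasorRate u θ x).im := by
  have := Complex.imCLM.intervalIntegral_comp_comm
    ((continuous_phasorRate hu hθ).intervalIntegrable (μ := volume) T X)
  simpa using this.symm

lemma phasor_eq_norm_mul_exp (T X : ℝ) :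
    phasor u θ X = ‖phasor u θ X‖ * Complex.exp (angle u T X θ * Complex.I) := by
  have h1 := eq_mul_exp_integral (hasDerivAt_phasor hu hθ) (continuous_phasorRate hu hθ) T X
  set ℓ := ∫ x in T..X, phasorRate u θ x with hℓ
  have h2 : ‖phasor u θ X‖ = ‖phasor u θ T‖ * Real.exp ℓ.re := by
    rw [h1, norm_mul, Complex.norm_exp]
  have h3 := Complex.norm_mul_exp_arg_mul_I (phasor u θ T)
  rw [h2, angle, ← im_integral_phasorRate hu hθ, ← hℓ]
  conv_lhs => rw [h1, ← h3]
  push_cast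
  rw [mul_assoc, mul_assoc, ← Complex.exp_add, ← Complex.exp_add]
  congr 2
  conv_lhs => rw [← Complex.re_add_im ℓ]
  ring

/-- Left of T the phasor stays in the right half plane, where the principal logarithm is a primitive
of its rate. The base point may thus be moved further left without changing the angle. -/
lemma angle_eq_angle {T T' X : ℝ} (hT : T' ≤ T) (hre : ∀ x ≤ T, 0 < (phasor u θ x).re) :
    angle u T' X θ = angle u T X θ := by
  have hc := continuous_im_phasorRate hu hθ
  have hi : ∀ a b, IntervalIntegrable (fun x => (phasorRate u θ x).im) volume a b :=
    fun a b => hc.intervalIntegrable a b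
  have h1 : ∫ x in T'..T, phasorRate u θ x
      = Complex.log (phasor u θ T) - Complex.log (phasor u θ T') := by
    refine intervalIntegral.integral_eq_sub_of_hasDerivAt
      (f := fun x => Complex.log (phasor u θ x)) (fun x hx => ?_)
      ((continuous_phasorRate hu hθ).intervalIntegrable _ _)
    rw [Set.uIcc_of_le hT] at hx
    refine ((hasDerivAt_phasor hu hθ x).clog_real (Or.inl (hre x hx.2))).congr_deriv ?_
    rw [mul_div_cancel_right₀ _ (phasor_ne_zero hu hθ x)]
  have h2 := congrArg Complex.im h1
  rw [im_integral_phasorRate hu hθ, Complex.sub_im, Complex.log_im, Complex.log_im] at h2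
  rw [angle, angle, ← intervalIntegral.integral_add_adjacent_intervals (hi T' T) (hi T X), h2]
  ring

/-- The symmetry z ↦ -z̄ conjugates the phasor. Positivity of the real part keeps it off the branch
cut, where conjugation would not negate the argument. -/
lemma angle_pi_sub {T X : ℝ} (hre : 0 < (phasor u θ T).re) :
    angle u T X (Real.pi - θ) = -angle u T X θ := by
  have hne : Complex.arg (phasor u θ T) ≠ Real.pi := by
    intro h
    rw [Complex.arg_eq_pi_iff] at h
    linarith [h.1]
  rw [angle, angle]
  simp only [phasor_pi_sub hu hθ, phasorRate_pi_sub hu hθ, Complex.conj_im,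
    intervalIntegral.integral_neg, Complex.arg_conj, if_neg hne]
  ring

lemma continuousAt_angle {T X : ℝ} (hre : 0 < (phasor u θ T).re) :
    ContinuousAt (angle u T X) θ := by
  refine ContinuousAt.add ?_ ?_
  · exact (Complex.continuousAt_arg (Or.inl hre)).comp (f := fun θ => phasor u θ T)
      (continuousAt_phasor hu hθ T)
  · refine intervalIntegral.continuousAt_of_dominated_interval (bound := fun _ => 1) ?_ ?_
      (by simp) ?_
    · filter_upwards [Ioo_mem_nhds hθ.1 hθ.2] with t ht
      exact (continuous_im_phasorRate hu ht).aestronglyMeasurable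
    · exact Eventually.of_forall fun t => Eventually.of_forall fun x _ => abs_im_phasorRate_le x
    · exact Eventually.of_forall fun x _ =>
        Complex.continuous_im.continuousAt.comp (continuousAt_phasorRate hu hθ x)

/-- The angle decreases strictly as the spectral parameter moves along the circle. -/
lemma eventually_angle_lt {T X : ℝ} (hX : u X = Real.pi) (hre : 0 < (phasor u θ T).re) :
    ∀ᶠ t in 𝓝[<] θ, angle u T X θ < angle u T X t := by
  have him := circlePoint_im_pos hθ
  set z := circlePoint θ with hz
  obtain ⟨m, hm, hK⟩ := exists_greenKernel_eq hu him (norm_circlePoint θ) hX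
  -- G(t) has the sign of the sine of the angle difference, and it is also the imaginary part of the
  -- Wronskian at θ and t, since the rest of the product is real.
  set G : ℝ → ℝ := fun t => (starRingEnd ℂ (phasor u θ X) * phasor u t X).im with hG
  set H : ℂ → ℂ := fun ζ => (ζ - z) * greenKernel u X z ζ with hH
  have hHd : HasDerivAt H (greenKernel u X z z) z :=
    hasDerivAt_of_eventuallyEq_sub_mul (Eventually.of_forall fun _ => rfl)
      (continuousAt_greenKernel hu him X)
  have hHc : HasDerivAt (fun t : ℝ => H (circlePoint t))
      ((z * Complex.I) • greenKernel u X z z) θ := 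
    HasDerivAt.scomp (g₁ := H) θ hHd (hasDerivAt_circlePoint θ)
  have hGH : ∀ t ∈ Set.Ioo 0 Real.pi, G t = (H (circlePoint t)).im := by
    intro t ht
    have ht' := circlePoint_im_pos ht
    obtain ⟨p0, p1⟩ := leftSol_conj_of_norm_eq_one hu him (norm_circlePoint θ) X
    obtain ⟨q0, q1⟩ := leftSol_conj_of_norm_eq_one hu ht' (norm_circlePoint t) X
    have e1 : H (circlePoint t) = wronskian (leftSol u z) (leftSol u (circlePoint t)) X :=
      (wronskian_leftSol_leftSol hu him ht' X).symm
    have e2 : starRingEnd ℂ (phasor u θ X) * phasor u t X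
        = (leftSol u z X 0 * leftSol u (circlePoint t) X 0
          - leftSol u z X 1 * leftSol u (circlePoint t) X 1) + H (circlePoint t) := by
      rw [conj_phasor hu hθ, e1, wronskian, phasor]; ring
    have e3 : (leftSol u z X 0 * leftSol u (circlePoint t) X 0
          - leftSol u z X 1 * leftSol u (circlePoint t) X 1).im = 0 := by
      rw [← Complex.conj_eq_iff_im, map_sub, map_mul, map_mul, p0, p1, q0, q1]; ring
    simp only [hG]
    rw [e2, Complex.add_im, e3, zero_add]
  have hGd : HasDerivAt G (-m / 2) θ := by
    have h1 : HasDerivAt (fun t : ℝ => (H (circlePoint t)).im)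
        (((z * Complex.I) • greenKernel u X z z).im) θ :=
      Complex.imCLM.hasFDerivAt.comp_hasDerivAt θ hHc
    -- The factor z from the derivative of exp(iθ) cancels z⁻¹ in the kernel, leaving a derivative
    -- -m/2 < 0.
    have h2 : (z * Complex.I) • greenKernel u X z z = ((-m / 2 : ℝ) : ℂ) * Complex.I := by
      have hz0 := ne_zero_of_im_pos him
      rw [hK, smul_eq_mul]
      push_cast
      field_simp
    rw [h2, Complex.im_ofReal_mul, Complex.I_im, mul_one] at h1
    refine h1.congr_of_eventuallyEq ?_
    filter_upwards [Ioo_mem_nhds hθ.1 hθ.2] with t ht using hGH t ht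
  have hG0 : G θ = 0 := by
    simp only [hG, ← Complex.normSq_eq_conj_mul_self, Complex.ofReal_im]
  have hneg : ∀ᶠ t in 𝓝[<] θ, 0 < G t := by
    have h1 := (hasDerivAt_iff_tendsto_slope.1 hGd).mono_left
      (nhdsWithin_mono θ (fun t (ht : t < θ) => ht.ne))
    have h2 := h1.eventually (gt_mem_nhds (show -m / 2 < 0 by linarith))
    filter_upwards [h2, self_mem_nhdsWithin] with t h3 (h4 : t < θ)
    rw [slope_def_field, hG0, sub_zero] at h3
    by_contra h5
    have : 0 ≤ G t / (t - θ) := div_nonneg_of_nonpos (not_lt.1 h5) (by linarith)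
    linarith
  -- A difference of size less than π has the same sign as its sine.
  have hnear : ∀ᶠ t in 𝓝[<] θ, |angle u T X t - angle u T X θ| < Real.pi := by
    have h1 := ((continuousAt_angle (X := X) hu hθ hre).sub_const (angle u T X θ)).abs
    have h2 : |angle u T X θ - angle u T X θ| < Real.pi := by
      rw [sub_self, abs_zero]; exact Real.pi_pos
    exact (h1.eventually (gt_mem_nhds h2)).filter_mono nhdsWithin_le_nhds
  have hmem : ∀ᶠ t in 𝓝[<] θ, t ∈ Set.Ioo 0 Real.pi :=
    nhdsWithin_le_nhds (Ioo_mem_nhds hθ.1 hθ.2)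
  filter_upwards [hneg, hnear, hmem] with t h1 h2 h3
  have h4 : G t = ‖phasor u θ X‖ * ‖phasor u t X‖ * Real.sin (angle u T X t - angle u T X θ) := by
    simp only [hG]
    have e1 := phasor_eq_norm_mul_exp hu hθ T X
    have e2 := phasor_eq_norm_mul_exp hu h3 T X
    have e3 : starRingEnd ℂ (phasor u θ X) * phasor u t X
        = ((‖phasor u θ X‖ * ‖phasor u t X‖ : ℝ) : ℂ)
          * Complex.exp (((angle u T X t - angle u T X θ : ℝ) : ℂ) * Complex.I) := by
      conv_lhs => rw [e1, e2]
      rw [map_mul, Complex.conj_ofReal, ← Complex.exp_conj, map_mul, Complex.conj_ofReal,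
        Complex.conj_I]
      push_cast
      rw [mul_mul_mul_comm, ← Complex.exp_add]
      congr 2; ring
    rw [e3, Complex.im_ofReal_mul, Complex.exp_ofReal_mul_I_im]
  by_contra h5
  rw [h4] at h1
  have h6 : Real.sin (angle u T X t - angle u T X θ) ≤ 0 :=
    Real.sin_nonpos_of_nonpos_of_neg_pi_le (by linarith) (by linarith [(abs_lt.1 h2).1])
  have := mul_nonpos_of_nonneg_of_nonpos
    (mul_nonneg (norm_nonneg (phasor u θ X)) (norm_nonneg (phasor u t X))) h6
  linarith

end Angle

/-! ### The total phase and its range -/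

/-- The angle function on the circle at a point where the potential equals `π`. -/
lemma exists_angle {u : ℝ → ℝ} (hu : IsMonotoneKink u) {X : ℝ} (hX : u X = Real.pi) :
    ∃ A : ℝ → ℝ, ContinuousOn A (Set.Ioo 0 Real.pi) ∧ StrictAntiOn A (Set.Ioo 0 Real.pi) ∧
      (∀ θ ∈ Set.Ioo 0 Real.pi,
        phasor u θ X = ‖phasor u θ X‖ * Complex.exp (A θ * Complex.I)) ∧
      (∀ θ ∈ Set.Ioo 0 Real.pi, A (Real.pi - θ) = -A θ) ∧
      Tendsto A (𝓝[>] 0) (𝓝 ((∫ x in Set.Iic X, Real.sin (u x / 2)) / 2)) := by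
  obtain ⟨T, hT⟩ := exists_abs_arg_phasor_lt hu one_pos
  have hre : ∀ θ ∈ Set.Ioo 0 Real.pi, 0 < (phasor u θ T).re := fun θ hθ => (hT T le_rfl θ hθ).1
  have hcont : ContinuousOn (angle u T X) (Set.Ioo 0 Real.pi) := fun θ hθ =>
    (continuousAt_angle hu hθ (hre θ hθ)).continuousWithinAt
  refine ⟨angle u T X, hcont, strictAntiOn_of_eventually_lt hcont fun θ hθ =>
    eventually_angle_lt hu hθ hX (hre θ hθ), fun θ hθ => phasor_eq_norm_mul_exp hu hθ T X,
    fun θ hθ => angle_pi_sub hu hθ (hre θ hθ), ?_⟩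
  rw [Metric.tendsto_nhds]
  intro ε hε
  -- The error budget is ε/4 for the argument at T', ε/4 for half the tail of the sine integral, and
  -- ε/2 for the interval [T', X], where θ is small only after T' is fixed.
  obtain ⟨T₁, hT₁⟩ := exists_abs_arg_phasor_lt hu (half_pos (half_pos hε))
  have htail : ∀ᶠ t in atBot, |∫ x in Set.Iic t, Real.sin (u x / 2)| < ε / 2 := by
    have h1 := (tendsto_integral_Iic_zero (f := fun x => Real.sin (u x / 2)) (μ := volume)
      tendsto_id).abs
    rw [abs_zero] at h1
    exact h1.eventually (gt_mem_nhds (half_pos hε))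
  obtain ⟨T', hT'₁, hT'₂⟩ := (htail.and (eventually_le_atBot (min T T₁))).exists
  set S := ∫ x in T'..X, Real.sin (u x / 2) with hS
  have hsplit : ∫ x in Set.Iic X, Real.sin (u x / 2)
      = (∫ x in Set.Iic T', Real.sin (u x / 2)) + S := by
    have := intervalIntegral.integral_Iic_sub_Iic (hu.integrable_sin.integrableOn (s := Set.Iic T'))
      (hu.integrable_sin.integrableOn (s := Set.Iic X))
    rw [hS, ← this]; ring
  have hsmall : ∀ᶠ θ in 𝓝[>] (0 : ℝ),
      |Real.sin θ| / 2 * |X - T'| + |(Real.cos θ - 1) / 2 * S| < ε / 2 := by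
    have h1 : ContinuousAt (fun θ : ℝ => |Real.sin θ| / 2 * |X - T'|
        + |(Real.cos θ - 1) / 2 * S|) 0 := by fun_prop
    have h2 : (fun θ : ℝ => |Real.sin θ| / 2 * |X - T'| + |(Real.cos θ - 1) / 2 * S|) 0 < ε / 2 := by
      simp; exact hε
    exact (h1.eventually (gt_mem_nhds h2)).filter_mono nhdsWithin_le_nhds
  filter_upwards [hsmall, Ioo_mem_nhdsGT Real.pi_pos] with θ h1 hθ
  have e1 : angle u T X θ = angle u T' X θ :=
    (angle_eq_angle hu hθ (hT'₂.trans (min_le_left _ _)) fun x hx => (hT x hx θ hθ).1).symm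
  have hi := (continuous_im_phasorRate hu hθ).intervalIntegrable (μ := volume) T' X
  have hi' : IntervalIntegrable (fun x => Real.cos θ / 2 * Real.sin (u x / 2)) volume T' X :=
    (continuous_const.mul hu.continuous_sin).intervalIntegrable _ _
  have h2 : |(∫ x in T'..X, (phasorRate u θ x).im) - Real.cos θ / 2 * S|
      ≤ |Real.sin θ| / 2 * |X - T'| := by
    rw [hS, ← intervalIntegral.integral_const_mul, ← intervalIntegral.integral_sub hi hi']
    exact intervalIntegral.norm_integral_le_of_norm_le_const (C := |Real.sin θ| / 2)
      (f := fun x => (phasorRate u θ x).im - Real.cos θ / 2 * Real.sin (u x / 2))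
      fun x _ => abs_im_phasorRate_sub_le x
  have h3 := (hT₁ T' (hT'₂.trans (min_le_right _ _)) θ hθ).2
  rw [Real.dist_eq, e1, angle, hsplit]
  have e2 : Complex.arg (phasor u θ T') + (∫ x in T'..X, (phasorRate u θ x).im)
      - ((∫ x in Set.Iic T', Real.sin (u x / 2)) + S) / 2
      = Complex.arg (phasor u θ T')
        + ((∫ x in T'..X, (phasorRate u θ x).im) - Real.cos θ / 2 * S)
        + (Real.cos θ - 1) / 2 * S - (∫ x in Set.Iic T', Real.sin (u x / 2)) / 2 := by ring
  rw [e2]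
  have h4 : |(∫ x in Set.Iic T', Real.sin (u x / 2)) / 2| < ε / 4 := by
    rw [abs_div, abs_two]; linarith
  refine lt_of_le_of_lt (abs_sub _ _) ?_
  have h5 := abs_add_le (Complex.arg (phasor u θ T')
        + ((∫ x in T'..X, (phasorRate u θ x).im) - Real.cos θ / 2 * S)) ((Real.cos θ - 1) / 2 * S)
  have h6 := abs_add_le (Complex.arg (phasor u θ T'))
    ((∫ x in T'..X, (phasorRate u θ x).im) - Real.cos θ / 2 * S)
  linarith

lemma exists_circlePoint_eq {z : ℂ} (hz : 0 < z.im) (h1 : ‖z‖ = 1) :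
    ∃ θ ∈ Set.Ioo 0 Real.pi, circlePoint θ = z := by
  refine ⟨Complex.arg z, ⟨?_, ?_⟩, ?_⟩
  · refine lt_of_le_of_ne (Complex.arg_nonneg_iff.2 hz.le) fun h => ?_
    exact hz.ne (Complex.arg_eq_zero_iff.1 h.symm).2.symm
  · refine lt_of_le_of_ne (Complex.arg_le_pi z) fun h => ?_
    exact hz.ne (Complex.arg_eq_pi_iff.1 h).2.symm
  · have := Complex.norm_mul_exp_arg_mul_I z
    rwa [h1, Complex.ofReal_one, one_mul] at this

lemma injOn_circlePoint : Set.InjOn circlePoint (Set.Ioo 0 Real.pi) := by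
  intro θ hθ t ht h
  have := congrArg Complex.re h
  rw [circlePoint_re, circlePoint_re] at this
  exact Real.injOn_cos (Set.Ioo_subset_Icc_self hθ) (Set.Ioo_subset_Icc_self ht) this

/-- The total phase: its values in `πℤ` detect the eigenvalues on the unit circle. -/
lemma exists_phase {u : ℝ → ℝ} (hu : IsMonotoneKink u) :
    ∃ δ : ℝ → ℝ, ContinuousOn δ (Set.Ioo 0 Real.pi) ∧ StrictAntiOn δ (Set.Ioo 0 Real.pi) ∧
      (∀ θ ∈ Set.Ioo 0 Real.pi,
        IsEigenvalue u (circlePoint θ) ↔ ∃ k : ℤ, (k : ℝ) * Real.pi = δ θ) ∧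
      (∀ θ ∈ Set.Ioo 0 Real.pi, δ (Real.pi - θ) = -δ θ) ∧
      Tendsto δ (𝓝[>] 0) (𝓝 ((∫ x, Real.sin (u x / 2)) / 2)) := by
  obtain ⟨X, hX⟩ := hu.exists_eq_pi
  obtain ⟨A, hAc, hAa, hAe, hAs, hAl⟩ := exists_angle hu hX
  obtain ⟨B, hBc, hBa, hBe, hBs, hBl⟩ := exists_angle hu.reflect (reflect_neg_eq_pi hX)
  refine ⟨fun θ => A θ + B θ, hAc.add hBc, hAa.add hBa, fun θ hθ => ?_, fun θ hθ => ?_, ?_⟩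
  · have him := circlePoint_im_pos hθ
    rw [isEigenvalue_iff hu him, ← wronskian_leftSol_rightSol hu him X, ← Real.sin_eq_zero_iff]
    -- On the circle the Wronskian of the two ends is -i times the imaginary part of the product of
    -- the two phasors, so it vanishes iff the sum of their angles lies in πℤ.
    have e1 : wronskian (leftSol u (circlePoint θ)) (rightSol u (circlePoint θ)) X
        = -((((phasor u θ X) * phasor (reflect u) θ (-X)).im : ℝ) : ℂ) * Complex.I := by
      have h1 := Complex.sub_conj (phasor u θ X * phasor (reflect u) θ (-X))
      rw [map_mul, conj_phasor hu hθ, conj_phasor hu.reflect hθ] at h1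
      have h2 : wronskian (leftSol u (circlePoint θ)) (rightSol u (circlePoint θ)) X
          = -(leftSol u (circlePoint θ) X 0 * leftSol (reflect u) (circlePoint θ) (-X) 1
            + leftSol u (circlePoint θ) X 1 * leftSol (reflect u) (circlePoint θ) (-X) 0) := by
        simp [wronskian, rightSol, reflectSol]; ring
      rw [h2]
      push_cast at h1
      simp only [phasor] at h1 ⊢
      linear_combination -h1 / 2
    have e2 : phasor u θ X * phasor (reflect u) θ (-X)
        = ((‖phasor u θ X‖ * ‖phasor (reflect u) θ (-X)‖ : ℝ) : ℂ)
          * Complex.exp (((A θ + B θ : ℝ) : ℂ) * Complex.I) := by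
      conv_lhs => rw [hAe θ hθ, hBe θ hθ]
      push_cast
      rw [mul_mul_mul_comm, ← Complex.exp_add, add_mul]
    rw [e1, e2, Complex.im_ofReal_mul, Complex.exp_ofReal_mul_I_im]
    have n1 : ‖phasor u θ X‖ ≠ 0 := norm_ne_zero_iff.2 (phasor_ne_zero hu hθ X)
    have n2 : ‖phasor (reflect u) θ (-X)‖ ≠ 0 :=
      norm_ne_zero_iff.2 (phasor_ne_zero hu.reflect hθ (-X))
    rw [mul_eq_zero, or_iff_left Complex.I_ne_zero, neg_eq_zero, Complex.ofReal_eq_zero,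
      mul_eq_zero, or_iff_right (mul_ne_zero n1 n2)]
  · simp only [hAs θ hθ, hBs θ hθ]; ring
  · have h1 := hAl.add hBl
    have h2 : (∫ x in Set.Iic X, Real.sin (u x / 2)) / 2
        + (∫ x in Set.Iic (-X), Real.sin (reflect u x / 2)) / 2
        = (∫ x, Real.sin (u x / 2)) / 2 := by
      simp only [sin_reflect]
      rw [integral_comp_neg_Iic (-X) (fun x => Real.sin (u x / 2)), neg_neg,
        ← intervalIntegral.integral_Iic_add_Ioi (b := X) hu.integrable_sin.integrableOn
          hu.integrable_sin.integrableOn]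
      ring
    rwa [h2] at h1

/-- The range of an odd (about `π / 2`) strictly decreasing function on `(0, π)`. -/
lemma image_Ioo_of_strictAntiOn {δ : ℝ → ℝ} {L : ℝ} (hc : ContinuousOn δ (Set.Ioo 0 Real.pi))
    (ha : StrictAntiOn δ (Set.Ioo 0 Real.pi))
    (hs : ∀ θ ∈ Set.Ioo 0 Real.pi, δ (Real.pi - θ) = -δ θ) (hl : Tendsto δ (𝓝[>] 0) (𝓝 L)) :
    δ '' Set.Ioo 0 Real.pi = Set.Ioo (-L) L := by
  have hsymm : ∀ θ ∈ Set.Ioo 0 Real.pi, Real.pi - θ ∈ Set.Ioo 0 Real.pi := fun θ hθ =>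
    ⟨by linarith [hθ.2], by linarith [hθ.1]⟩
  have hlt : ∀ θ ∈ Set.Ioo 0 Real.pi, δ θ < L := fun θ hθ => by
    -- Comparing with θ/2 makes the inequality δ(θ) < L strict although the limit gives only ≤.
    have hθ' : θ / 2 ∈ Set.Ioo 0 Real.pi := ⟨half_pos hθ.1, (half_lt_self hθ.1).trans hθ.2⟩
    refine (ha hθ' hθ (half_lt_self hθ.1)).trans_le (ge_of_tendsto hl ?_)
    filter_upwards [Ioo_mem_nhdsGT hθ'.1] with t ht
    exact (ha ⟨ht.1, ht.2.trans hθ'.2⟩ hθ' ht.2).le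
  have hex : ∀ y < L, ∃ θ ∈ Set.Ioo 0 Real.pi, y < δ θ := fun y hy => by
    obtain ⟨θ, h1, h2⟩ := ((hl.eventually (lt_mem_nhds hy)).and (Ioo_mem_nhdsGT Real.pi_pos)).exists
    exact ⟨θ, h2, h1⟩
  ext y
  constructor
  · rintro ⟨θ, hθ, rfl⟩
    have := hlt _ (hsymm θ hθ)
    rw [hs θ hθ] at this
    exact ⟨by linarith, hlt θ hθ⟩
  · rintro ⟨h1, h2⟩
    obtain ⟨θ₁, hθ₁, hy₁⟩ := hex y h2
    obtain ⟨θ₂, hθ₂, hy₂⟩ := hex (-y) (by linarith)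
    refine isPreconnected_Ioo.intermediate_value (hsymm θ₂ hθ₂) hθ₁ hc ⟨?_, hy₁.le⟩
    rw [hs θ₂ hθ₂]
    linarith

end SineGordonScattering
end

/-! ### Counting the eigenvalues -/

open SineGordonScattering in
theorem mainTheorem2 (u : ℝ → ℝ) (hu : SineGordonScattering.IsMonotoneKink u)
    (N : ℤ)
    (hN : IsGreatest {n : ℤ | 2 * (n : ℝ) * Real.pi < ∫ x : ℝ, Real.sin (u x / 2)} N) :
    {z : ℂ | 0 < z.im ∧ SineGordonScattering.IsEigenvalue u z}.Finite ∧
    ({z : ℂ | 0 < z.im ∧ SineGordonScattering.IsEigenvalue u z}.ncard : ℤ) = 2 * N + 1 ∧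
    (∀ z : ℂ, 0 < z.im → SineGordonScattering.IsEigenvalue u z →
      ‖z‖ = 1 ∧ SineGordonScattering.IsSimple u z) ∧
    SineGordonScattering.IsEigenvalue u Complex.I := by
  obtain ⟨δ, hc, ha, he, hs, hl⟩ := exists_phase hu
  set L := (∫ x, Real.sin (u x / 2)) / 2 with hL
  have hpi := Real.pi_pos
  have himage := image_Ioo_of_strictAntiOn hc ha hs hl
  have hcircle : ∀ z : ℂ, 0 < z.im → IsEigenvalue u z → ‖z‖ = 1 := by
    rintro z hz ⟨-, hne⟩
    by_contra h1
    obtain ⟨Φ, hΦ, hΦ0⟩ := (Submodule.ne_bot_iff _).1 hne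
    obtain ⟨hsol, hL2⟩ : IsSolution u z Φ ∧ MemLp Φ 2 volume := hΦ
    exact hΦ0 (funext (eq_zero_of_norm_ne_one hu hz hsol ((memLp_two_iff hsol.continuous).1 hL2) h1))
  have hmem : ∀ k : ℤ, (k : ℝ) * Real.pi < L ↔ k ≤ N := fun k => by
    constructor
    · intro h
      refine hN.2 ?_
      simp only [Set.mem_ofPred_eq]
      linarith
    · intro h
      have h1 : 2 * (N : ℝ) * Real.pi < ∫ x : ℝ, Real.sin (u x / 2) := hN.1
      have h2 : (k : ℝ) * Real.pi ≤ N * Real.pi :=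
        mul_le_mul_of_nonneg_right (by exact_mod_cast h) hpi.le
      linarith
  have hrange : ∀ k : ℤ, k ∈ Set.Icc (-N) N ↔ (k : ℝ) * Real.pi ∈ Set.Ioo (-L) L := fun k => by
    have h1 := hmem k
    have h2 := hmem (-k)
    push_cast at h2
    constructor
    · rintro ⟨h3, h4⟩
      exact ⟨by linarith [h2.2 (by linarith)], h1.2 h4⟩
    · rintro ⟨h3, h4⟩
      exact ⟨by linarith [h2.1 (by linarith)], h1.1 h4⟩
  have hchoose : ∀ k : ℤ, ∃ θ : ℝ, k ∈ Set.Icc (-N) N →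
      θ ∈ Set.Ioo 0 Real.pi ∧ δ θ = k * Real.pi := fun k => by
    by_cases hk : k ∈ Set.Icc (-N) N
    · have h1 := (hrange k).1 hk
      rw [← himage] at h1
      obtain ⟨θ, h2, h3⟩ := h1
      exact ⟨θ, fun _ => ⟨h2, h3⟩⟩
    · exact ⟨0, fun h => (hk h).elim⟩
  choose τ hτ using hchoose
  have hset : {z : ℂ | 0 < z.im ∧ IsEigenvalue u z}
      = (fun k => circlePoint (τ k)) '' Set.Icc (-N) N := by
    ext z
    constructor
    · rintro ⟨hz, hev⟩
      obtain ⟨θ, hθ, rfl⟩ := exists_circlePoint_eq hz (hcircle z hz hev)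
      obtain ⟨k, hk⟩ := (he θ hθ).1 hev
      have hkr : k ∈ Set.Icc (-N) N := by
        rw [hrange, ← himage, hk]
        exact Set.mem_image_of_mem δ hθ
      obtain ⟨h1, h2⟩ := hτ k hkr
      refine ⟨k, hkr, ?_⟩
      rw [hk] at h2
      simp only [ha.injOn h1 hθ h2]
    · rintro ⟨k, hk, rfl⟩
      obtain ⟨h1, h2⟩ := hτ k hk
      exact ⟨circlePoint_im_pos h1, (he _ h1).2 ⟨k, h2.symm⟩⟩
  have hinj : Set.InjOn (fun k => circlePoint (τ k)) (Set.Icc (-N) N) := by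
    intro k hk l hl' h
    obtain ⟨h1, h2⟩ := hτ k hk
    obtain ⟨h3, h4⟩ := hτ l hl'
    have h5 := injOn_circlePoint h1 h3 h
    rw [h5, h4] at h2
    exact_mod_cast (mul_right_cancel₀ hpi.ne' h2).symm
  have hhalf : Real.pi / 2 ∈ Set.Ioo 0 Real.pi := ⟨half_pos hpi, half_lt_self hpi⟩
  have hδ0 : δ (Real.pi / 2) = 0 := by
    have h1 := hs _ hhalf
    rw [sub_half] at h1
    linarith
  -- Nonnegativity of N is needed because the cardinality 2N + 1 of [-N, N] is a truncated natural
  -- number. It holds since δ(π/2) = 0 lies in (-L, L), so L > 0.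
  have hN0 : 0 ≤ N := by
    have h1 : δ (Real.pi / 2) ∈ Set.Ioo (-L) L := himage ▸ Set.mem_image_of_mem δ hhalf
    rw [← hmem 0]
    simpa [hδ0] using h1.2
  refine ⟨?_, ?_, fun z hz hev => ⟨hcircle z hz hev, isSimple_of_norm_eq_one hu hz
    (hcircle z hz hev) ((isEigenvalue_iff hu hz).1 hev)⟩, ?_⟩
  · rw [hset]
    exact (Set.finite_Icc _ _).image _
  · rw [hset, hinj.ncard_image, ← Finset.coe_Icc, Set.ncard_coe_finset, Int.card_Icc]
    omega
  · have h1 := (he _ hhalf).2 ⟨0, by simp [hδ0]⟩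
    have h2 : circlePoint (Real.pi / 2) = Complex.I := by
      apply Complex.ext
      · rw [circlePoint_re]; simp
      · rw [circlePoint_im]; simp
    rwa [h2] at h1
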